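/- Let $d\ge 1$ and let $U\subset\mathbb{R}^d$ be a connected polytope (a bounded open set lying on one side of its boundary, i.e. $U=\operatorname{int}\overline U$) of diameter $h_U$ which admits a finite matching partition $\mathcal{S}_U$ into nondegenerate simplices: $\overline U$ is the union of the closed simplices, and any two closed simplices meet in the convex hull of their common vertices (possibly empty). For $S\in\mathcal S_U$ denote by $h_S$ its diameter and by $r_S$ its inradius, and assume that there is a real number $\varrho>0$ such that $$\varrho^2 h_U\le\varrho h_S\le r_S\qquad\text{for all } S\in\mathcal{S}_U .$$ Let $l\ge 0$, $s\in\{1,\ldots,l+1\}$ and $p\in[1,+\infty]$. Let $W^{s,p}(U)$ be the space of functions whose weak derivatives up to order $s$ are in $L^p(U)$, with seminorm $|v|_{W^{s,p}(U)}=\sum_{\alpha\in\mathbb{N}^d,\,|\alpha|=s}\|\partial^\alpha v\|_{L^p(U)}$. For $v\in W^{1,1}(U)$, let $\pi^l v$ be the elliptic projection of $v$, that is, the unique polynomial of degree at most $l$ such that $\int_U\nabla\pi^lv\cdot\nabla w=\int_U\nabla v\cdot\nabla w$ for all polynomials $w$ of degree at most $l$, and $\int_U(\pi^l v-v)=0$.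 Let $\mathcal F_U$ be the set of (relatively open) hyperplanar faces of $U$, let $W^{m,p}(\mathcal F_U)$ be the set of functions $w$ such that, for all $|\alpha|\le m$, $\partial^\alpha w$ has a trace on the faces belonging to $L^p$, and put $|w|_{W^{m,p}(\mathcal F_U)}=\sum_{\alpha\in\mathbb{N}^d,\,|\alpha|=m}\|\partial^\alpha w\|_{L^p(\bigcup_{F\in\mathcal F_U}F)}$, where traces are understood and the norm is taken with respect to the $(d-1)$-dimensional surface measure. Then there exists a real number $C>0$ depending only on $d$, $\varrho$, $l$, $s$ and $p$ such that, for all $m\in\{0,\ldots,s-1\}$ and all $v\in W^{s,p}(U)$, one has $v-\pi^lv\in W^{m,p}(\mathcal F_U)$ and $$h_U^{1/p}\,|v-\pi^l v|_{W^{m,p}(\mathcal F_U)}\le C\,h_U^{s-m}\,|v|_{W^{s,p}(U)},$$ with $h_U^{1/p}=1$ if $p=+\infty$. -/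

import Mathlib

open MeasureTheory Set
open scoped ENNReal ContDiff

noncomputable section

/-- `∂^α φ = ∂_1^{α_1} ⋯ ∂_d^{α_d} φ` (classical partial derivatives). -/
def multiDeriv {d : ℕ} (α : Fin d → ℕ) (φ : EuclideanSpace ℝ (Fin d) → ℝ) :
    EuclideanSpace ℝ (Fin d) → ℝ :=
  (List.finRange d).foldr
    (fun i g => (fun (f : EuclideanSpace ℝ (Fin d) → ℝ) x =>
      fderiv ℝ f x (EuclideanSpace.single i 1))^[α i] g) φ

/-- `w` is the weak derivative `∂^α v` on the open set `U`. -/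
def IsWeakDeriv {d : ℕ} (U : Set (EuclideanSpace ℝ (Fin d))) (α : Fin d → ℕ)
    (v w : EuclideanSpace ℝ (Fin d) → ℝ) : Prop :=
  LocallyIntegrableOn v U volume ∧ LocallyIntegrableOn w U volume ∧
    ∀ φ : EuclideanSpace ℝ (Fin d) → ℝ, ContDiff ℝ ∞ φ → HasCompactSupport φ → tsupport φ ⊆ U →
      ∫ x in U, v x * multiDeriv α φ x = (-1) ^ (∑ i, α i) * ∫ x in U, w x * φ x

open Classical in
/-- A representative of the weak derivative `∂^α v` on `U` (which is unique up to null sets);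
zero if there is none. -/
def weakDeriv {d : ℕ} (U : Set (EuclideanSpace ℝ (Fin d))) (α : Fin d → ℕ)
    (v : EuclideanSpace ℝ (Fin d) → ℝ) : EuclideanSpace ℝ (Fin d) → ℝ :=
  if h : ∃ w, IsWeakDeriv U α v w then h.choose else 0

/-- `v ∈ W^{s,p}(U)`: all weak derivatives of order at most `s` (including `v` itself) exist and
lie in `L^p(U)`. -/
def MemSobolev {d : ℕ} (U : Set (EuclideanSpace ℝ (Fin d))) (s : ℕ) (p : ℝ≥0∞)
    (v : EuclideanSpace ℝ (Fin d) → ℝ) : Prop :=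
  ∀ α : Fin d → ℕ, ∑ i, α i ≤ s → ∃ w, IsWeakDeriv U α v w ∧ MemLp w p (volume.restrict U)

/-- `|v|_{W^{s,p}(U)} = ∑_{|α| = s} ‖∂^α v‖_{L^p(U)}`. -/
def sobolevSeminorm {d : ℕ} (U : Set (EuclideanSpace ℝ (Fin d))) (s : ℕ) (p : ℝ≥0∞)
    (v : EuclideanSpace ℝ (Fin d) → ℝ) : ℝ≥0∞ :=
  ∑ α ∈ Finset.piAntidiag (Finset.univ : Finset (Fin d)) s,
    eLpNorm (weakDeriv U α v) p (volume.restrict U)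

/-- The value of a `d`-variate polynomial at a point of `ℝ^d`. -/
def polyEval {d : ℕ} (q : MvPolynomial (Fin d) ℝ) (x : EuclideanSpace ℝ (Fin d)) : ℝ :=
  MvPolynomial.eval (fun i => x i) q

/-- `q` is a polynomial of degree at most `l` with `∫_U ∇q · ∇w = ∫_U ∇v · ∇w` for all polynomials
`w` of degree at most `l`, and `∫_U (q - v) = 0`. -/
def IsEllipticProjection {d : ℕ} (U : Set (EuclideanSpace ℝ (Fin d))) (l : ℕ)
    (v : EuclideanSpace ℝ (Fin d) → ℝ) (q : MvPolynomial (Fin d) ℝ) : Prop :=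
  q.totalDegree ≤ l ∧
  (∀ w : MvPolynomial (Fin d) ℝ, w.totalDegree ≤ l →
    ∫ x in U, ∑ i, polyEval (MvPolynomial.pderiv i q) x * polyEval (MvPolynomial.pderiv i w) x =
      ∫ x in U, ∑ i, weakDeriv U (Pi.single i 1) v x * polyEval (MvPolynomial.pderiv i w) x) ∧
  ∫ x in U, (polyEval q x - v x) = 0

open Classical in
/-- The elliptic projector `π^l v`, as a polynomial function; its defining equations have exactly
one solution for `v ∈ W^{1,1}(U)`. -/
def ellipticProjector {d : ℕ} (U : Set (EuclideanSpace ℝ (Fin d))) (l : ℕ)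
    (v : EuclideanSpace ℝ (Fin d) → ℝ) : EuclideanSpace ℝ (Fin d) → ℝ :=
  if h : ∃ q, IsEllipticProjection U l v q then polyEval h.choose else 0

/-- The inradius of a set: the supremum of the radii of the balls contained in it. -/
def setInradius {d : ℕ} (A : Set (EuclideanSpace ℝ (Fin d))) : ℝ :=
  sSup {r : ℝ | ∃ x, Metric.ball x r ⊆ A}

/-- `U` is a polytope (an open set without cracks, that is, `U = interior (closure U)`), and `𝒮`
is a matching partition of `U` into nondegenerate simplices. A simplex is given by the set of its
`d + 1` vertices; two of the closed simplices meet in the convex hull of their common vertices, so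
that distinct open simplices are disjoint. -/
structure IsSimplicialPartition {d : ℕ} (U : Set (EuclideanSpace ℝ (Fin d)))
    (𝒮 : Finset (Finset (EuclideanSpace ℝ (Fin d)))) : Prop where
  interior_closure : interior (closure U) = U
  closure_eq : closure U = ⋃ S ∈ 𝒮, convexHull ℝ (S : Set (EuclideanSpace ℝ (Fin d)))
  card_eq : ∀ S ∈ 𝒮, S.card = d + 1
  indep : ∀ S ∈ 𝒮, AffineIndependent ℝ ((↑) : S → EuclideanSpace ℝ (Fin d))
  inter_eq : ∀ S ∈ 𝒮, ∀ T ∈ 𝒮,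
    convexHull ℝ (S : Set (EuclideanSpace ℝ (Fin d))) ∩ convexHull ℝ (T : Set _) =
      convexHull ℝ ((S : Set _) ∩ (T : Set _))

/-- In a neighbourhood of `x`, the set `U` is the open half-space with outward unit normal `ν`
whose boundary hyperplane contains `x`. -/
def IsHalfSpaceNear {d : ℕ} (U : Set (EuclideanSpace ℝ (Fin d)))
    (ν x : EuclideanSpace ℝ (Fin d)) : Prop :=
  ‖ν‖ = 1 ∧ ∃ ε > 0, ∀ y ∈ Metric.ball x ε, (y ∈ U ↔ inner ℝ ν (y - x) < 0)

/-- The set `F_U` of hyperplanar faces of `U`: for each hyperplane `{⟪ν, x⟫ = c}` with a choice of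
side, the set of its points near which `U` is the half-space `{⟪ν, x⟫ < c}`, if nonempty. These
are disjoint relatively open subsets of hyperplanes. -/
def hyperplanarFaces {d : ℕ} (U : Set (EuclideanSpace ℝ (Fin d))) :
    Set (Set (EuclideanSpace ℝ (Fin d))) :=
  {F | F.Nonempty ∧ ∃ (ν : EuclideanSpace ℝ (Fin d)) (c : ℝ),
    F = {x | inner ℝ ν x = c ∧ IsHalfSpaceNear U ν x}}

open Classical in
/-- The outward unit normal of `U` at the points of its hyperplanar faces. -/
def outwardNormal {d : ℕ} (U : Set (EuclideanSpace ℝ (Fin d)))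
    (x : EuclideanSpace ℝ (Fin d)) : EuclideanSpace ℝ (Fin d) :=
  if h : ∃ ν, IsHalfSpaceNear U ν x then h.choose else 0

/-- The `(d-1)`-dimensional surface measure on the union of the hyperplanar faces of `U`
(`d ≥ 1`). -/
def faceMeasure {d : ℕ} (U : Set (EuclideanSpace ℝ (Fin d))) :
    Measure (EuclideanSpace ℝ (Fin d)) :=
  (Measure.euclideanHausdorffMeasure (d - 1)).restrict (⋃₀ hyperplanarFaces U)

/-- `g` is the trace of `w ∈ W^{1,1}(U)` on the hyperplanar faces of `U`, characterised by Green's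
formula `∫_U (w ∂_i φ + ∂_i w φ) = ∫_{∂U} g φ n_i` for the smooth compactly supported functions `φ`
on `ℝ^d` whose support meets the boundary of `U` only in the (relatively open) faces. -/
def IsTrace {d : ℕ} (U : Set (EuclideanSpace ℝ (Fin d)))
    (w g : EuclideanSpace ℝ (Fin d) → ℝ) : Prop :=
  LocallyIntegrableOn g (⋃₀ hyperplanarFaces U) (Measure.euclideanHausdorffMeasure (d - 1)) ∧
  ∀ φ : EuclideanSpace ℝ (Fin d) → ℝ, ContDiff ℝ ∞ φ → HasCompactSupport φ →
    tsupport φ ∩ frontier U ⊆ ⋃₀ hyperplanarFaces U → ∀ i : Fin d,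
      ∫ x in U, (w x * fderiv ℝ φ x (EuclideanSpace.single i 1) +
          weakDeriv U (Pi.single i 1) w x * φ x) =
        ∫ x, g x * φ x * outwardNormal U x i ∂(faceMeasure U)

open Classical in
/-- The trace of `w` on the hyperplanar faces of `U` (unique up to null sets of the surface
measure); zero if there is none. -/
def faceTrace {d : ℕ} (U : Set (EuclideanSpace ℝ (Fin d)))
    (w : EuclideanSpace ℝ (Fin d) → ℝ) : EuclideanSpace ℝ (Fin d) → ℝ :=
  if h : ∃ g, IsTrace U w g then h.choose else 0

/-- `w ∈ W^{m,p}(F_U)`: all derivatives `∂^α w` of order at most `m` have a trace on the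
hyperplanar faces of `U`, which lies in `L^p`. -/
def MemFaceSobolev {d : ℕ} (U : Set (EuclideanSpace ℝ (Fin d))) (m : ℕ) (p : ℝ≥0∞)
    (w : EuclideanSpace ℝ (Fin d) → ℝ) : Prop :=
  ∀ α : Fin d → ℕ, ∑ i, α i ≤ m →
    ∃ g, IsTrace U (weakDeriv U α w) g ∧ MemLp g p (faceMeasure U)

/-- The broken seminorm `|w|_{W^{m,p}(F_U)} = ∑_{|α| = m} ‖∂^α w‖_{L^p(⋃ F_U)}`, with all
`α ∈ ℕ^d` and the traces of `∂^α w` on the faces. -/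
def faceSeminorm {d : ℕ} (U : Set (EuclideanSpace ℝ (Fin d))) (m : ℕ) (p : ℝ≥0∞)
    (w : EuclideanSpace ℝ (Fin d) → ℝ) : ℝ≥0∞ :=
  ∑ α ∈ Finset.piAntidiag (Finset.univ : Finset (Fin d)) m,
    eLpNorm (faceTrace U (weakDeriv U α w)) p (faceMeasure U)

end

noncomputable section

variable {d : ℕ}

local notation "𝔼" => EuclideanSpace ℝ (Fin d)

/-- The classical partial derivative `∂_i f`. -/
def partialDeriv (i : Fin d) (f : 𝔼 → ℝ) (x : 𝔼) : ℝ := fderiv ℝ f x (EuclideanSpace.single i 1)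

theorem contDiff_partialDeriv (i : Fin d) {f : 𝔼 → ℝ} (hf : ContDiff ℝ ∞ f) :
    ContDiff ℝ ∞ (partialDeriv i f) :=
  (hf.fderiv_right (m := ∞) (by simp)).clm_apply contDiff_const

theorem tsupport_partialDeriv (i : Fin d) (f : 𝔼 → ℝ) :
    tsupport (partialDeriv i f) ⊆ tsupport f :=
  tsupport_fderiv_apply_subset ℝ _

theorem partialDeriv_comm (i j : Fin d) {f : 𝔼 → ℝ} (hf : ContDiff ℝ ∞ f) :
    partialDeriv i (partialDeriv j f) = partialDeriv j (partialDeriv i f) := by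
  funext x
  have hsymm : IsSymmSndFDerivAt ℝ f x :=
    hf.contDiffAt.isSymmSndFDerivAt (by simpa using WithTop.coe_le_coe.2 (le_top : (2 : ℕ∞) ≤ ⊤))
  have hd : DifferentiableAt ℝ (fderiv ℝ f) x :=
    ((hf.fderiv_right (m := ∞) (by simp)).differentiable (by simp)) x
  have key : ∀ k l : Fin d, partialDeriv k (partialDeriv l f) x =
      fderiv ℝ (fderiv ℝ f) x (EuclideanSpace.single k 1) (EuclideanSpace.single l 1) := by
    intro k l
    change fderiv ℝ (fun y => fderiv ℝ f y (EuclideanSpace.single l 1)) x _ = _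
    rw [fderiv_clm_apply hd (by fun_prop)]
    simp
  rw [key, key]
  exact hsymm.eq _ _

theorem contDiff_partialDeriv_iterate (i : Fin d) (n : ℕ) {f : 𝔼 → ℝ} (hf : ContDiff ℝ ∞ f) :
    ContDiff ℝ ∞ ((partialDeriv i)^[n] f) := by
  induction n with
  | zero => exact hf
  | succ n ih => rw [Function.iterate_succ_apply']; exact contDiff_partialDeriv i ih

theorem partialDeriv_iterate_comm (i j : Fin d) (n : ℕ) {f : 𝔼 → ℝ} (hf : ContDiff ℝ ∞ f) :
    partialDeriv i ((partialDeriv j)^[n] f) = (partialDeriv j)^[n] (partialDeriv i f) := by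
  induction n with
  | zero => rfl
  | succ n ih =>
    rw [Function.iterate_succ_apply', Function.iterate_succ_apply', ← ih]
    exact partialDeriv_comm _ _ (contDiff_partialDeriv_iterate j n hf)

/-- Iterated partial derivatives along a list of coordinates. -/
def listDeriv (α : Fin d → ℕ) (L : List (Fin d)) (f : 𝔼 → ℝ) : 𝔼 → ℝ :=
  L.foldr (fun i g => (partialDeriv i)^[α i] g) f

theorem multiDeriv_eq_listDeriv (α : Fin d → ℕ) (f : 𝔼 → ℝ) :
    multiDeriv α f = listDeriv α (List.finRange d) f := rfl

theorem contDiff_listDeriv (α : Fin d → ℕ) (L : List (Fin d)) {f : 𝔼 → ℝ}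
    (hf : ContDiff ℝ ∞ f) : ContDiff ℝ ∞ (listDeriv α L f) := by
  induction L with
  | nil => exact hf
  | cons i L ih => exact contDiff_partialDeriv_iterate i _ ih

theorem partialDeriv_listDeriv (α : Fin d → ℕ) (L : List (Fin d)) (i : Fin d) {f : 𝔼 → ℝ}
    (hf : ContDiff ℝ ∞ f) :
    partialDeriv i (listDeriv α L f) = listDeriv α L (partialDeriv i f) := by
  induction L with
  | nil => rfl
  | cons j L ih =>
    change partialDeriv i ((partialDeriv j)^[α j] (listDeriv α L f)) =
      (partialDeriv j)^[α j] (listDeriv α L (partialDeriv i f))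
    rw [← ih, partialDeriv_iterate_comm _ _ _ (contDiff_listDeriv α L hf)]

theorem listDeriv_add_single (α : Fin d → ℕ) (L : List (Fin d)) (i : Fin d) (hL : L.Nodup)
    {f : 𝔼 → ℝ} (hf : ContDiff ℝ ∞ f) :
    listDeriv (α + Pi.single i 1) L f =
      if i ∈ L then listDeriv α L (partialDeriv i f) else listDeriv α L f := by
  induction L with
  | nil => simp [listDeriv]
  | cons j L ih =>
    have hj := List.nodup_cons.1 hL
    change (partialDeriv j)^[(α + Pi.single i 1 : Fin d → ℕ) j] (listDeriv (α + Pi.single i 1) L f) = _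
    rw [ih hj.2]
    by_cases hij : i = j
    · subst hij
      rw [if_neg hj.1, if_pos List.mem_cons_self]
      have : (α + Pi.single i 1 : Fin d → ℕ) i = α i + 1 := by simp
      rw [this, Function.iterate_succ_apply]
      change _ = (partialDeriv i)^[α i] (listDeriv α L (partialDeriv i f))
      rw [partialDeriv_listDeriv _ _ _ hf]
    · have : (α + Pi.single i 1 : Fin d → ℕ) j = α j := by simp [Ne.symm hij]
      rw [this]
      by_cases hiL : i ∈ L
      · rw [if_pos hiL, if_pos (List.mem_cons_of_mem _ hiL)]; rfl
      · rw [if_neg hiL, if_neg (by simp [hij, hiL])]; rfl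

theorem contDiff_multiDeriv (α : Fin d → ℕ) {f : 𝔼 → ℝ} (hf : ContDiff ℝ ∞ f) :
    ContDiff ℝ ∞ (multiDeriv α f) := contDiff_listDeriv α _ hf

theorem multiDeriv_add_single (α : Fin d → ℕ) (i : Fin d) {f : 𝔼 → ℝ} (hf : ContDiff ℝ ∞ f) :
    multiDeriv (α + Pi.single i 1) f = multiDeriv α (partialDeriv i f) := by
  rw [multiDeriv_eq_listDeriv, listDeriv_add_single _ _ _ (List.nodup_finRange d) hf]
  simp [multiDeriv_eq_listDeriv]

theorem partialDeriv_multiDeriv (α : Fin d → ℕ) (i : Fin d) {f : 𝔼 → ℝ} (hf : ContDiff ℝ ∞ f) :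
    partialDeriv i (multiDeriv α f) = multiDeriv α (partialDeriv i f) :=
  partialDeriv_listDeriv α _ i hf

theorem multiDeriv_zero (f : 𝔼 → ℝ) : multiDeriv 0 f = f := by
  rw [multiDeriv_eq_listDeriv]
  induction List.finRange d with
  | nil => rfl
  | cons j L ih => exact ih

theorem multiDeriv_single (i : Fin d) {f : 𝔼 → ℝ} (hf : ContDiff ℝ ∞ f) :
    multiDeriv (Pi.single i 1) f = partialDeriv i f := by
  have := multiDeriv_add_single 0 i hf
  rwa [zero_add, multiDeriv_zero] at this

theorem tsupport_listDeriv (α : Fin d → ℕ) (L : List (Fin d)) (f : 𝔼 → ℝ) :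
    tsupport (listDeriv α L f) ⊆ tsupport f := by
  induction L with
  | nil => exact subset_rfl
  | cons j L ih =>
    refine subset_trans ?_ ih
    change tsupport ((partialDeriv j)^[α j] (listDeriv α L f)) ⊆ _
    induction α j with
    | zero => exact subset_rfl
    | succ n ihn =>
      rw [Function.iterate_succ_apply']
      exact (tsupport_partialDeriv _ _).trans ihn

theorem tsupport_multiDeriv (α : Fin d → ℕ) (f : 𝔼 → ℝ) :
    tsupport (multiDeriv α f) ⊆ tsupport f := tsupport_listDeriv α _ f

theorem hasCompactSupport_multiDeriv (α : Fin d → ℕ) {f : 𝔼 → ℝ} (hf : HasCompactSupport f) :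
    HasCompactSupport (multiDeriv α f) :=
  hf.of_isClosed_subset (isClosed_tsupport _) (tsupport_multiDeriv α f)

theorem hasCompactSupport_partialDeriv (i : Fin d) {f : 𝔼 → ℝ} (hf : HasCompactSupport f) :
    HasCompactSupport (partialDeriv i f) :=
  hf.of_isClosed_subset (isClosed_tsupport _) (tsupport_partialDeriv i f)

/-- The product of a locally integrable function on `U` and a continuous function with compact
support in `U` is integrable. -/
theorem MeasureTheory.LocallyIntegrableOn.integrable_mul_of_tsupport {U : Set 𝔼} {v φ : 𝔼 → ℝ}
    {μ : Measure 𝔼}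
    (hv : LocallyIntegrableOn v U μ) (hφ : Continuous φ) (hc : HasCompactSupport φ)
    (hs : tsupport φ ⊆ U) : Integrable (fun x => v x * φ x) μ := by
  have h1 : IntegrableOn v (tsupport φ) μ := hv.integrableOn_compact_subset hs hc
  have h2 : IntegrableOn (fun x => v x * φ x) (tsupport φ) μ :=
    h1.mul_continuousOn hφ.continuousOn hc
  refine (integrableOn_iff_integrable_of_support_subset ?_).1 h2
  intro x hx
  exact subset_tsupport _ (fun h0 => hx (by simp [h0]))

theorem IsWeakDeriv.ae_eq {U : Set 𝔼} (hU : IsOpen U) {α : Fin d → ℕ} {v w w' : 𝔼 → ℝ}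
    (h : IsWeakDeriv U α v w) (h' : IsWeakDeriv U α v w') :
    w =ᵐ[volume.restrict U] w' := by
  have key : ∀ᵐ x ∂(volume : Measure 𝔼), x ∈ U → (w - w') x = 0 := by
    apply hU.ae_eq_zero_of_integral_contDiff_smul_eq_zero (h.2.1.sub h'.2.1)
    intro g hg hc hs
    have e1 := h.2.2 g hg hc hs
    have e2 := h'.2.2 g hg hc hs
    rw [e1] at e2
    have e3 := mul_left_cancel₀ (pow_ne_zero _ (by norm_num : (-1 : ℝ) ≠ 0)) e2
    have i1 := h.2.1.integrable_mul_of_tsupport hg.continuous hc hs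
    have i2 := h'.2.1.integrable_mul_of_tsupport hg.continuous hc hs
    have z : ∀ u : 𝔼 → ℝ, ∫ x in U, u x * g x = ∫ x, u x * g x := fun u =>
      setIntegral_eq_integral_of_forall_compl_eq_zero fun x hx => by
        rw [image_eq_zero_of_notMem_tsupport (fun h => hx (hs h)), mul_zero]
    rw [z, z] at e3
    calc ∫ x, g x • (w - w') x = ∫ x, (w x * g x - w' x * g x) := by
          congr 1; funext x; simp; ring
      _ = 0 := by rw [integral_sub i1 i2, e3, sub_self]
  rw [Filter.EventuallyEq, ae_restrict_iff' hU.measurableSet]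
  filter_upwards [key] with x hx hxU
  have := hx hxU
  simpa [sub_eq_zero] using this

theorem isWeakDeriv_weakDeriv {U : Set 𝔼} {α : Fin d → ℕ} {v : 𝔼 → ℝ}
    (h : ∃ w, IsWeakDeriv U α v w) : IsWeakDeriv U α v (weakDeriv U α v) := by
  rw [weakDeriv, dif_pos h]
  exact h.choose_spec

theorem IsWeakDeriv.weakDeriv_ae_eq {U : Set 𝔼} (hU : IsOpen U) {α : Fin d → ℕ} {v w : 𝔼 → ℝ}
    (h : IsWeakDeriv U α v w) : weakDeriv U α v =ᵐ[volume.restrict U] w :=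
  (isWeakDeriv_weakDeriv ⟨w, h⟩).ae_eq hU h

theorem IsWeakDeriv.comp_single {U : Set 𝔼} {α : Fin d → ℕ} {i : Fin d} {v w u : 𝔼 → ℝ}
    (h : IsWeakDeriv U α v w) (h' : IsWeakDeriv U (Pi.single i 1) w u) :
    IsWeakDeriv U (α + Pi.single i 1) v u := by
  refine ⟨h.1, h'.2.1, fun φ hφ hc hs => ?_⟩
  rw [multiDeriv_add_single _ _ hφ,
    h.2.2 _ (contDiff_partialDeriv i hφ) (hasCompactSupport_partialDeriv i hc)
      ((tsupport_partialDeriv i φ).trans hs),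
    ← multiDeriv_single i hφ, h'.2.2 φ hφ hc hs]
  simp [Finset.sum_add_distrib, pow_add]

theorem IsWeakDeriv.single_of_add {U : Set 𝔼} {α : Fin d → ℕ} {i : Fin d} {v w u : 𝔼 → ℝ}
    (h : IsWeakDeriv U α v w) (h' : IsWeakDeriv U (α + Pi.single i 1) v u) :
    IsWeakDeriv U (Pi.single i 1) w u := by
  refine ⟨h.2.1, h'.2.1, fun φ hφ hc hs => ?_⟩
  have e1 := h.2.2 _ (contDiff_partialDeriv i hφ) (hasCompactSupport_partialDeriv i hc)
      ((tsupport_partialDeriv i φ).trans hs)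
  have e2 := h'.2.2 φ hφ hc hs
  rw [multiDeriv_add_single _ _ hφ, e1] at e2
  rw [multiDeriv_single i hφ]
  refine mul_left_cancel₀ (pow_ne_zero (∑ j, α j) (by norm_num : (-1 : ℝ) ≠ 0)) ?_
  rw [e2]
  simp [Finset.sum_add_distrib, pow_add]

theorem IsWeakDeriv.sub {U : Set 𝔼} {α : Fin d → ℕ} {v w v' w' : 𝔼 → ℝ}
    (h : IsWeakDeriv U α v w) (h' : IsWeakDeriv U α v' w') :
    IsWeakDeriv U α (v - v') (w - w') := by
  refine ⟨h.1.sub h'.1, h.2.1.sub h'.2.1, fun φ hφ hc hs => ?_⟩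
  have m := (tsupport_multiDeriv α φ).trans hs
  have i1 := (h.1.integrable_mul_of_tsupport (contDiff_multiDeriv α hφ).continuous
    (hasCompactSupport_multiDeriv α hc) m).integrableOn (s := U)
  have i2 := (h'.1.integrable_mul_of_tsupport (contDiff_multiDeriv α hφ).continuous
    (hasCompactSupport_multiDeriv α hc) m).integrableOn (s := U)
  have i3 := (h.2.1.integrable_mul_of_tsupport hφ.continuous hc hs).integrableOn (s := U)
  have i4 := (h'.2.1.integrable_mul_of_tsupport hφ.continuous hc hs).integrableOn (s := U)
  simp only [Pi.sub_apply, sub_mul]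
  rw [integral_sub i1 i2, integral_sub i3 i4, h.2.2 φ hφ hc hs, h'.2.2 φ hφ hc hs]
  ring

theorem IsWeakDeriv.congr {U : Set 𝔼} (hU : IsOpen U) {α : Fin d → ℕ} {v w v' w' : 𝔼 → ℝ}
    (h : IsWeakDeriv U α v w) (hv : v =ᵐ[volume.restrict U] v')
    (hw : w =ᵐ[volume.restrict U] w') : IsWeakDeriv U α v' w' := by
  have loc : ∀ {u u' : 𝔼 → ℝ}, LocallyIntegrableOn u U volume →
      u =ᵐ[volume.restrict U] u' → LocallyIntegrableOn u' U volume := by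
    intro u u' hu huu'
    rw [locallyIntegrableOn_iff hU.isLocallyClosed] at hu ⊢
    intro k hk hkc
    exact (hu k hk hkc).congr_fun_ae (ae_restrict_of_ae_restrict_of_subset hk huu')
  refine ⟨loc h.1 hv, loc h.2.1 hw, fun φ hφ hc hs => ?_⟩
  have e1 : ∫ x in U, v' x * multiDeriv α φ x = ∫ x in U, v x * multiDeriv α φ x :=
    integral_congr_ae (by filter_upwards [hv] with x hx; rw [hx])
  have e2 : ∫ x in U, w' x * φ x = ∫ x in U, w x * φ x :=
    integral_congr_ae (by filter_upwards [hw] with x hx; rw [hx])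
  rw [e1, e2]
  exact h.2.2 φ hφ hc hs

theorem IsWeakDeriv.mono {U S : Set 𝔼} (hSU : S ⊆ U) {α : Fin d → ℕ} {v w : 𝔼 → ℝ}
    (h : IsWeakDeriv U α v w) : IsWeakDeriv S α v w := by
  refine ⟨h.1.mono_set hSU, h.2.1.mono_set hSU, fun φ hφ hc hs => ?_⟩
  have z : ∀ u ψ : 𝔼 → ℝ, tsupport ψ ⊆ S → ∫ x in S, u x * ψ x = ∫ x in U, u x * ψ x := by
    intro u ψ hψ
    rw [setIntegral_eq_integral_of_forall_compl_eq_zero,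
      setIntegral_eq_integral_of_forall_compl_eq_zero]
    · intro x hx
      rw [image_eq_zero_of_notMem_tsupport (fun h => hx (hSU (hψ h))), mul_zero]
    · intro x hx
      rw [image_eq_zero_of_notMem_tsupport (fun h => hx (hψ h)), mul_zero]
  rw [z _ _ ((tsupport_multiDeriv α φ).trans hs), z _ _ hs]
  exact h.2.2 φ hφ hc (hs.trans hSU)

theorem isWeakDeriv_single_of_contDiff {U : Set 𝔼} (i : Fin d) {f : 𝔼 → ℝ}
    (hf : ContDiff ℝ ∞ f) : IsWeakDeriv U (Pi.single i 1) f (partialDeriv i f) := by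
  have hf' := contDiff_partialDeriv i hf
  refine ⟨hf.continuous.locallyIntegrable.locallyIntegrableOn _,
    hf'.continuous.locallyIntegrable.locallyIntegrableOn _, fun φ hφ hc hs => ?_⟩
  have hφ' := contDiff_partialDeriv i hφ
  have hc' := hasCompactSupport_partialDeriv i hc
  rw [multiDeriv_single i hφ]
  have z : ∀ u ψ : 𝔼 → ℝ, tsupport ψ ⊆ U → ∫ x in U, u x * ψ x = ∫ x, u x * ψ x := by
    intro u ψ hψ
    refine setIntegral_eq_integral_of_forall_compl_eq_zero fun x hx => ?_
    rw [image_eq_zero_of_notMem_tsupport (fun h => hx (hψ h)), mul_zero]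
  rw [z _ _ ((tsupport_partialDeriv i φ).trans hs), z _ _ hs]
  have key := integral_mul_fderiv_eq_neg_fderiv_mul_of_integrable (μ := (volume : Measure 𝔼))
    (f := f) (g := φ) (v := EuclideanSpace.single i 1) ?_ ?_ ?_
    (fun x _ => hf.differentiable (by simp) x) (fun x _ => hφ.differentiable (by simp) x)
  · simpa [partialDeriv] using key
  · exact (hf'.continuous.mul hφ.continuous).integrable_of_hasCompactSupport hc.mul_left
  · exact (hf.continuous.mul hφ'.continuous).integrable_of_hasCompactSupport hc'.mul_left
  · exact (hf.continuous.mul hφ.continuous).integrable_of_hasCompactSupport hc.mul_left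

/-- Jensen's inequality for averages along a map: if the image of `μ × P` under `Ψ` is at most
`A • ν`, then averaging `f ∘ Ψ` over `P` is bounded from `L^p(ν)` to `L^p(μ)`. -/
theorem eLpNorm_le_of_map_prod_le {X Ω Y : Type*} [MeasurableSpace X] [MeasurableSpace Ω]
    [MeasurableSpace Y] {μ : Measure X} [SFinite μ] {P : Measure Ω} [IsProbabilityMeasure P]
    {ν : Measure Y} {Ψ : X × Ω → Y} (hΨ : Measurable Ψ) {A : ℝ≥0∞} (hA0 : A ≠ 0)
    (hmap : (μ.prod P).map Ψ ≤ A • ν) {f : Y → ℝ} (hf : Measurable f) {F : X → ℝ}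
    (hF : ∀ᵐ x ∂μ, ‖F x‖ₑ ≤ ∫⁻ o, ‖f (Ψ (x, o))‖ₑ ∂P) {p : ℝ≥0∞} (hp : 1 ≤ p) :
    eLpNorm F p μ ≤ A ^ (1 / p).toReal * eLpNorm f p ν := by
  have hp0 : p ≠ 0 := (zero_lt_one.trans_le hp).ne'
  have h1 : eLpNorm (f ∘ Ψ) p (μ.prod P) ≤ A ^ (1 / p).toReal * eLpNorm f p ν := by
    rw [← eLpNorm_map_measure hf.aestronglyMeasurable hΨ.aemeasurable]
    refine (eLpNorm_mono_measure f hmap).trans ?_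
    rw [eLpNorm_smul_measure_of_ne_zero hA0, smul_eq_mul]
  refine le_trans ?_ h1
  rcases eq_or_ne p ⊤ with rfl | hpt
  · have h2 : ∀ᵐ q ∂(μ.prod P), ‖(f ∘ Ψ) q‖ₑ ≤ eLpNorm (f ∘ Ψ) ⊤ (μ.prod P) := by
      rw [eLpNorm_exponent_top]; exact ae_le_eLpNormEssSup
    have h3 := Measure.ae_ae_of_ae_prod h2
    rw [eLpNorm_exponent_top (f := F)]
    refine eLpNormEssSup_le_of_ae_enorm_bound ?_
    filter_upwards [hF, h3] with x hx hx'
    refine hx.trans ((lintegral_mono_ae hx').trans ?_)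
    simp
  · have hpr : 0 < p.toReal := ENNReal.toReal_pos hp0 hpt
    rw [eLpNorm_eq_lintegral_rpow_enorm_toReal hp0 hpt,
      eLpNorm_eq_lintegral_rpow_enorm_toReal hp0 hpt]
    refine ENNReal.rpow_le_rpow ?_ (by positivity)
    have hm : Measurable (fun q : X × Ω => ‖(f ∘ Ψ) q‖ₑ ^ p.toReal) :=
      ((hf.comp hΨ).enorm).pow_const _
    rw [lintegral_prod _ hm.aemeasurable]
    refine lintegral_mono_ae ?_
    filter_upwards [hF] with x hx
    have hmx : Measurable (fun o => f (Ψ (x, o))) := hf.comp (hΨ.comp measurable_prodMk_left)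
    have h4 := eLpNorm_le_eLpNorm_of_exponent_le (μ := P) hp
      hmx.aestronglyMeasurable
    rw [eLpNorm_one_eq_lintegral_enorm, eLpNorm_eq_lintegral_rpow_enorm_toReal hp0 hpt] at h4
    calc ‖F x‖ₑ ^ p.toReal ≤ ((∫⁻ o, ‖f (Ψ (x, o))‖ₑ ^ p.toReal ∂P) ^ (1 / p.toReal)) ^ p.toReal :=
          ENNReal.rpow_le_rpow (hx.trans h4) hpr.le
      _ = _ := by rw [← ENNReal.rpow_mul, one_div, inv_mul_cancel₀ hpr.ne', ENNReal.rpow_one]; rfl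

theorem isProbabilityMeasure_restrict_Ioc :
    IsProbabilityMeasure (volume.restrict (Ioc (0 : ℝ) 1)) := ⟨by simp⟩

attribute [local instance] isProbabilityMeasure_restrict_Ioc

theorem fderiv_apply_eq_sum (φ : 𝔼 → ℝ) (x z : 𝔼) :
    fderiv ℝ φ x z = ∑ i, z i * partialDeriv i φ x := by
  have hz : z = ∑ i, z i • (EuclideanSpace.single i (1 : ℝ)) := by
    have := (EuclideanSpace.basisFun (Fin d) ℝ).sum_repr z
    simpa using this.symm
  conv_lhs => rw [hz]
  simp [partialDeriv]

/-- `G` is the weak gradient of `w` on `U`. -/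
def HasWeakGrad (U : Set 𝔼) (w : 𝔼 → ℝ) (G : Fin d → 𝔼 → ℝ) : Prop :=
  ∀ i, IsWeakDeriv U (Pi.single i 1) w (G i)

/-- The directional derivative in the direction `z` of a function with (weak) gradient `G`. -/
def dirGrad (G : Fin d → 𝔼 → ℝ) (z x : 𝔼) : ℝ := ∑ i, z i * G i x

theorem HasWeakGrad.integral_partialDeriv {U : Set 𝔼} {w : 𝔼 → ℝ} {G : Fin d → 𝔼 → ℝ}
    (h : HasWeakGrad U w G) {ψ : 𝔼 → ℝ} (hψ : ContDiff ℝ ∞ ψ) (hc : HasCompactSupport ψ)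
    (hs : tsupport ψ ⊆ U) (i : Fin d) :
    ∫ x, w x * partialDeriv i ψ x = - ∫ x, G i x * ψ x := by
  have e := (h i).2.2 ψ hψ hc hs
  rw [multiDeriv_single i hψ] at e
  have z : ∀ u ψ' : 𝔼 → ℝ, tsupport ψ' ⊆ U → ∫ x in U, u x * ψ' x = ∫ x, u x * ψ' x := by
    intro u ψ' hψ'
    refine setIntegral_eq_integral_of_forall_compl_eq_zero fun x hx => ?_
    rw [image_eq_zero_of_notMem_tsupport (fun h => hx (hψ' h)), mul_zero]
  rw [z _ _ ((tsupport_partialDeriv i ψ).trans hs), z _ _ hs] at e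
  simpa using e

theorem HasWeakGrad.integral_fderiv {U : Set 𝔼} {w : 𝔼 → ℝ} {G : Fin d → 𝔼 → ℝ}
    (h : HasWeakGrad U w G) {ψ : 𝔼 → ℝ} (hψ : ContDiff ℝ ∞ ψ) (hc : HasCompactSupport ψ)
    (hs : tsupport ψ ⊆ U) (z : 𝔼) :
    ∫ x, w x * fderiv ℝ ψ x z = - ∫ x, dirGrad G z x * ψ x := by
  simp only [fderiv_apply_eq_sum, dirGrad, Finset.mul_sum, Finset.sum_mul]
  rw [integral_finsetSum, integral_finsetSum, ← Finset.sum_neg_distrib]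
  · refine Finset.sum_congr rfl fun i _ => ?_
    have e1 : ∀ x, w x * (z i * partialDeriv i ψ x) = z i * (w x * partialDeriv i ψ x) :=
      fun x => by ring
    have e2 : ∀ x, z i * G i x * ψ x = z i * (G i x * ψ x) := fun x => by ring
    simp only [e1, e2, integral_const_mul]
    rw [h.integral_partialDeriv hψ hc hs i]; ring
  · intro i _
    have := (((h i).2.1.integrable_mul_of_tsupport hψ.continuous hc hs)).const_mul (z i)
    exact this.congr (Filter.Eventually.of_forall fun x => by simp only []; ring)
  · intro i _
    have := (((h i).1.integrable_mul_of_tsupport (contDiff_partialDeriv i hψ).continuous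
      (hasCompactSupport_partialDeriv i hc) ((tsupport_partialDeriv i ψ).trans hs))).const_mul (z i)
    exact this.congr (Filter.Eventually.of_forall fun x => by simp only []; ring)

theorem measurePreserving_shear (τ : Measure ℝ) [SFinite τ] (z : 𝔼) :
    MeasurePreserving (fun q : ℝ × 𝔼 => (q.1, q.2 + q.1 • z)) (τ.prod volume)
      (τ.prod volume) := by
  refine (MeasurePreserving.id τ).skew_product (g := fun t x => x + t • z) ?_ ?_
  · exact Continuous.measurable (by fun_prop)
  · exact Filter.Eventually.of_forall fun t => (measurePreserving_add_right volume (t • z)).map_eq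

theorem Integrable.comp_shear {τ : Measure ℝ} [IsFiniteMeasure τ] {f : 𝔼 → ℝ}
    (hf : Integrable f) (z : 𝔼) :
    Integrable (fun q : ℝ × 𝔼 => f (q.2 + q.1 • z)) (τ.prod volume) := by
  have h := (hf.comp_snd τ)
  exact (measurePreserving_shear τ z).integrable_comp_of_integrable h

theorem integrable_dirGrad {μ : Measure 𝔼} {G : Fin d → 𝔼 → ℝ} (hG : ∀ i, Integrable (G i) μ)
    (z : 𝔼) : Integrable (dirGrad G z) μ :=
  integrable_finsetSum _ fun i _ => (hG i).const_mul (z i)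

theorem abs_dirGrad_le (G : Fin d → 𝔼 → ℝ) (z x : 𝔼) :
    |dirGrad G z x| ≤ ‖z‖ * ∑ i, |G i x| := by
  rw [dirGrad, Finset.mul_sum]
  refine (Finset.abs_sum_le_sum_abs _ _).trans (Finset.sum_le_sum fun i _ => ?_)
  rw [abs_mul]
  exact mul_le_mul_of_nonneg_right (PiLp.norm_apply_le z i) (abs_nonneg _)

theorem tsupport_comp_sub_subset (φ : 𝔼 → ℝ) (a : 𝔼) :
    tsupport (fun y => φ (y - a)) ⊆ (fun y => y - a) ⁻¹' tsupport φ :=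
  tsupport_comp_subset_preimage φ (by fun_prop)

/-- Functions with an integrable weak gradient on a convex open set are absolutely continuous on
almost all lines. -/
theorem HasWeakGrad.ae_sub_eq {S : Set 𝔼} (hS : IsOpen S) (hconv : Convex ℝ S)
    {w : 𝔼 → ℝ} {G : Fin d → 𝔼 → ℝ} (h : HasWeakGrad S w G) (hw : Integrable w)
    (hG : ∀ i, Integrable (G i)) (z : 𝔼) :
    ∀ᵐ x, x ∈ S → x + z ∈ S →
      w (x + z) - w x = ∫ t in Ioc (0 : ℝ) 1, dirGrad G z (x + t • z) := by
  set τ : Measure ℝ := volume.restrict (Ioc (0 : ℝ) 1) with hτ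
  let V : Set 𝔼 := {x | x ∈ S ∧ x + z ∈ S}
  have hV : IsOpen V := hS.inter (hS.preimage (by fun_prop : Continuous fun x : 𝔼 => x + z))
  have hgi := integrable_dirGrad hG z
  have hprod : Integrable (fun q : 𝔼 × ℝ => dirGrad G z (q.1 + q.2 • z)) (volume.prod τ) :=
    (Integrable.comp_shear (τ := τ) hgi z).swap
  have hint : Integrable (fun x => ∫ t, dirGrad G z (x + t • z) ∂τ) := hprod.integral_prod_left
  have hwz : Integrable (fun x => w (x + z)) := hw.comp_add_right z
  have hf : Integrable (fun x => w (x + z) - w x - ∫ t, dirGrad G z (x + t • z) ∂τ) :=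
    (hwz.sub hw).sub hint
  have key : ∀ᵐ x, x ∈ V → w (x + z) - w x - ∫ t, dirGrad G z (x + t • z) ∂τ = 0 := by
    apply hV.ae_eq_zero_of_integral_contDiff_smul_eq_zero (hf.locallyIntegrable.locallyIntegrableOn _)
    intro φ hφ hc hs
    simp only [smul_eq_mul]
    obtain ⟨C, hC⟩ := hc.exists_bound_of_continuous hφ.continuous
    have bdd : ∀ {u : 𝔼 → ℝ}, Integrable u → Integrable (fun x => φ x * u x) := fun hu =>
      hu.bdd_mul hφ.continuous.aestronglyMeasurable (Filter.Eventually.of_forall hC)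
    -- the integral of the gradient term
    have shift : ∀ t ∈ Ioc (0 : ℝ) 1, ∫ x, φ x * dirGrad G z (x + t • z) =
        - ∫ y, w y * fderiv ℝ φ (y - t • z) z := by
      intro t ht
      let ψ : 𝔼 → ℝ := fun y => φ (y - t • z)
      have hψ : ContDiff ℝ ∞ ψ := hφ.comp (contDiff_id.sub contDiff_const)
      have hψc : HasCompactSupport ψ :=
        hc.comp_homeomorph (Homeomorph.subRight (t • z))
      have hψs : tsupport ψ ⊆ S := by
        intro y hy
        have hy' := hs (tsupport_comp_sub_subset φ _ hy)
        have := hconv.add_smul_mem hy'.1 hy'.2 ⟨ht.1.le, ht.2⟩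
        simpa using this
      have e := h.integral_fderiv hψ hψc hψs z
      have e3 : ∀ y, fderiv ℝ ψ y = fderiv ℝ φ (y - t • z) := fun y => fderiv_comp_sub _
      simp only [e3] at e
      rw [e, neg_neg, ← integral_add_right_eq_self (fun x => dirGrad G z x * ψ x) (t • z)]
      refine integral_congr_ae (Filter.Eventually.of_forall fun x => ?_)
      simp only [ψ, add_sub_cancel_right]; ring
    have fub1 : ∫ x, φ x * (∫ t, dirGrad G z (x + t • z) ∂τ) =
        ∫ t, (∫ x, φ x * dirGrad G z (x + t • z)) ∂τ := by
      simp only [← integral_const_mul]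
      refine integral_integral_swap (f := fun x t => φ x * dirGrad G z (x + t • z)) ?_
      refine hprod.bdd_mul (c := C) (f := fun q : 𝔼 × ℝ => φ q.1) ?_ ?_
      · exact (hφ.continuous.comp continuous_fst).aestronglyMeasurable
      · exact Filter.Eventually.of_forall fun q => hC q.1
    have hφ1 : Continuous fun x => fderiv ℝ φ x z :=
      (hφ.continuous_fderiv (by simp)).clm_apply continuous_const
    obtain ⟨C', hC'⟩ := (hc.fderiv_apply ℝ z).exists_bound_of_continuous hφ1
    have fub2 : ∫ t, (∫ y, w y * fderiv ℝ φ (y - t • z) z) ∂τ =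
        ∫ y, w y * (∫ t, fderiv ℝ φ (y - t • z) z ∂τ) := by
      simp only [← integral_const_mul]
      refine integral_integral_swap (f := fun t y => w y * fderiv ℝ φ (y - t • z) z) ?_
      have := (hw.comp_snd τ).bdd_mul (c := C') (f := fun q : ℝ × 𝔼 => fderiv ℝ φ (q.2 - q.1 • z) z)
        (Continuous.aestronglyMeasurable (by fun_prop))
        (Filter.Eventually.of_forall fun q => hC' _)
      exact this.congr (Filter.Eventually.of_forall fun q => by
        simp only [Function.uncurry]; ring)
    have ftc : ∀ y, ∫ t, fderiv ℝ φ (y - t • z) z ∂τ = φ y - φ (y - z) := by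
      intro y
      rw [hτ, ← intervalIntegral.integral_of_le zero_le_one]
      have hd : ∀ t ∈ uIcc (0 : ℝ) 1,
          HasDerivAt (fun t : ℝ => - φ (y - t • z)) (fderiv ℝ φ (y - t • z) z) t := by
        intro t _
        have h1 : HasDerivAt (fun t : ℝ => y - t • z) (-z) t := by
          simpa using ((hasDerivAt_id t).smul_const z).const_sub y
        have h2 := ((hφ.differentiable (by simp)) (y - t • z)).hasFDerivAt.comp_hasDerivAt t h1
        have h3 := h2.neg
        rw [map_neg, neg_neg] at h3
        exact h3
      rw [intervalIntegral.integral_eq_sub_of_hasDerivAt hd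
        (Continuous.intervalIntegrable (by fun_prop) _ _)]
      simp; ring
    have main : ∫ x, φ x * (∫ t, dirGrad G z (x + t • z) ∂τ) =
        ∫ y, w y * (φ (y - z) - φ y) := by
      rw [fub1, show (∫ t, (∫ x, φ x * dirGrad G z (x + t • z)) ∂τ) =
        ∫ t, (- ∫ y, w y * fderiv ℝ φ (y - t • z) z) ∂τ from
          setIntegral_congr_fun measurableSet_Ioc shift, integral_neg, fub2, ← integral_neg]
      refine integral_congr_ae (Filter.Eventually.of_forall fun y => ?_)
      simp only [ftc]; ring
    have e4 : ∫ x, φ x * w (x + z) = ∫ y, w y * φ (y - z) := by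
      rw [← integral_add_right_eq_self (fun y => w y * φ (y - z)) z]
      refine integral_congr_ae (Filter.Eventually.of_forall fun y => ?_)
      simp only [add_sub_cancel_right]; ring
    have i1 : Integrable fun y => w y * φ (y - z) := by
      have := (bdd hwz).comp_sub_right z
      exact this.congr (Filter.Eventually.of_forall fun y => by
        simp only [sub_add_cancel]; ring)
    have i2 : Integrable fun y => w y * φ y := (bdd hw).congr
      (Filter.Eventually.of_forall fun y => by simp only []; ring)
    simp only [mul_sub] at main ⊢
    have i3 : Integrable fun x => φ x * w (x + z) - φ x * w x := (bdd hwz).sub (bdd hw)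
    rw [integral_sub i3 (bdd hint), integral_sub (bdd hwz) (bdd hw), main,
      integral_sub i1 i2, e4]
    simp only [mul_comm (φ _), sub_self]
  filter_upwards [key] with x hx h1 h2
  exact sub_eq_zero.1 (hx ⟨h1, h2⟩)

theorem HasWeakGrad.congr {U : Set 𝔼} (hU : IsOpen U) {w w' : 𝔼 → ℝ} {G G' : Fin d → 𝔼 → ℝ}
    (h : HasWeakGrad U w G) (hw : w =ᵐ[volume.restrict U] w')
    (hG : ∀ i, G i =ᵐ[volume.restrict U] G' i) : HasWeakGrad U w' G' :=
  fun i => (h i).congr hU hw (hG i)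

theorem HasWeakGrad.mono {U S : Set 𝔼} (hSU : S ⊆ U) {w : 𝔼 → ℝ} {G : Fin d → 𝔼 → ℝ}
    (h : HasWeakGrad U w G) : HasWeakGrad S w G :=
  fun i => (h i).mono hSU

/-- An integrable function on `U` agrees a.e. on `U` with a measurable function which is integrable
on the whole space and vanishes outside `U`. -/
theorem exists_measurable_integrable_rep {U : Set 𝔼} (hU : MeasurableSet U) {w : 𝔼 → ℝ}
    (hw : IntegrableOn w U) :
    ∃ w' : 𝔼 → ℝ, Measurable w' ∧ Integrable w' ∧ (∀ x ∉ U, w' x = 0) ∧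
      w =ᵐ[volume.restrict U] w' := by
  have hae := hw.aestronglyMeasurable.ae_eq_mk
  refine ⟨U.indicator (hw.aestronglyMeasurable.mk w),
    hw.aestronglyMeasurable.stronglyMeasurable_mk.measurable.indicator hU, ?_, ?_, ?_⟩
  · rw [integrable_indicator_iff hU]
    exact hw.congr_fun_ae hae
  · intro x hx; exact indicator_of_notMem hx _
  · exact hae.trans (indicator_ae_eq_restrict hU).symm

theorem volume_preimage_affine (c : 𝔼) {t : ℝ} (ht : t ≠ 0) (B : Set 𝔼) :
    volume ((fun y : 𝔼 => c + t • y) ⁻¹' B) = ENNReal.ofReal (|t ^ d|⁻¹) * volume B := by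
  have : (fun y : 𝔼 => c + t • y) ⁻¹' B = (fun y : 𝔼 => t • y) ⁻¹' ((fun y => c + y) ⁻¹' B) := rfl
  rw [this, Measure.addHaar_preimage_smul _ ht, measure_preimage_add]
  simp [abs_inv]

theorem volume_preimage_affine_le (c : 𝔼) {t : ℝ} (ht : 1 / 2 ≤ t) (B : Set 𝔼) :
    volume ((fun y : 𝔼 => c + t • y) ⁻¹' B) ≤ 2 ^ d * volume B := by
  have ht0 : 0 < t := by linarith
  rw [volume_preimage_affine c ht0.ne']
  gcongr
  rw [show (2 : ℝ≥0∞) ^ d = ENNReal.ofReal (2 ^ d) by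
    rw [ENNReal.ofReal_pow (by norm_num)]; simp]
  refine ENNReal.ofReal_le_ofReal ?_
  rw [abs_of_pos (by positivity), ← inv_pow]
  refine pow_le_pow_left₀ (by positivity) ?_ _
  rw [inv_le_comm₀ ht0 (by norm_num)]
  linarith

/-- Averaging over the segments of a convex set does not concentrate mass. -/
theorem map_segment_le {S : Set 𝔼} (hS : MeasurableSet S) (hconv : Convex ℝ S)
    (h0 : volume S ≠ 0) (hfin : volume S ≠ ⊤) :
    ((volume.restrict S).prod ((volume.restrict (Ioc (0 : ℝ) 1)).prod
      (ProbabilityTheory.cond volume S))).map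
        (fun q : 𝔼 × ℝ × 𝔼 => q.2.2 + q.2.1 • (q.1 - q.2.2)) ≤
      (2 ^ d : ℝ≥0∞) • volume.restrict S := by
  have hP : IsProbabilityMeasure (ProbabilityTheory.cond volume S) :=
    ProbabilityTheory.cond_isProbabilityMeasure_of_finite h0 hfin
  set P := ProbabilityTheory.cond volume S with hPdef
  set τ : Measure ℝ := volume.restrict (Ioc (0 : ℝ) 1)
  have : IsFiniteMeasure (volume.restrict S) := ⟨by simpa using hfin.lt_top⟩
  have hmeas : Measurable (fun q : 𝔼 × ℝ × 𝔼 => q.2.2 + q.2.1 • (q.1 - q.2.2)) :=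
    Continuous.measurable (by fun_prop)
  have hPle : ∀ f : 𝔼 → ℝ≥0∞, ∫⁻ x, f x ∂P = (volume S)⁻¹ * ∫⁻ x in S, f x := by
    intro f
    rw [hPdef, ProbabilityTheory.cond, lintegral_smul_measure, smul_eq_mul]
  refine Measure.le_iff.2 fun B hB => ?_
  rw [Measure.map_apply hmeas hB, Measure.smul_apply, smul_eq_mul, Measure.restrict_apply hB]
  let f : 𝔼 → ℝ → 𝔼 → ℝ≥0∞ := fun y t x => B.indicator 1 (x + t • (y - x))
  have hfm : Measurable (fun q : 𝔼 × ℝ × 𝔼 => f q.1 q.2.1 q.2.2) :=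
    (measurable_one.indicator hB).comp hmeas
  have e1 : ((volume.restrict S).prod (τ.prod P))
      ((fun q : 𝔼 × ℝ × 𝔼 => q.2.2 + q.2.1 • (q.1 - q.2.2)) ⁻¹' B) =
      ∫⁻ t, (∫⁻ y in S, ∫⁻ x, f y t x ∂P) ∂τ := by
    rw [← lintegral_indicator_one (hmeas hB)]
    have : ∀ q : 𝔼 × ℝ × 𝔼, ((fun q : 𝔼 × ℝ × 𝔼 => q.2.2 + q.2.1 • (q.1 - q.2.2)) ⁻¹' B).indicator
        (1 : 𝔼 × ℝ × 𝔼 → ℝ≥0∞) q = f q.1 q.2.1 q.2.2 := fun q => rfl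
    simp only [this]
    rw [lintegral_prod _ hfm.aemeasurable]
    have : ∀ y, ∫⁻ r, f y r.1 r.2 ∂(τ.prod P) = ∫⁻ t, (∫⁻ x, f y t x ∂P) ∂τ := fun y =>
      lintegral_prod _ (hfm.comp measurable_prodMk_left).aemeasurable
    simp only [this]
    refine lintegral_lintegral_swap (f := fun y t => ∫⁻ x, f y t x ∂P) ?_
    refine Measurable.aemeasurable ?_
    refine Measurable.lintegral_prod_right' (f := fun q : (𝔼 × ℝ) × 𝔼 => f q.1.1 q.1.2 q.2) ?_
    exact hfm.comp (by fun_prop : Measurable fun q : (𝔼 × ℝ) × 𝔼 => (q.1.1, q.1.2, q.2))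
  rw [e1]
  have seg : ∀ {x y : 𝔼} {t : ℝ}, x ∈ S → y ∈ S → t ∈ Ioc (0 : ℝ) 1 → x + t • (y - x) ∈ S :=
    fun hx hy ht => hconv.add_smul_sub_mem hx hy ⟨ht.1.le, ht.2⟩
  have bound : ∀ t ∈ Ioc (0 : ℝ) 1, ∫⁻ y in S, ∫⁻ x, f y t x ∂P ≤ 2 ^ d * volume (B ∩ S) := by
    intro t ht
    have hBS : MeasurableSet (B ∩ S) := hB.inter hS
    have hft : Measurable (fun q : 𝔼 × 𝔼 => f q.1 t q.2) :=
      hfm.comp (by fun_prop : Measurable fun q : 𝔼 × 𝔼 => (q.1, t, q.2))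
    rcases le_total t (1 / 2) with h | h
    · have hin : ∀ y ∈ S, ∫⁻ x, f y t x ∂P ≤ (volume S)⁻¹ * (2 ^ d * volume (B ∩ S)) := by
        intro y hy
        rw [hPle]
        gcongr
        calc ∫⁻ x in S, f y t x
            ≤ ∫⁻ x, ((fun x : 𝔼 => t • y + (1 - t) • x) ⁻¹' (B ∩ S)).indicator 1 x := by
              rw [← lintegral_indicator hS]
              refine lintegral_mono fun x => ?_
              by_cases hx : x ∈ S
              · rw [indicator_of_mem hx]
                have e : x + t • (y - x) = t • y + (1 - t) • x := by module
                by_cases hxB : x + t • (y - x) ∈ B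
                · have hm : x ∈ (fun x : 𝔼 => t • y + (1 - t) • x) ⁻¹' (B ∩ S) := by
                    rw [mem_preimage, ← e]; exact ⟨hxB, seg hx hy ht⟩
                  rw [indicator_of_mem hm]; simp [f, hxB]
                · simp [f, hxB]
              · rw [indicator_of_notMem hx]; exact zero_le
          _ = volume ((fun x : 𝔼 => t • y + (1 - t) • x) ⁻¹' (B ∩ S)) :=
              lintegral_indicator_one
                ((Continuous.measurable (by fun_prop) :
                  Measurable fun x : 𝔼 => t • y + (1 - t) • x) hBS)
          _ ≤ _ := volume_preimage_affine_le _ (by linarith) _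
      calc ∫⁻ y in S, ∫⁻ x, f y t x ∂P
          ≤ ∫⁻ y in S, (volume S)⁻¹ * (2 ^ d * volume (B ∩ S)) := setLIntegral_mono' hS hin
        _ = 2 ^ d * volume (B ∩ S) := by
            rw [setLIntegral_const, mul_comm, ← mul_assoc, ENNReal.mul_inv_cancel h0 hfin, one_mul]
    · rw [lintegral_lintegral_swap hft.aemeasurable]
      have hin : ∀ x ∈ S, ∫⁻ y in S, f y t x ≤ 2 ^ d * volume (B ∩ S) := by
        intro x hx
        calc ∫⁻ y in S, f y t x
            ≤ ∫⁻ y, ((fun y : 𝔼 => (1 - t) • x + t • y) ⁻¹' (B ∩ S)).indicator 1 y := by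
              rw [← lintegral_indicator hS]
              refine lintegral_mono fun y => ?_
              by_cases hy : y ∈ S
              · rw [indicator_of_mem hy]
                have e : x + t • (y - x) = (1 - t) • x + t • y := by module
                by_cases hxB : x + t • (y - x) ∈ B
                · have hm : y ∈ (fun y : 𝔼 => (1 - t) • x + t • y) ⁻¹' (B ∩ S) := by
                    rw [mem_preimage, ← e]; exact ⟨hxB, seg hx hy ht⟩
                  rw [indicator_of_mem hm]; simp [f, hxB]
                · simp [f, hxB]
              · rw [indicator_of_notMem hy]; exact zero_le
          _ = volume ((fun y : 𝔼 => (1 - t) • x + t • y) ⁻¹' (B ∩ S)) :=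
              lintegral_indicator_one
                ((Continuous.measurable (by fun_prop) :
                  Measurable fun y : 𝔼 => (1 - t) • x + t • y) hBS)
          _ ≤ _ := volume_preimage_affine_le _ h _
      rw [hPle]
      calc (volume S)⁻¹ * ∫⁻ x in S, ∫⁻ y in S, f y t x
          ≤ (volume S)⁻¹ * ∫⁻ x in S, 2 ^ d * volume (B ∩ S) := by
            gcongr 1; exact setLIntegral_mono' hS hin
        _ = 2 ^ d * volume (B ∩ S) := by
            rw [setLIntegral_const, mul_comm, mul_assoc, ENNReal.mul_inv_cancel h0 hfin, mul_one]
  calc ∫⁻ t, (∫⁻ y in S, ∫⁻ x, f y t x ∂P) ∂τ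
      ≤ ∫⁻ t, (2 ^ d * volume (B ∩ S)) ∂τ := setLIntegral_mono' measurableSet_Ioc bound
    _ = 2 ^ d * volume (B ∩ S) := by simp [τ]

/-- Poincaré's inequality on a convex open set. -/
theorem HasWeakGrad.poincare_convex {S : Set 𝔼} (hS : IsOpen S) (hconv : Convex ℝ S)
    (hb : Bornology.IsBounded S) (hne : S.Nonempty) {w : 𝔼 → ℝ} {G : Fin d → 𝔼 → ℝ}
    (h : HasWeakGrad S w G) (hw : IntegrableOn w S) (hG : ∀ i, IntegrableOn (G i) S)
    {p : ℝ≥0∞} (hp : 1 ≤ p) :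
    ∃ c : ℝ, eLpNorm (fun x => w x - c) p (volume.restrict S) ≤
      ENNReal.ofReal (2 ^ d * Metric.diam S) * ∑ i, eLpNorm (G i) p (volume.restrict S) := by
  obtain ⟨w', hwm, hwi, -, hww⟩ := exists_measurable_integrable_rep hS.measurableSet hw
  choose G' hGm hGi hG0 hGG using fun i => exists_measurable_integrable_rep hS.measurableSet (hG i)
  have h' : HasWeakGrad S w' G' := h.congr hS hww hGG
  have h0 : volume S ≠ 0 := (hS.measure_pos volume hne).ne'
  have hfin : volume S ≠ ⊤ := hb.measure_lt_top.ne
  have hP : IsProbabilityMeasure (ProbabilityTheory.cond volume S) :=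
    ProbabilityTheory.cond_isProbabilityMeasure_of_finite h0 hfin
  set P := ProbabilityTheory.cond volume S with hPdef
  set τ : Measure ℝ := volume.restrict (Ioc (0 : ℝ) 1) with hτ
  have hPac : P ≪ volume.restrict S := by
    rw [hPdef, ProbabilityTheory.cond]; exact Measure.smul_absolutelyContinuous
  have hPw : Integrable w' P := by
    rw [hPdef, ProbabilityTheory.cond]
    exact hwi.integrableOn.smul_measure (ENNReal.inv_ne_top.2 h0)
  set f : 𝔼 → ℝ := fun x => Metric.diam S * ∑ i, |G' i x| with hf
  have hfm : Measurable f := by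
    refine Measurable.const_mul ?_ _
    exact Finset.measurable_sum _ fun i _ => (hGm i).abs
  refine ⟨∫ x, w' x ∂P, ?_⟩
  -- the difference formula, for almost all pairs of points
  have hdg : ∀ G : Fin d → 𝔼 → ℝ, (∀ i, Measurable (G i)) →
      Measurable (fun q : (𝔼 × 𝔼) × ℝ => dirGrad G q.1.2 (q.1.1 + q.2 • q.1.2)) := by
    intro G hG
    refine Finset.measurable_sum _ fun i _ => ?_
    refine Measurable.mul ?_ ((hG i).comp (Continuous.measurable (by fun_prop)))
    exact (Continuous.measurable (by fun_prop))
  have hset : MeasurableSet {q : 𝔼 × 𝔼 | q.1 ∈ S → q.1 + q.2 ∈ S →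
      w' (q.1 + q.2) - w' q.1 = ∫ t in Ioc (0 : ℝ) 1, dirGrad G' q.2 (q.1 + t • q.2)} := by
    have m1 : Measurable fun q : 𝔼 × 𝔼 => w' (q.1 + q.2) - w' q.1 :=
      (hwm.comp (by fun_prop)).sub (hwm.comp measurable_fst)
    have m2 : Measurable fun q : 𝔼 × 𝔼 => ∫ t in Ioc (0 : ℝ) 1, dirGrad G' q.2 (q.1 + t • q.2) :=
      ((hdg G' hGm).stronglyMeasurable.integral_prod_right').measurable
    refine (measurableSet_setOfPred.2 ?_)
    refine Measurable.imp ?_ (Measurable.imp ?_ ?_)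
    · exact measurableSet_setOfPred.1 (hS.measurableSet.preimage measurable_fst)
    · exact measurableSet_setOfPred.1 (hS.measurableSet.preimage
        (by fun_prop : Measurable fun q : 𝔼 × 𝔼 => q.1 + q.2))
    · exact measurableSet_setOfPred.1 (measurableSet_eq_fun m1 m2)
  have hz : ∀ᵐ q ∂((volume : Measure 𝔼).prod (volume : Measure 𝔼)), q.1 ∈ S → q.1 + q.2 ∈ S →
      w' (q.1 + q.2) - w' q.1 = ∫ t in Ioc (0 : ℝ) 1, dirGrad G' q.2 (q.1 + t • q.2) := by
    rw [Measure.ae_prod_iff_ae_ae hset]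
    have h1 : ∀ᵐ q ∂((volume : Measure 𝔼).prod (volume : Measure 𝔼)), q.2 ∈ S → q.2 + q.1 ∈ S →
      w' (q.2 + q.1) - w' q.2 = ∫ t in Ioc (0 : ℝ) 1, dirGrad G' q.1 (q.2 + t • q.1) := by
      have hset' : MeasurableSet {q : 𝔼 × 𝔼 | q.2 ∈ S → q.2 + q.1 ∈ S →
        w' (q.2 + q.1) - w' q.2 = ∫ t in Ioc (0 : ℝ) 1, dirGrad G' q.1 (q.2 + t • q.1)} :=
        measurable_swap hset
      rw [Measure.ae_prod_iff_ae_ae hset']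
      exact Filter.Eventually.of_forall fun z => h'.ae_sub_eq hS hconv hwi hGi z
    have h2 := (Measure.measurePreserving_swap (μ := (volume : Measure 𝔼))
      (ν := (volume : Measure 𝔼))).quasiMeasurePreserving.ae h1
    exact Measure.ae_ae_of_ae_prod h2
  have hxy : ∀ᵐ q ∂((volume : Measure 𝔼).prod (volume : Measure 𝔼)), q.1 ∈ S → q.2 ∈ S →
      w' q.2 - w' q.1 = ∫ t in Ioc (0 : ℝ) 1, dirGrad G' (q.2 - q.1) (q.1 + t • (q.2 - q.1)) := by
    have h2 := (measurePreserving_prod_neg_add (volume : Measure 𝔼)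
      (volume : Measure 𝔼)).quasiMeasurePreserving.ae hz
    filter_upwards [h2] with q hq h3 h4
    simpa [sub_eq_add_neg, add_comm] using hq h3 (by simpa using h4)
  have hyx : ∀ᵐ y ∂(volume.restrict S), ∀ᵐ x ∂P,
      w' y - w' x = ∫ t in Ioc (0 : ℝ) 1, dirGrad G' (y - x) (x + t • (y - x)) := by
    have h2 := (Measure.measurePreserving_swap (μ := (volume : Measure 𝔼))
      (ν := (volume : Measure 𝔼))).quasiMeasurePreserving.ae hxy
    have h3 := Measure.ae_ae_of_ae_prod h2
    rw [ae_restrict_iff' hS.measurableSet]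
    filter_upwards [h3] with y hy hyS
    refine hPac.ae_le ?_
    change ∀ᵐ x ∂volume.restrict S, _
    rw [ae_restrict_iff' hS.measurableSet]
    filter_upwards [hy] with x hx hxS using hx hxS hyS
  have main := eLpNorm_le_of_map_prod_le (μ := volume.restrict S) (P := τ.prod P)
    (ν := volume.restrict S) (F := fun x => w' x - ∫ x, w' x ∂P)
    (Ψ := fun q : 𝔼 × ℝ × 𝔼 => q.2.2 + q.2.1 • (q.1 - q.2.2))
    (Continuous.measurable (by fun_prop)) (by simp : (2 ^ d : ℝ≥0∞) ≠ 0)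
    (map_segment_le hS.measurableSet hconv h0 hfin) hfm ?_ hp
  · have hae : (fun x => w x - ∫ x, w' x ∂P) =ᵐ[volume.restrict S]
        fun x => w' x - ∫ x, w' x ∂P := by
      filter_upwards [hww] with x hx; rw [hx]
    rw [eLpNorm_congr_ae hae]
    refine main.trans ?_
    have hf2 : eLpNorm f p (volume.restrict S) ≤ ENNReal.ofReal (Metric.diam S) *
        ∑ i, eLpNorm (G i) p (volume.restrict S) := by
      have : f = Metric.diam S • ∑ i, (fun x => |G' i x|) := by
        funext x; simp [hf]
      rw [this, eLpNorm_const_smul, Real.enorm_eq_ofReal Metric.diam_nonneg]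
      gcongr
      refine (eLpNorm_sum_le (fun i _ => (hGm i).abs.aestronglyMeasurable) hp).trans ?_
      refine Finset.sum_le_sum fun i _ => ?_
      rw [eLpNorm_congr_ae (hGG i)]
      exact (eLpNorm_norm (G' i)).le
    rw [ENNReal.ofReal_mul (by positivity), mul_assoc]
    refine mul_le_mul' ?_ hf2
    rw [ENNReal.ofReal_pow (by norm_num), ENNReal.ofReal_ofNat]
    conv_rhs => rw [← ENNReal.rpow_one (2 ^ d)]
    refine ENNReal.rpow_le_rpow_of_exponent_le (one_le_pow_of_one_le' (by norm_num) _) ?_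
    refine ENNReal.toReal_le_of_le_ofReal (by norm_num) ?_
    simpa using hp
  · filter_upwards [hyx, ae_restrict_mem hS.measurableSet] with y hy hyS
    have e1 : w' y - ∫ x, w' x ∂P = ∫ x, (w' y - w' x) ∂P := by
      rw [integral_sub (integrable_const _) hPw]; simp
    rw [e1]
    have hmf : Measurable fun o : ℝ × 𝔼 => ‖f (o.2 + o.1 • (y - o.2))‖ₑ :=
      (hfm.comp (Continuous.measurable (by fun_prop))).enorm
    rw [lintegral_prod_symm' _ hmf]
    refine (enorm_integral_le_lintegral_enorm _).trans (lintegral_mono_ae ?_)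
    have hxS : ∀ᵐ x ∂P, x ∈ S := hPac.ae_le (ae_restrict_mem hS.measurableSet)
    filter_upwards [hy, hxS] with x hx hxS
    rw [hx]
    refine (enorm_integral_le_lintegral_enorm _).trans (lintegral_mono fun t => ?_)
    rw [enorm_le_iff_norm_le, Real.norm_eq_abs, Real.norm_eq_abs]
    refine (abs_dirGrad_le _ _ _).trans ?_
    refine le_trans ?_ (le_abs_self _)
    refine mul_le_mul_of_nonneg_right ?_ (Finset.sum_nonneg fun i _ => abs_nonneg _)
    rw [← dist_eq_norm]
    exact Metric.dist_le_diam_of_mem hb hyS hxS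

theorem eLpNorm_restrict_union_le {X : Type*} [MeasurableSpace X] {μ : Measure X} {A B : Set X}
    (hA : MeasurableSet A) (hB : MeasurableSet B) {f : X → ℝ}
    (hfA : AEStronglyMeasurable f (μ.restrict A)) (hfB : AEStronglyMeasurable f (μ.restrict B))
    {p : ℝ≥0∞} (hp : 1 ≤ p) :
    eLpNorm f p (μ.restrict (A ∪ B)) ≤ eLpNorm f p (μ.restrict A) + eLpNorm f p (μ.restrict B) := by
  rw [← eLpNorm_indicator_eq_eLpNorm_restrict (hA.union hB),
    ← eLpNorm_indicator_eq_eLpNorm_restrict hA, ← eLpNorm_indicator_eq_eLpNorm_restrict hB]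
  have mA : AEStronglyMeasurable (fun x => ‖A.indicator f x‖) μ :=
    ((aestronglyMeasurable_indicator_iff hA).2 hfA).norm
  have mB : AEStronglyMeasurable (fun x => ‖B.indicator f x‖) μ :=
    ((aestronglyMeasurable_indicator_iff hB).2 hfB).norm
  rw [← eLpNorm_norm (A.indicator f), ← eLpNorm_norm (B.indicator f)]
  refine le_trans (eLpNorm_mono_real (g := (fun x => ‖A.indicator f x‖) + fun x => ‖B.indicator f x‖)
    fun x => ?_) (eLpNorm_add_le mA mB hp)
  by_cases h1 : x ∈ A <;> by_cases h2 : x ∈ B <;> simp [h1, h2]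

/-- Approximation by constants on two sets with a large intersection. -/
theorem exists_const_union {X : Type*} [MeasurableSpace X] {μ : Measure X} {A B : Set X}
    (hA : MeasurableSet A) (hB : MeasurableSet B) {w : X → ℝ}
    (hwA : AEStronglyMeasurable w (μ.restrict A)) (hwB : AEStronglyMeasurable w (μ.restrict B))
    {p : ℝ≥0∞} (hp : 1 ≤ p) (h0 : μ (A ∩ B) ≠ 0) {N : ℝ≥0∞} (hN1 : 1 ≤ N)
    (hN : μ B ≤ N * μ (A ∩ B)) {K L : ℝ≥0∞}
    (hKA : ∃ c : ℝ, eLpNorm (fun x => w x - c) p (μ.restrict A) ≤ K)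
    (hLB : ∃ c : ℝ, eLpNorm (fun x => w x - c) p (μ.restrict B) ≤ L) :
    ∃ c : ℝ, eLpNorm (fun x => w x - c) p (μ.restrict (A ∪ B)) ≤ K + L + N * (K + L) := by
  obtain ⟨a, ha⟩ := hKA
  obtain ⟨b, hb⟩ := hLB
  have hp0 : p ≠ 0 := (zero_lt_one.trans_le hp).ne'
  have hAB : μ.restrict (A ∩ B) ≠ 0 := by rwa [Ne, Measure.restrict_eq_zero]
  have hB0 : μ.restrict B ≠ 0 := by
    rw [Ne, Measure.restrict_eq_zero]
    exact fun h => h0 (measure_mono_null inter_subset_right h)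
  have mA : ∀ c : ℝ, AEStronglyMeasurable (fun x => w x - c) (μ.restrict A) :=
    fun c => hwA.sub aestronglyMeasurable_const
  have mB : ∀ c : ℝ, AEStronglyMeasurable (fun x => w x - c) (μ.restrict B) :=
    fun c => hwB.sub aestronglyMeasurable_const
  have h1 : eLpNorm (fun _ : X => b - a) p (μ.restrict (A ∩ B)) ≤ K + L := by
    have : (fun _ : X => b - a) = (fun x => w x - a) - fun x => w x - b := by
      funext x; simp
    rw [this]
    refine (eLpNorm_sub_le ((mA a).mono_measure (Measure.restrict_mono inter_subset_left le_rfl))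
      ((mB b).mono_measure (Measure.restrict_mono inter_subset_right le_rfl)) hp).trans ?_
    exact add_le_add
      ((eLpNorm_mono_measure _ (Measure.restrict_mono inter_subset_left le_rfl)).trans ha)
      ((eLpNorm_mono_measure _ (Measure.restrict_mono inter_subset_right le_rfl)).trans hb)
  have h2 : eLpNorm (fun _ : X => b - a) p (μ.restrict B) ≤ N * (K + L) := by
    refine le_trans ?_ (mul_le_mul_right h1 N)
    rw [eLpNorm_const _ hp0 hB0, eLpNorm_const _ hp0 hAB, mul_left_comm]
    refine mul_le_mul_right ?_ _
    rw [Measure.restrict_apply_univ, Measure.restrict_apply_univ]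
    calc μ B ^ (1 / p.toReal) ≤ (N * μ (A ∩ B)) ^ (1 / p.toReal) :=
          ENNReal.rpow_le_rpow hN (by positivity)
      _ = N ^ (1 / p.toReal) * μ (A ∩ B) ^ (1 / p.toReal) :=
          ENNReal.mul_rpow_of_nonneg _ _ (by positivity)
      _ ≤ N ^ (1 : ℝ) * μ (A ∩ B) ^ (1 / p.toReal) := by
          gcongr
          · rcases eq_or_ne p ⊤ with rfl | hpt
            · simp
            · have : 1 ≤ p.toReal := by
                rw [← ENNReal.toReal_one]; exact ENNReal.toReal_mono hpt hp
              rw [div_le_one (by linarith)]; exact this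
      _ = _ := by rw [ENNReal.rpow_one]
  refine ⟨a, (eLpNorm_restrict_union_le hA hB (mA a) (mB a) hp).trans ?_⟩
  have h3 : eLpNorm (fun x => w x - a) p (μ.restrict B) ≤ L + N * (K + L) := by
    have : (fun x => w x - a) = (fun x => w x - b) + fun _ : X => b - a := by
      funext x; simp
    rw [this]
    exact (eLpNorm_add_le (mB b) aestronglyMeasurable_const hp).trans (add_le_add hb h2)
  rw [add_assoc]
  exact add_le_add ha h3

/-- Barycentric coordinates of a nondegenerate simplex. -/
theorem exists_barycentric_coords {S : Finset 𝔼} (hcard : S.card = d + 1)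
    (hind : AffineIndependent ℝ ((↑) : S → 𝔼)) :
    ∃ f : 𝔼 → (𝔼 →ᵃ[ℝ] ℝ), (∀ v ∈ S, f v v = 1) ∧ (∀ v ∈ S, ∀ u ∈ S, u ≠ v → f v u = 0) ∧
      (∀ x, x ∈ convexHull ℝ (S : Set 𝔼) ↔ ∀ v ∈ S, 0 ≤ f v x) ∧
      (∀ x, x ∈ interior (convexHull ℝ (S : Set 𝔼)) ↔ ∀ v ∈ S, 0 < f v x) ∧
      (∀ x, ∑ v ∈ S, f v x = 1) ∧ (∀ x, ∑ v ∈ S, f v x • v = x) := by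
  classical
  have htop : affineSpan ℝ (range ((↑) : S → 𝔼)) = ⊤ := by
    rw [hind.affineSpan_eq_top_iff_card_eq_finrank_add_one]
    simp [hcard]
  let b : AffineBasis S ℝ 𝔼 := ⟨(↑), hind, htop⟩
  have hb : ∀ i : S, b i = i := fun i => rfl
  have hr : range b = (S : Set 𝔼) := by
    ext x; simp [hb]
  refine ⟨fun v => if h : v ∈ S then b.coord ⟨v, h⟩ else 0, ?_, ?_, ?_, ?_, ?_, ?_⟩
  · intro v hv
    simp only [hv, dif_pos]
    exact b.coord_apply_eq ⟨v, hv⟩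
  · intro v hv u hu huv
    simp only [hv, dif_pos]
    exact b.coord_apply_ne (i := ⟨v, hv⟩) (j := ⟨u, hu⟩) (fun h => huv (by simpa using h.symm))
  · intro x
    rw [← hr, b.convexHull_eq_nonneg_coord]
    refine ⟨fun h v hv => ?_, fun h i => ?_⟩
    · simp only [hv, dif_pos]; exact h ⟨v, hv⟩
    · have := h i i.2
      simpa only [i.2, dif_pos] using this
  · intro x
    rw [← hr, b.interior_convexHull]
    refine ⟨fun h v hv => ?_, fun h i => ?_⟩
    · simp only [hv, dif_pos]; exact h ⟨v, hv⟩
    · have := h i i.2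
      simpa only [i.2, dif_pos] using this
  · intro x
    rw [← b.sum_coord_apply_eq_one x, ← Finset.sum_coe_sort S]
    refine Finset.sum_congr rfl fun i _ => ?_
    simp only [i.2, dif_pos]
  · intro x
    conv_rhs => rw [← b.linear_combination_coord_eq_self x]
    rw [← Finset.sum_coe_sort S]
    refine Finset.sum_congr rfl fun i _ => ?_
    simp only [i.2, dif_pos, hb]

theorem AffineMap.apply_centroid {V : Type*} [AddCommGroup V] [Module ℝ V] (f : V →ᵃ[ℝ] ℝ)
    {G : Finset V} (hG : G.Nonempty) :
    f ((G.card : ℝ)⁻¹ • ∑ v ∈ G, v) = (G.card : ℝ)⁻¹ * ∑ v ∈ G, f v := by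
  have hc : (G.card : ℝ) ≠ 0 := by exact_mod_cast hG.card_pos.ne'
  have hf : ∀ y, f y = f.linear y + f 0 := fun y => by
    have := f.map_vadd 0 y
    simpa using this
  have hs : ∑ v ∈ G, f v = ∑ v ∈ G, f.linear v + G.card * f 0 := by
    rw [Finset.sum_congr rfl fun v _ => hf v, Finset.sum_add_distrib, Finset.sum_const,
      nsmul_eq_mul]
  rw [hf, map_smul, map_sum, hs, smul_eq_mul, mul_add, inv_mul_cancel_left₀ hc]

theorem AffineMap.apply_add_vec {V : Type*} [AddCommGroup V] [Module ℝ V] (f : V →ᵃ[ℝ] ℝ)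
    (x z : V) : f (x + z) = f x + f.linear z := by
  have := f.map_vadd x z
  rw [vadd_eq_add, vadd_eq_add] at this
  rw [add_comm x z, this, add_comm]

/-- An affine function with values in `[0, 1]` on a ball of radius `r` has slope at most `2 / r`. -/
theorem abs_linear_le_of_ball {f : 𝔼 →ᵃ[ℝ] ℝ} {c : 𝔼} {r : ℝ} (hr : 0 < r)
    (h : ∀ x ∈ Metric.ball c r, 0 ≤ f x ∧ f x ≤ 1) (z : 𝔼) :
    |f.linear z| ≤ 2 / r * ‖z‖ := by
  rcases eq_or_ne z 0 with rfl | hz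
  · simp
  have hz' : 0 < ‖z‖ := norm_pos_iff.2 hz
  have h1 := h c (Metric.mem_ball_self hr)
  have h2 := h (c + (r / 2 / ‖z‖) • z) (by
    rw [Metric.mem_ball, dist_eq_norm, add_sub_cancel_left, norm_smul, Real.norm_eq_abs,
      abs_of_pos (by positivity), div_mul_cancel₀ _ hz'.ne']
    linarith)
  rw [f.apply_add_vec, map_smul, smul_eq_mul] at h2
  have h3 : |r / 2 / ‖z‖ * f.linear z| ≤ 1 := by
    rw [abs_le]; constructor <;> linarith
  rw [abs_mul, abs_of_pos (by positivity)] at h3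
  have h4 : |f.linear z| = (2 / r * ‖z‖) * (r / 2 / ‖z‖ * |f.linear z|) := by field_simp
  rw [h4]
  calc _ ≤ (2 / r * ‖z‖) * 1 := mul_le_mul_of_nonneg_left h3 (by positivity)
    _ = _ := mul_one _

/-- A connected polytope of dimension `d ≥ 1` with a shape regular simplicial partition. -/
structure IsRegularPolytope (ρ : ℝ) (U : Set 𝔼) (𝒮 : Finset (Finset 𝔼)) : Prop where
  one_le_dim : 1 ≤ d
  rho_pos : 0 < ρ
  isConnected : IsConnected U
  isSimplicialPartition : IsSimplicialPartition U 𝒮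
  le_inradius : ∀ S ∈ 𝒮, ρ ^ 2 * Metric.diam U ≤ setInradius (convexHull ℝ (S : Set 𝔼))

namespace IsRegularPolytope

variable {ρ : ℝ} {U : Set (EuclideanSpace ℝ (Fin d))}
  {𝒮 : Finset (Finset (EuclideanSpace ℝ (Fin d)))}

theorem isOpen (h : IsRegularPolytope ρ U 𝒮) : IsOpen U := by
  rw [← h.isSimplicialPartition.interior_closure]; exact isOpen_interior

theorem isCompact_closure (h : IsRegularPolytope ρ U 𝒮) : IsCompact (closure U) := by
  rw [h.isSimplicialPartition.closure_eq]
  exact 𝒮.isCompact_biUnion fun S _ => S.finite_toSet.isCompact_convexHull ℝ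

theorem isBounded (h : IsRegularPolytope ρ U 𝒮) : Bornology.IsBounded U :=
  h.isCompact_closure.isBounded.subset subset_closure

theorem isClosed_convexHull (S : Finset 𝔼) : IsClosed (convexHull ℝ (S : Set 𝔼)) :=
  (S.finite_toSet.isCompact_convexHull ℝ).isClosed

theorem diam_pos (h : IsRegularPolytope ρ U 𝒮) : 0 < Metric.diam U := by
  have := h.one_le_dim
  obtain ⟨x, hx⟩ := h.isConnected.nonempty
  obtain ⟨ε, hε, hb⟩ := Metric.isOpen_iff.1 h.isOpen x hx
  let z : 𝔼 := EuclideanSpace.single (⟨0, by omega⟩ : Fin d) (ε / 2)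
  have hz : ‖z‖ = ε / 2 := by
    simp [z, abs_of_pos hε]
  have hxz : x + z ∈ U := hb (by rw [Metric.mem_ball, dist_eq_norm, add_sub_cancel_left, hz]; linarith)
  have := Metric.dist_le_diam_of_mem h.isBounded hxz hx
  rw [dist_eq_norm, add_sub_cancel_left, hz] at this
  linarith

theorem convexHull_subset (h : IsRegularPolytope ρ U 𝒮) {S : Finset 𝔼} (hS : S ∈ 𝒮) :
    convexHull ℝ (S : Set 𝔼) ⊆ closure U := by
  rw [h.isSimplicialPartition.closure_eq]
  exact subset_biUnion_of_mem (u := fun S : Finset 𝔼 => convexHull ℝ (S : Set 𝔼)) hS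

theorem interior_convexHull_subset (h : IsRegularPolytope ρ U 𝒮) {S : Finset 𝔼} (hS : S ∈ 𝒮) :
    interior (convexHull ℝ (S : Set 𝔼)) ⊆ U := by
  conv_rhs => rw [← h.isSimplicialPartition.interior_closure]
  exact interior_mono (h.convexHull_subset hS)

theorem exists_mem (h : IsRegularPolytope ρ U 𝒮) {x : 𝔼} (hx : x ∈ closure U) :
    ∃ S ∈ 𝒮, x ∈ convexHull ℝ (S : Set 𝔼) := by
  rw [h.isSimplicialPartition.closure_eq] at hx
  simpa using hx

/-- The radius of a ball contained in each simplex. -/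
def radius (ρ : ℝ) (U : Set 𝔼) : ℝ := ρ ^ 2 * Metric.diam U / 2

theorem radius_pos (h : IsRegularPolytope ρ U 𝒮) : 0 < radius ρ U := by
  have := h.diam_pos
  have := h.rho_pos
  unfold radius; positivity

theorem exists_ball_subset (h : IsRegularPolytope ρ U 𝒮) {S : Finset 𝔼} (hS : S ∈ 𝒮) :
    ∃ c, Metric.ball c (radius ρ U) ⊆ convexHull ℝ (S : Set 𝔼) := by
  have h1 : radius ρ U < setInradius (convexHull ℝ (S : Set 𝔼)) := by
    refine lt_of_lt_of_le ?_ (h.le_inradius S hS)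
    have h2 := h.radius_pos
    unfold radius at h2 ⊢
    linarith
  obtain ⟨r, ⟨c, hc⟩, hr⟩ := exists_lt_of_lt_csSup
    (⟨0, (0 : 𝔼), by simp⟩ : Set.Nonempty {r : ℝ | ∃ x : 𝔼, Metric.ball x r ⊆ convexHull ℝ (S : Set 𝔼)}) h1
  exact ⟨c, (Metric.ball_subset_ball hr.le).trans hc⟩

theorem dist_le_diam (h : IsRegularPolytope ρ U 𝒮) {x y : 𝔼} (hx : x ∈ closure U)
    (hy : y ∈ closure U) : dist x y ≤ Metric.diam U := by
  rw [← Metric.diam_closure]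
  exact Metric.dist_le_diam_of_mem h.isCompact_closure.isBounded hx hy

/-- If two simplices meet in `U`, they have a common point which is the centre of a ball in `U` of
controlled radius. -/
theorem exists_common_ball (h : IsRegularPolytope ρ U 𝒮) {S T : Finset 𝔼} (hS : S ∈ 𝒮)
    (hT : T ∈ 𝒮) {x : 𝔼} (hxU : x ∈ U) (hxS : x ∈ convexHull ℝ (S : Set 𝔼))
    (hxT : x ∈ convexHull ℝ (T : Set 𝔼)) :
    ∃ b, b ∈ convexHull ℝ (S : Set 𝔼) ∧ b ∈ convexHull ℝ (T : Set 𝔼) ∧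
      Metric.ball b (radius ρ U / (2 * (d + 1))) ⊆ U := by
  classical
  have hP := h.isSimplicialPartition
  have hr := h.radius_pos
  choose! f hf1 hf0 hfc hfi hfs hfx using fun (R : Finset 𝔼) (hR : R ∈ 𝒮) =>
    exists_barycentric_coords (hP.card_eq R hR) (hP.indep R hR)
  -- coordinates vanish on the hulls of the other vertices
  have hvan : ∀ R ∈ 𝒮, ∀ v ∈ R, ∀ A : Set 𝔼, A ⊆ (R : Set 𝔼) → v ∉ A →
      ∀ y ∈ convexHull ℝ A, f R v y ≤ 0 := by
    intro R hR v hv A hA hvA y hy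
    have hsub : A ⊆ {y | f R v y ≤ 0} := fun u hu =>
      (hf0 R hR v hv u (hA hu) (fun e => hvA (e ▸ hu))).le
    have hcv : Convex ℝ {y | f R v y ≤ 0} := (convex_Iic (0 : ℝ)).affine_preimage (f R v)
    exact convexHull_min hsub hcv hy
  let G : Finset 𝔼 := S.filter fun v => 0 < f S v x
  have hxG : x ∈ convexHull ℝ (G : Set 𝔼) := by
    have e : ∑ v ∈ G, f S v x • v = x := by
      conv_rhs => rw [← hfx S hS x]
      refine Finset.sum_subset (Finset.filter_subset _ _) fun v hv hvG => ?_
      have : f S v x ≤ 0 := not_lt.1 fun hlt => hvG (Finset.mem_filter.2 ⟨hv, hlt⟩)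
      rw [le_antisymm this ((hfc S hS x).1 hxS v hv), zero_smul]
    have e1 : ∑ v ∈ G, f S v x = 1 := by
      rw [← hfs S hS x]
      refine Finset.sum_subset (Finset.filter_subset _ _) fun v hv hvG => ?_
      have : f S v x ≤ 0 := not_lt.1 fun hlt => hvG (Finset.mem_filter.2 ⟨hv, hlt⟩)
      exact le_antisymm this ((hfc S hS x).1 hxS v hv)
    rw [← e]
    refine (convex_convexHull ℝ (G : Set 𝔼)).sum_mem (fun v hv => ?_) e1
      (fun v hv => subset_convexHull ℝ _ hv)
    exact (Finset.mem_filter.1 hv).2.le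
  have hGne : G.Nonempty := by
    have := convexHull_nonempty_iff.1 ⟨x, hxG⟩
    simpa using this
  have hGsub : ∀ R ∈ 𝒮, x ∈ convexHull ℝ (R : Set 𝔼) → G ⊆ R := by
    intro R hR hxR v hv
    by_contra hvR
    have hv' := Finset.mem_filter.1 hv
    have hxSR : x ∈ convexHull ℝ ((S : Set 𝔼) ∩ (R : Set 𝔼)) := by
      rw [← hP.inter_eq S hS R hR]; exact ⟨hxS, hxR⟩
    have := hvan S hS v hv'.1 _ inter_subset_left (fun hh => hvR hh.2) x hxSR
    exact absurd hv'.2 (not_lt.2 this)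
  have hzero : ∀ R ∈ 𝒮, x ∈ convexHull ℝ (R : Set 𝔼) → ∀ v ∈ R, v ∉ G → f R v x = 0 := by
    intro R hR hxR v hv hvG
    refine le_antisymm ?_ ((hfc R hR x).1 hxR v hv)
    exact hvan R hR v hv (G : Set 𝔼) (by exact_mod_cast hGsub R hR hxR) (by exact_mod_cast hvG) x hxG
  let b : 𝔼 := (G.card : ℝ)⁻¹ • ∑ v ∈ G, v
  have hbG : b ∈ convexHull ℝ (G : Set 𝔼) := by
    have hc : (G.card : ℝ) ≠ 0 := by exact_mod_cast hGne.card_pos.ne'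
    simp only [b, Finset.smul_sum]
    refine (convex_convexHull ℝ (G : Set 𝔼)).sum_mem (fun v hv => by positivity) ?_
      (fun v hv => subset_convexHull ℝ _ hv)
    simp [hc]
  refine ⟨b, convexHull_mono (by exact_mod_cast hGsub S hS hxS) hbG,
    convexHull_mono (by exact_mod_cast hGsub T hT hxT) hbG, ?_⟩
  suffices hball : Metric.ball b (radius ρ U / (2 * (d + 1))) ⊆ closure U by
    conv_rhs => rw [← hP.interior_closure]
    exact interior_maximal hball Metric.isOpen_ball
  intro y hy
  set z := y - b with hz
  have hyz : y = b + z := by rw [hz]; abel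
  have hzn : ‖z‖ < radius ρ U / (2 * (d + 1)) := by rwa [hz, ← dist_eq_norm]
  let W : Set 𝔼 := U ∩ ⋂ (R : Finset 𝔼) (_ : R ∈ 𝒮.filter (fun R : Finset 𝔼 => x ∉ convexHull ℝ (R : Set 𝔼))),
    (convexHull ℝ (R : Set 𝔼))ᶜ
  have hW : IsOpen W := by
    refine h.isOpen.inter ?_
    exact isOpen_biInter_finset fun R _ => (isClosed_convexHull R).isOpen_compl
  have hxW : x ∈ W := by
    refine ⟨hxU, ?_⟩
    simp only [Finset.mem_filter, mem_iInter, mem_compl_iff]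
    exact fun R hR => hR.2
  have hcont : Filter.Tendsto (fun t : ℝ => x + t • z) (nhdsWithin 0 (Ioi 0)) (nhds x) := by
    have : Continuous fun t : ℝ => x + t • z := by fun_prop
    have h2 := this.tendsto 0
    simp only [zero_smul, add_zero] at h2
    exact h2.mono_left nhdsWithin_le_nhds
  obtain ⟨t, htW, ht⟩ := ((hcont.eventually (hW.mem_nhds hxW)).and self_mem_nhdsWithin).exists
  have ht : 0 < t := ht
  obtain ⟨R, hR, hxtR⟩ := h.exists_mem (subset_closure htW.1)
  have hxR : x ∈ convexHull ℝ (R : Set 𝔼) := by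
    by_contra hxR
    have := htW.2
    simp only [Finset.mem_filter, mem_iInter, mem_compl_iff] at this
    exact this R ⟨hR, hxR⟩ hxtR
  refine h.convexHull_subset hR ((hfc R hR y).2 fun v hv => ?_)
  rw [hyz, AffineMap.apply_add_vec, AffineMap.apply_centroid _ hGne]
  by_cases hvG : v ∈ G
  · have e : ∑ u ∈ G, f R v u = 1 := by
      rw [Finset.sum_eq_single v (fun u hu huv => hf0 R hR v hv u (hGsub R hR hxR hu) huv)
        (fun hn => absurd hvG hn), hf1 R hR v hv]
    rw [e, mul_one]
    obtain ⟨c, hc⟩ := h.exists_ball_subset hR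
    have hlip := abs_linear_le_of_ball (f := f R v) hr (fun u hu => by
      have hu' := (hfc R hR u).1 (hc hu)
      refine ⟨hu' v hv, ?_⟩
      rw [← hfs R hR u]
      exact Finset.single_le_sum (f := fun v => f R v u) hu' hv) z
    have hcard : (G.card : ℝ) ≤ d + 1 := by
      have := Finset.card_le_card (hGsub R hR hxR)
      rw [hP.card_eq R hR] at this
      exact_mod_cast this
    have hcpos : 0 < (G.card : ℝ) := by exact_mod_cast hGne.card_pos
    have h1 : ((d : ℝ) + 1)⁻¹ ≤ (G.card : ℝ)⁻¹ := inv_anti₀ hcpos hcard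
    have h2 : 2 / radius ρ U * ‖z‖ ≤ ((d : ℝ) + 1)⁻¹ := by
      have h3 : ‖z‖ * (2 / radius ρ U) ≤ radius ρ U / (2 * (d + 1)) * (2 / radius ρ U) :=
        mul_le_mul_of_nonneg_right hzn.le (by positivity)
      have h4 : radius ρ U / (2 * ((d : ℝ) + 1)) * (2 / radius ρ U) = ((d : ℝ) + 1)⁻¹ := by
        field_simp
      linarith
    have := neg_abs_le ((f R v).linear z)
    linarith
  · have e : ∑ u ∈ G, f R v u = 0 :=
      Finset.sum_eq_zero fun u hu => hf0 R hR v hv u (hGsub R hR hxR hu) (fun e => hvG (e ▸ hu))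
    rw [e, mul_zero, zero_add]
    have h1 := (hfc R hR _).1 hxtR v hv
    rw [AffineMap.apply_add_vec, hzero R hR hxR v hv hvG, map_smul, zero_add, smul_eq_mul] at h1
    exact nonneg_of_mul_nonneg_right h1 ht

theorem disjoint_interior (h : IsRegularPolytope ρ U 𝒮) {S T : Finset 𝔼} (hS : S ∈ 𝒮)
    (hT : T ∈ 𝒮) (hST : S ≠ T) :
    Disjoint (interior (convexHull ℝ (S : Set 𝔼))) (interior (convexHull ℝ (T : Set 𝔼))) := by
  have hP := h.isSimplicialPartition
  obtain ⟨f, -, hf0, -, hfi, -⟩ := exists_barycentric_coords (hP.card_eq S hS) (hP.indep S hS)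
  rw [Set.disjoint_left]
  intro y hyS hyT
  obtain ⟨v, hvS, hvT⟩ : ∃ v ∈ S, v ∉ T := by
    by_contra! hcon
    exact hST (Finset.eq_of_subset_of_card_le hcon (by rw [hP.card_eq S hS, hP.card_eq T hT]))
  have hy : y ∈ convexHull ℝ ((S : Set 𝔼) ∩ (T : Set 𝔼)) := by
    rw [← hP.inter_eq S hS T hT]; exact ⟨interior_subset hyS, interior_subset hyT⟩
  have hsub : (S : Set 𝔼) ∩ (T : Set 𝔼) ⊆ {y | f v y ≤ 0} := fun u hu =>
    (hf0 v hvS u hu.1 (fun e => hvT (e ▸ hu.2))).le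
  have hcv : Convex ℝ {y | f v y ≤ 0} := (convex_Iic (0 : ℝ)).affine_preimage (f v)
  exact absurd ((hfi y).1 hyS v hvS) (not_lt.2 (convexHull_min hsub hcv hy))

end IsRegularPolytope

namespace IsRegularPolytope

variable {ρ : ℝ} {U : Set (EuclideanSpace ℝ (Fin d))}
  {𝒮 : Finset (Finset (EuclideanSpace ℝ (Fin d)))}

theorem ball_subset_interior {S : Finset 𝔼} {c : 𝔼} {r : ℝ}
    (hc : Metric.ball c r ⊆ convexHull ℝ (S : Set 𝔼)) :
    Metric.ball c r ⊆ interior (convexHull ℝ (S : Set 𝔼)) :=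
  interior_maximal hc Metric.isOpen_ball

theorem volume_ball_le (h : IsRegularPolytope ρ U 𝒮) {S : Finset 𝔼} (hS : S ∈ 𝒮) (x : 𝔼) :
    volume (Metric.ball x (radius ρ U)) ≤ volume (interior (convexHull ℝ (S : Set 𝔼))) := by
  obtain ⟨c, hc⟩ := h.exists_ball_subset hS
  rw [Measure.addHaar_ball_center, ← Measure.addHaar_ball_center volume c]
  exact measure_mono (ball_subset_interior hc)

theorem card_le (h : IsRegularPolytope ρ U 𝒮) : (𝒮.card : ℝ) ≤ (2 / ρ ^ 2) ^ d := by
  have hr := h.radius_pos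
  have hρ := h.rho_pos
  have hdiam := h.diam_pos
  obtain ⟨x, hx⟩ := h.isConnected.nonempty
  have h1 : ∑ S ∈ 𝒮, volume (interior (convexHull ℝ (S : Set 𝔼))) ≤
      volume (Metric.closedBall x (Metric.diam U)) := by
    rw [← measure_biUnion_finset]
    · refine measure_mono (iUnion₂_subset fun S hS y hy => ?_)
      rw [Metric.mem_closedBall]
      exact h.dist_le_diam (subset_closure (h.interior_convexHull_subset hS hy)) (subset_closure hx)
    · intro S hS T hT hST; exact h.disjoint_interior hS hT hST
    · intro S _; exact isOpen_interior.measurableSet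
  have h2 : 𝒮.card * volume (Metric.ball x (radius ρ U)) ≤
      volume (Metric.closedBall x (Metric.diam U)) := by
    refine le_trans ?_ h1
    rw [← nsmul_eq_mul, ← Finset.sum_const]
    exact Finset.sum_le_sum fun S hS => h.volume_ball_le hS x
  have hv0 : volume (Metric.ball (0 : 𝔼) 1) ≠ 0 := (Metric.measure_ball_pos volume _ one_pos).ne'
  have hvt : volume (Metric.ball (0 : 𝔼) 1) ≠ ⊤ := measure_ball_lt_top.ne
  rw [Measure.addHaar_ball_of_pos _ _ hr, Measure.addHaar_closedBall _ _ hdiam.le, ← mul_assoc] at h2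
  have h3 := (ENNReal.mul_le_mul_iff_left hv0 hvt).1 h2
  rw [finrank_euclideanSpace_fin, ← ENNReal.ofReal_natCast, ← ENNReal.ofReal_mul (by positivity),
    ENNReal.ofReal_le_ofReal_iff (by positivity)] at h3
  rw [← le_div_iff₀ (by positivity), ← div_pow] at h3
  refine h3.trans_eq ?_
  unfold radius
  congr 1
  field_simp

/-- The scaling factor which maps a simplex into the ball around one of its points. -/
def shrink (d : ℕ) (ρ : ℝ) : ℝ := min 1 (ρ ^ 2 / (8 * (d + 1)))

theorem shrink_pos (d : ℕ) {ρ : ℝ} (hρ : 0 < ρ) : 0 < shrink d ρ :=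
  lt_min one_pos (by positivity)

theorem volume_interior_le (h : IsRegularPolytope ρ U 𝒮) {S : Finset 𝔼} (hS : S ∈ 𝒮) {b : 𝔼}
    (hb : b ∈ convexHull ℝ (S : Set 𝔼)) :
    volume (interior (convexHull ℝ (S : Set 𝔼))) ≤ ENNReal.ofReal ((shrink d ρ ^ d)⁻¹) *
      volume (interior (convexHull ℝ (S : Set 𝔼)) ∩
        Metric.ball b (radius ρ U / (2 * (d + 1)))) := by
  have hη := shrink_pos d h.rho_pos
  have e := volume_preimage_affine ((1 - shrink d ρ) • b) hη.ne'
    (interior (convexHull ℝ (S : Set 𝔼)) ∩ Metric.ball b (radius ρ U / (2 * (d + 1))))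
  rw [abs_of_pos (by positivity)] at e
  rw [← e]
  refine measure_mono fun y hy => ?_
  have hyy : (1 - shrink d ρ) • b + shrink d ρ • y = b + shrink d ρ • (y - b) := by module
  rw [mem_preimage, hyy]
  have hcv := convex_convexHull ℝ (S : Set 𝔼)
  refine ⟨hcv.add_smul_sub_mem_interior hb hy ⟨hη, min_le_left _ _⟩, ?_⟩
  rw [Metric.mem_ball, dist_eq_norm, add_sub_cancel_left, norm_smul, Real.norm_eq_abs,
    abs_of_pos hη, ← dist_eq_norm]
  have h1 : dist y b ≤ Metric.diam U :=
    h.dist_le_diam (h.convexHull_subset hS (interior_subset hy)) (h.convexHull_subset hS hb)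
  have h2 : shrink d ρ ≤ ρ ^ 2 / (8 * (d + 1)) := min_le_right _ _
  have hρ := h.rho_pos
  have hd := h.diam_pos
  calc shrink d ρ * dist y b ≤ ρ ^ 2 / (8 * (d + 1)) * Metric.diam U := by gcongr
    _ < radius ρ U / (2 * (d + 1)) := by
        have : 0 < ρ ^ 2 * Metric.diam U / (8 * ((d : ℝ) + 1)) := by positivity
        have e2 : radius ρ U / (2 * (d + 1)) = 2 * (ρ ^ 2 * Metric.diam U / (8 * ((d : ℝ) + 1))) := by
          unfold radius; field_simp; norm_num
        have e3 : ρ ^ 2 / (8 * (d + 1)) * Metric.diam U =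
          ρ ^ 2 * Metric.diam U / (8 * ((d : ℝ) + 1)) := by ring
        rw [e2, e3]; linarith

theorem volume_ball_le_inter (h : IsRegularPolytope ρ U 𝒮) {S : Finset 𝔼} (hS : S ∈ 𝒮) {b : 𝔼}
    (hb : b ∈ convexHull ℝ (S : Set 𝔼)) :
    volume (Metric.ball b (radius ρ U / (2 * (d + 1)))) ≤ ENNReal.ofReal ((shrink d ρ ^ d)⁻¹) *
      volume (interior (convexHull ℝ (S : Set 𝔼)) ∩
        Metric.ball b (radius ρ U / (2 * (d + 1)))) := by
  refine le_trans (measure_mono (Metric.ball_subset_ball ?_))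
    ((h.volume_ball_le hS b).trans (h.volume_interior_le hS hb))
  have := h.radius_pos
  rw [div_le_iff₀ (by positivity)]
  have : (0 : ℝ) ≤ d := by positivity
  nlinarith

/-- A proper nonempty family of simplices has a neighbour in the complement. -/
theorem exists_neighbour (h : IsRegularPolytope ρ U 𝒮) {A : Finset (Finset 𝔼)} (hA : A ⊂ 𝒮)
    (hne : A.Nonempty) :
    ∃ S ∈ A, ∃ T ∈ 𝒮, T ∉ A ∧ ∃ x ∈ U, x ∈ convexHull ℝ (S : Set 𝔼) ∧
      x ∈ convexHull ℝ (T : Set 𝔼) := by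
  classical
  have hint : ∀ S ∈ 𝒮, (U ∩ convexHull ℝ (S : Set 𝔼)).Nonempty := by
    intro S hS
    obtain ⟨c, hc⟩ := h.exists_ball_subset hS
    have hcm := ball_subset_interior hc (Metric.mem_ball_self h.radius_pos)
    exact ⟨c, h.interior_convexHull_subset hS hcm, interior_subset hcm⟩
  have hcl : ∀ B : Finset (Finset 𝔼), IsClosed (⋃ S ∈ B, convexHull ℝ (S : Set 𝔼)) := fun B =>
    B.finite_toSet.isClosed_biUnion fun S _ => isClosed_convexHull S
  have key := isPreconnected_closed_iff.1 h.isConnected.isPreconnected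
    (⋃ S ∈ A, convexHull ℝ (S : Set 𝔼)) (⋃ S ∈ 𝒮 \ A, convexHull ℝ (S : Set 𝔼)) (hcl A)
    (hcl (𝒮 \ A)) ?_ ?_ ?_
  · obtain ⟨x, hxU, hx1, hx2⟩ := key
    simp only [mem_iUnion, Finset.mem_sdiff, exists_prop] at hx1 hx2
    obtain ⟨S, hS, hxS⟩ := hx1
    obtain ⟨T, hT, hxT⟩ := hx2
    exact ⟨S, hS, T, hT.1, hT.2, x, hxU, hxS, hxT⟩
  · intro x hx
    obtain ⟨S, hS, hxS⟩ := h.exists_mem (subset_closure hx)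
    by_cases hSA : S ∈ A
    · exact Or.inl (mem_biUnion (t := fun S : Finset 𝔼 => convexHull ℝ (S : Set 𝔼)) hSA hxS)
    · refine Or.inr ?_
      simp only [mem_iUnion, Finset.mem_sdiff, exists_prop]
      exact ⟨S, ⟨hS, hSA⟩, hxS⟩
  · obtain ⟨S, hS⟩ := hne
    obtain ⟨x, hxU, hxS⟩ := hint S (hA.1 hS)
    exact ⟨x, hxU, mem_biUnion (t := fun S : Finset 𝔼 => convexHull ℝ (S : Set 𝔼)) hS hxS⟩
  · obtain ⟨T, hT, hTA⟩ := Finset.exists_of_ssubset hA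
    obtain ⟨x, hxU, hxS⟩ := hint T hT
    refine ⟨x, hxU, ?_⟩
    simp only [mem_iUnion, Finset.mem_sdiff, exists_prop]
    exact ⟨T, ⟨hT, hTA⟩, hxS⟩

/-- The growth of the Poincaré constant along a chain of overlapping convex sets. -/
def chainConst (N : ℝ≥0∞) : ℕ → ℝ≥0∞
  | 0 => 1
  | n + 1 => (chainConst N n + 1 + N * (chainConst N n + 1)) + 1 +
      N * ((chainConst N n + 1 + N * (chainConst N n + 1)) + 1)

theorem chainConst_mono (N : ℝ≥0∞) : Monotone (chainConst N) := by
  refine monotone_nat_of_le_succ fun n => ?_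
  rw [chainConst, add_assoc _ (1 : ℝ≥0∞), add_assoc (chainConst N n), add_assoc]
  exact le_self_add

theorem chainConst_ne_top {N : ℝ≥0∞} (hN : N ≠ ⊤) (n : ℕ) : chainConst N n ≠ ⊤ := by
  induction n with
  | zero => simp [chainConst]
  | succ n ih =>
    rw [chainConst]
    have h1 : chainConst N n + 1 ≠ ⊤ := ENNReal.add_ne_top.2 ⟨ih, by simp⟩
    have h2 : chainConst N n + 1 + N * (chainConst N n + 1) + 1 ≠ ⊤ :=
      ENNReal.add_ne_top.2 ⟨ENNReal.add_ne_top.2 ⟨h1, ENNReal.mul_ne_top hN h1⟩, by simp⟩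
    exact ENNReal.add_ne_top.2 ⟨h2, ENNReal.mul_ne_top hN h2⟩

theorem ae_le_iUnion_interior (h : IsRegularPolytope ρ U 𝒮) :
    (U : Set 𝔼) ≤ᵐ[volume] ⋃ S ∈ 𝒮, interior (convexHull ℝ (S : Set 𝔼)) := by
  have hnull : volume (⋃ S ∈ 𝒮, frontier (convexHull ℝ (S : Set 𝔼))) = 0 := by
    refine (measure_biUnion_null_iff 𝒮.countable_toSet).2 ?_
    exact fun S _ => (convex_convexHull ℝ (S : Set 𝔼)).addHaar_frontier volume
  have hae : ∀ᵐ x : 𝔼, x ∉ ⋃ S ∈ 𝒮, frontier (convexHull ℝ (S : Set 𝔼)) :=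
    measure_eq_zero_iff_ae_notMem.1 hnull
  filter_upwards [hae] with x hx hxU
  obtain ⟨S, hS, hxS⟩ := h.exists_mem (subset_closure hxU)
  refine mem_biUnion (t := fun S : Finset 𝔼 => interior (convexHull ℝ (S : Set 𝔼))) hS ?_
  by_contra hxi
  exact hx (mem_biUnion (t := fun S : Finset 𝔼 => frontier (convexHull ℝ (S : Set 𝔼))) hS
    ⟨subset_closure hxS, hxi⟩)

/-- Poincaré's inequality on a regular polytope. -/
theorem exists_const_eLpNorm_sub_le (h : IsRegularPolytope ρ U 𝒮) {w : 𝔼 → ℝ}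
    {G : Fin d → 𝔼 → ℝ} (hwG : HasWeakGrad U w G) (hw : IntegrableOn w U)
    (hG : ∀ i, IntegrableOn (G i) U) {p : ℝ≥0∞} (hp : 1 ≤ p) :
    ∃ c : ℝ, eLpNorm (fun x => w x - c) p (volume.restrict U) ≤
      chainConst (ENNReal.ofReal ((shrink d ρ ^ d)⁻¹)) 𝒮.card *
        (ENNReal.ofReal (2 ^ d * Metric.diam U) * ∑ i, eLpNorm (G i) p (volume.restrict U)) := by
  classical
  set N := ENNReal.ofReal ((shrink d ρ ^ d)⁻¹) with hN
  set M := ENNReal.ofReal (2 ^ d * Metric.diam U) * ∑ i, eLpNorm (G i) p (volume.restrict U)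
  have hη := shrink_pos d h.rho_pos
  have hN1 : 1 ≤ N := by
    rw [hN, ← ENNReal.ofReal_one]
    refine ENNReal.ofReal_le_ofReal ((one_le_inv₀ (by positivity)).2 ?_)
    exact pow_le_one₀ hη.le (min_le_left _ _)
  have hδ : 0 < radius ρ U / (2 * (d + 1)) := by have := h.radius_pos; positivity
  have convex_bound : ∀ A : Set 𝔼, IsOpen A → Convex ℝ A → A.Nonempty → A ⊆ U →
      ∃ c : ℝ, eLpNorm (fun x => w x - c) p (volume.restrict A) ≤ M := by
    intro A hA hAc hAn hAU
    obtain ⟨c, hc⟩ := (hwG.mono hAU).poincare_convex hA hAc (h.isBounded.subset hAU) hAn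
      (hw.mono_set hAU) (fun i => (hG i).mono_set hAU) hp
    refine ⟨c, hc.trans (mul_le_mul' (ENNReal.ofReal_le_ofReal ?_)
      (Finset.sum_le_sum fun i _ => eLpNorm_mono_measure _ (Measure.restrict_mono hAU le_rfl)))⟩
    exact mul_le_mul_of_nonneg_left (Metric.diam_mono hAU h.isBounded) (by positivity)
  have hmeas : ∀ A : Set 𝔼, A ⊆ U → AEStronglyMeasurable w (volume.restrict A) := fun A hA =>
    hw.aestronglyMeasurable.mono_measure (Measure.restrict_mono hA le_rfl)
  let I : Finset 𝔼 → Set 𝔼 := fun S => interior (convexHull ℝ (S : Set 𝔼))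
  have hIU : ∀ S ∈ 𝒮, I S ⊆ U := fun S hS => h.interior_convexHull_subset hS
  have hIo : ∀ S, IsOpen (I S) := fun S => isOpen_interior
  have hIc : ∀ S, Convex ℝ (I S) := fun S => (convex_convexHull ℝ _).interior
  have hIn : ∀ S ∈ 𝒮, (I S).Nonempty := fun S hS => by
    obtain ⟨c, hc⟩ := h.exists_ball_subset hS
    exact ⟨c, ball_subset_interior hc (Metric.mem_ball_self h.radius_pos)⟩
  have hcard : 1 ≤ 𝒮.card := by
    obtain ⟨x, hx⟩ := h.isConnected.nonempty
    obtain ⟨S, hS, -⟩ := h.exists_mem (subset_closure hx)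
    exact Finset.card_pos.2 ⟨S, hS⟩
  have claim : ∀ n : ℕ, n + 1 ≤ 𝒮.card → ∃ A ⊆ 𝒮, A.card = n + 1 ∧
      ∃ c : ℝ, eLpNorm (fun x => w x - c) p (volume.restrict (⋃ S ∈ A, I S)) ≤
        chainConst N n * M := by
    intro n
    induction n with
    | zero =>
      intro _
      obtain ⟨S, hS⟩ := Finset.card_pos.1 hcard
      refine ⟨{S}, by simpa using hS, by simp, ?_⟩
      simpa [chainConst] using convex_bound (I S) (hIo S) (hIc S) (hIn S hS) (hIU S hS)
    | succ n ih =>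
      intro hn
      obtain ⟨A, hA, hAcard, hAc⟩ := ih (by omega)
      have hss : A ⊂ 𝒮 := by
        refine Finset.ssubset_iff_subset_ne.2 ⟨hA, fun e => ?_⟩
        rw [e] at hAcard; omega
      obtain ⟨S, hSA, T, hT, hTA, x, hxU, hxS, hxT⟩ :=
        h.exists_neighbour hss (Finset.card_pos.1 (by omega))
      obtain ⟨b, hbS, hbT, hbU⟩ := h.exists_common_ball (hA hSA) hT hxU hxS hxT
      set B := Metric.ball b (radius ρ U / (2 * (d + 1)))
      set V := ⋃ S ∈ A, I S with hV
      have hVU : V ⊆ U := iUnion₂_subset fun S hS => hIU S (hA hS)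
      have hVo : IsOpen V := isOpen_biUnion fun S _ => hIo S
      have hSV : I S ⊆ V := subset_biUnion_of_mem (u := I) hSA
      have hBpos : volume B ≠ 0 := (Metric.measure_ball_pos volume _ hδ).ne'
      have hSB : volume B ≤ N * volume (I S ∩ B) := h.volume_ball_le_inter (hA hSA) hbS
      have hTB : volume B ≤ N * volume (I T ∩ B) := h.volume_ball_le_inter hT hbT
      have hTT : volume (I T) ≤ N * volume (I T ∩ B) := h.volume_interior_le hT hbT
      have pos : ∀ C : Set 𝔼, volume B ≤ N * volume C → volume C ≠ 0 := by
        intro C hC h0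
        rw [h0, mul_zero] at hC
        exact hBpos (le_antisymm hC zero_le)
      have hBc := convex_bound B Metric.isOpen_ball (convex_ball _ _)
        ⟨b, Metric.mem_ball_self hδ⟩ hbU
      have hTc := convex_bound (I T) (hIo T) (hIc T) (hIn T hT) (hIU T hT)
      have s1 : volume (I S ∩ B) ≤ volume (V ∩ B) := measure_mono (inter_subset_inter_left _ hSV)
      have step1 := exists_const_union hVo.measurableSet Metric.isOpen_ball.measurableSet
        (hmeas V hVU) (hmeas B hbU) hp
        (pos _ (hSB.trans (mul_le_mul_right s1 N))) hN1 (hSB.trans (mul_le_mul_right s1 N)) hAc hBc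
      have s2 : volume (I T ∩ B) ≤ volume ((V ∪ B) ∩ I T) :=
        measure_mono fun y hy => ⟨Or.inr hy.2, hy.1⟩
      have step2 := exists_const_union (hVo.union Metric.isOpen_ball).measurableSet
        (hIo T).measurableSet (hmeas _ (union_subset hVU hbU)) (hmeas _ (hIU T hT)) hp
        (pos _ (hTB.trans (mul_le_mul_right s2 N))) hN1 (hTT.trans (mul_le_mul_right s2 N))
        step1 hTc
      refine ⟨insert T A, Finset.insert_subset hT hA, by
        rw [Finset.card_insert_of_notMem hTA, hAcard], ?_⟩
      obtain ⟨c, hc⟩ := step2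
      refine ⟨c, (eLpNorm_mono_measure _ (Measure.restrict_mono ?_ le_rfl)).trans
        (hc.trans (le_of_eq ?_))⟩
      · rw [Finset.set_biUnion_insert, union_comm]
        exact union_subset_union_left _ subset_union_left
      · rw [chainConst]; ring
  obtain ⟨A, hA, hAcard, c, hc⟩ := claim (𝒮.card - 1) (by omega)
  have hAS : A = 𝒮 := Finset.eq_of_subset_of_card_le hA (by omega)
  subst hAS
  refine ⟨c, (eLpNorm_mono_measure _ (Measure.restrict_mono' h.ae_le_iUnion_interior le_rfl)).trans
    (hc.trans ?_)⟩
  exact mul_le_mul_left (chainConst_mono N (Nat.sub_le _ _)) _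

end IsRegularPolytope

/-- The average over a probability space is bounded on `L^p`. -/
theorem enorm_mul_rpow_le_eLpNorm {X : Type*} [MeasurableSpace X] {μ : Measure X}
    [IsFiniteMeasure μ] {f : X → ℝ} (hf : AEStronglyMeasurable f μ) {p : ℝ≥0∞} (hp : 1 ≤ p) (c : ℝ)
    (hc : c * μ.real univ = ∫ x, f x ∂μ) :
    eLpNorm (fun _ : X => c) p μ ≤ eLpNorm f p μ := by
  rcases eq_or_ne μ 0 with rfl | hμ
  · simp
  have hp0 : p ≠ 0 := (zero_lt_one.trans_le hp).ne'
  have hμ0 : μ univ ≠ 0 := by simpa using hμ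
  have hμt : μ univ ≠ ⊤ := measure_ne_top μ univ
  have h1 : ‖c‖ₑ * μ univ ≤ eLpNorm f 1 μ := by
    have : ‖c * μ.real univ‖ₑ ≤ ∫⁻ x, ‖f x‖ₑ ∂μ := by
      rw [hc]; exact enorm_integral_le_lintegral_enorm _
    rw [eLpNorm_one_eq_lintegral_enorm]
    refine le_trans (le_of_eq ?_) this
    rw [enorm_mul, Real.enorm_eq_ofReal (measureReal_nonneg), ofReal_measureReal]
  have h2 := eLpNorm_le_eLpNorm_mul_rpow_measure_univ (μ := μ) hp hf
  rw [eLpNorm_const _ hp0 hμ]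
  have h3 := h1.trans h2
  have e : μ univ ^ (1 / (1 : ℝ≥0∞).toReal - 1 / p.toReal) * μ univ ^ (1 / p.toReal) = μ univ := by
    rw [← ENNReal.rpow_add _ _ hμ0 hμt]; simp
  have hne0 : μ univ ^ (1 / (1 : ℝ≥0∞).toReal - 1 / p.toReal) ≠ 0 := by
    simp [ENNReal.rpow_eq_zero_iff, hμ0, hμt]
  have hnet : μ univ ^ (1 / (1 : ℝ≥0∞).toReal - 1 / p.toReal) ≠ ⊤ := by
    simp [ENNReal.rpow_eq_top_iff, hμ0, hμt]
  rw [← ENNReal.mul_le_mul_iff_left hne0 hnet, mul_assoc, mul_comm (μ univ ^ (1 / p.toReal)), e]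
  exact h3

/-- Poincaré's inequality on regular polytopes for functions with zero mean. -/
theorem exists_poincare_const (d : ℕ) (ρ : ℝ) :
    ∃ K : ℝ, 0 < K ∧ ∀ (U : Set (EuclideanSpace ℝ (Fin d)))
      (𝒮 : Finset (Finset (EuclideanSpace ℝ (Fin d)))), IsRegularPolytope ρ U 𝒮 →
      ∀ (w : EuclideanSpace ℝ (Fin d) → ℝ) (G : Fin d → EuclideanSpace ℝ (Fin d) → ℝ),
      HasWeakGrad U w G → IntegrableOn w U → (∀ i, IntegrableOn (G i) U) → ∫ x in U, w x = 0 →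
      ∀ p : ℝ≥0∞, 1 ≤ p → eLpNorm w p (volume.restrict U) ≤
        ENNReal.ofReal (K * Metric.diam U) * ∑ i, eLpNorm (G i) p (volume.restrict U) := by
  set n := ⌊(2 / ρ ^ 2) ^ d⌋₊ with hn
  set N := ENNReal.ofReal ((IsRegularPolytope.shrink d ρ ^ d)⁻¹)
  have hNt := IsRegularPolytope.chainConst_ne_top (N := N) ENNReal.ofReal_ne_top n
  refine ⟨2 * ((IsRegularPolytope.chainConst N n).toReal + 1) * 2 ^ d, by positivity, ?_⟩
  intro U 𝒮 h w G hwG hw hG hmean p hp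
  obtain ⟨c, hc⟩ := h.exists_const_eLpNorm_sub_le hwG hw hG hp
  have : IsFiniteMeasure (volume.restrict U) := ⟨by simpa using h.isBounded.measure_lt_top⟩
  have mw : AEStronglyMeasurable (fun x => w x - c) (volume.restrict U) :=
    hw.aestronglyMeasurable.sub aestronglyMeasurable_const
  have h1 : eLpNorm (fun _ : EuclideanSpace ℝ (Fin d) => -c) p (volume.restrict U) ≤
      eLpNorm (fun x => w x - c) p (volume.restrict U) := by
    refine enorm_mul_rpow_le_eLpNorm mw hp _ ?_
    rw [integral_sub hw (integrable_const _), hmean, integral_const, smul_eq_mul]; ring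
  have h2 : eLpNorm w p (volume.restrict U) ≤
      2 * eLpNorm (fun x => w x - c) p (volume.restrict U) := by
    have e : w = (fun x => w x - c) - fun _ => -c := by funext x; simp
    conv_lhs => rw [e]
    refine (eLpNorm_sub_le mw aestronglyMeasurable_const hp).trans ?_
    rw [two_mul]
    exact add_le_add le_rfl h1
  refine h2.trans ?_
  have hcard : 𝒮.card ≤ n := Nat.le_floor h.card_le
  have h3 : IsRegularPolytope.chainConst N 𝒮.card ≤
      ENNReal.ofReal ((IsRegularPolytope.chainConst N n).toReal + 1) := by
    refine (IsRegularPolytope.chainConst_mono N hcard).trans ?_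
    rw [← ENNReal.ofReal_toReal hNt]
    refine ENNReal.ofReal_le_ofReal ?_
    rw [ENNReal.ofReal_toReal hNt]; linarith
  calc 2 * eLpNorm (fun x => w x - c) p (volume.restrict U)
      ≤ 2 * (ENNReal.ofReal ((IsRegularPolytope.chainConst N n).toReal + 1) *
        (ENNReal.ofReal (2 ^ d * Metric.diam U) *
          ∑ i, eLpNorm (G i) p (volume.restrict U))) := by
        gcongr
        exact hc.trans (mul_le_mul_left h3 _)
    _ = _ := by
        rw [show (2 : ℝ≥0∞) * (ENNReal.ofReal ((IsRegularPolytope.chainConst N n).toReal + 1) *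
          (ENNReal.ofReal (2 ^ d * Metric.diam U) * ∑ i, eLpNorm (G i) p (volume.restrict U))) =
          ENNReal.ofReal 2 * (ENNReal.ofReal ((IsRegularPolytope.chainConst N n).toReal + 1) *
          (ENNReal.ofReal (2 ^ d * Metric.diam U) *
            ∑ i, eLpNorm (G i) p (volume.restrict U))) by rw [ENNReal.ofReal_ofNat], ← mul_assoc, ← mul_assoc,
          ← ENNReal.ofReal_mul (by norm_num), ← ENNReal.ofReal_mul (by positivity)]
        congr 2; ring

/-- The union of the hyperplanar faces of `U`. -/
def faceSet (U : Set 𝔼) : Set 𝔼 := {x | ∃ ν, IsHalfSpaceNear U ν x}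

theorem sUnion_hyperplanarFaces (U : Set 𝔼) : ⋃₀ hyperplanarFaces U = faceSet U := by
  ext x
  constructor
  · rintro ⟨F, ⟨-, ν, c, rfl⟩, hx⟩
    exact ⟨ν, hx.2⟩
  · rintro ⟨ν, hν⟩
    exact ⟨{y | inner ℝ ν y = inner ℝ ν x ∧ IsHalfSpaceNear U ν y}, ⟨⟨x, rfl, hν⟩, ν, _, rfl⟩, rfl, hν⟩

theorem IsHalfSpaceNear.notMem {U : Set 𝔼} {ν x : 𝔼} (h : IsHalfSpaceNear U ν x) : x ∉ U := by
  obtain ⟨-, ε, hε, hb⟩ := h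
  rw [hb x (Metric.mem_ball_self hε)]
  simp

theorem exists_small_smul {x z : 𝔼} {ε : ℝ} (hε : 0 < ε) : ∃ t : ℝ, 0 < t ∧ x + t • z ∈ Metric.ball x ε := by
  refine ⟨ε / (2 * (‖z‖ + 1)), by positivity, ?_⟩
  rw [Metric.mem_ball, dist_eq_norm, add_sub_cancel_left, norm_smul, Real.norm_eq_abs,
    abs_of_pos (by positivity), div_mul_eq_mul_div, div_lt_iff₀ (by positivity)]
  nlinarith [norm_nonneg z]

theorem IsHalfSpaceNear.unique {U : Set 𝔼} {ν ν' x : 𝔼} (h : IsHalfSpaceNear U ν x)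
    (h' : IsHalfSpaceNear U ν' x) : ν = ν' := by
  obtain ⟨h1, ε, hε, hb⟩ := h
  obtain ⟨h1', ε', hε', hb'⟩ := h'
  by_contra hne
  have hlt : inner ℝ ν ν' < 1 := (inner_lt_one_iff_real_of_norm_eq_one h1 h1').2 hne
  obtain ⟨t, ht, hx⟩ := exists_small_smul (x := x) (z := ν' - ν) (lt_min hε hε')
  have e1 := hb _ (Metric.ball_subset_ball (min_le_left _ _) hx)
  have e2 := hb' _ (Metric.ball_subset_ball (min_le_right _ _) hx)
  rw [e2] at e1
  rw [add_sub_cancel_left, inner_smul_right, inner_smul_right, inner_sub_right, inner_sub_right,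
    real_inner_self_eq_norm_sq, real_inner_self_eq_norm_sq, h1, h1', real_inner_comm ν ν'] at e1
  have a1 : ¬ t * (1 ^ 2 - inner ℝ ν ν') < 0 := by
    rw [not_lt]; exact mul_nonneg ht.le (by linarith)
  exact a1 (e1.2 (mul_neg_of_pos_of_neg ht (by linarith)))

theorem IsHalfSpaceNear.outwardNormal_eq {U : Set 𝔼} {ν x : 𝔼} (h : IsHalfSpaceNear U ν x) :
    outwardNormal U x = ν := by
  have hex : ∃ ν, IsHalfSpaceNear U ν x := ⟨ν, h⟩
  rw [outwardNormal, dif_pos hex]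
  exact hex.choose_spec.unique h

theorem IsHalfSpaceNear.of_mem_ball {U : Set 𝔼} {ν x : 𝔼} {ε : ℝ} (hν : ‖ν‖ = 1)
    (hb : ∀ y ∈ Metric.ball x ε, (y ∈ U ↔ inner ℝ ν (y - x) < 0)) {y : 𝔼}
    (hy : y ∈ Metric.ball x ε) (h0 : inner ℝ ν (y - x) = 0) : IsHalfSpaceNear U ν y := by
  obtain ⟨δ, hδ, hsub⟩ := Metric.isOpen_iff.1 Metric.isOpen_ball y hy
  refine ⟨hν, δ, hδ, fun u hu => ?_⟩
  rw [hb u (hsub hu)]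
  have : u - x = (u - y) + (y - x) := by abel
  rw [this, inner_add_right, h0, add_zero]

theorem mem_faceSet_iff_of_mem_ball {U : Set 𝔼} {ν x : 𝔼} {ε : ℝ} (hν : ‖ν‖ = 1)
    (hb : ∀ y ∈ Metric.ball x ε, (y ∈ U ↔ inner ℝ ν (y - x) < 0)) {y : 𝔼}
    (hy : y ∈ Metric.ball x ε) : y ∈ faceSet U ↔ inner ℝ ν (y - x) = 0 := by
  refine ⟨fun ⟨ν', h'⟩ => ?_, fun h0 => ⟨ν, IsHalfSpaceNear.of_mem_ball hν hb hy h0⟩⟩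
  rcases lt_trichotomy (inner ℝ ν (y - x)) 0 with hlt | h0 | hgt
  · exact absurd ((hb y hy).2 hlt) h'.notMem
  · exact h0
  · exfalso
    obtain ⟨hν', ε', hε', hb'⟩ := h'
    let V : Set 𝔼 := Metric.ball x ε ∩ Metric.ball y ε' ∩ {u | 0 < inner ℝ ν (u - x)}
    have hV : IsOpen V := by
      refine (Metric.isOpen_ball.inter Metric.isOpen_ball).inter ?_
      exact isOpen_lt continuous_const (by fun_prop)
    have hyV : y ∈ V := ⟨⟨hy, Metric.mem_ball_self hε'⟩, hgt⟩
    obtain ⟨δ, hδ, hsub⟩ := Metric.isOpen_iff.1 hV y hyV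
    obtain ⟨t, ht, hu⟩ := exists_small_smul (x := y) (z := -ν') hδ
    obtain ⟨⟨h1, h2⟩, h3⟩ := hsub hu
    have h4 := (hb' _ h2).2 (by
      rw [add_sub_cancel_left, smul_neg, inner_neg_right, inner_smul_right,
        real_inner_self_eq_norm_sq, hν']
      linarith)
    have h5 := (hb _ h1).1 h4
    have h3' : 0 < inner ℝ ν (y + t • -ν' - x) := h3
    linarith

theorem faceSet_eq_inter (U : Set 𝔼) : ∃ V : Set 𝔼, IsOpen V ∧ faceSet U = V ∩ frontier U := by
  choose! ν hν using fun (x : 𝔼) (hx : x ∈ faceSet U) => hx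
  choose! ε hε hb using fun (x : 𝔼) (hx : x ∈ faceSet U) => (hν x hx).2
  refine ⟨⋃ x ∈ faceSet U, Metric.ball x (ε x), isOpen_biUnion fun x _ => Metric.isOpen_ball, ?_⟩
  ext y
  constructor
  · intro hy
    refine ⟨mem_biUnion hy (Metric.mem_ball_self (hε y hy)), ?_, ?_⟩
    · rw [Metric.mem_closure_iff]
      intro δ hδ
      obtain ⟨t, ht, hu⟩ := exists_small_smul (x := y) (z := - ν y) (lt_min hδ (hε y hy))
      refine ⟨_, (hb y hy _ (Metric.ball_subset_ball (min_le_right _ _) hu)).2 ?_, ?_⟩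
      · rw [add_sub_cancel_left, smul_neg, inner_neg_right, inner_smul_right,
          real_inner_self_eq_norm_sq, (hν y hy).1]
        linarith
      · rw [dist_comm]; exact Metric.ball_subset_ball (min_le_left _ _) hu
    · exact fun hi => (hν y hy).notMem (interior_subset hi)
  · rintro ⟨hy, hyc, hyi⟩
    obtain ⟨x, hx, hyx⟩ := mem_iUnion₂.1 hy
    rw [mem_faceSet_iff_of_mem_ball (hν x hx).1 (hb x hx) hyx]
    have cont : Continuous fun u : 𝔼 => inner ℝ (ν x) (u - x) := by fun_prop
    rcases lt_trichotomy (inner ℝ (ν x) (y - x)) 0 with hlt | h0 | hgt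
    · exfalso
      refine hyi (mem_interior.2 ⟨Metric.ball x (ε x) ∩ {u | inner ℝ (ν x) (u - x) < 0}, ?_,
        Metric.isOpen_ball.inter (isOpen_lt cont continuous_const), hyx, hlt⟩)
      rintro u ⟨hu1, hu2⟩
      exact (hb x hx u hu1).2 hu2
    · exact h0
    · exfalso
      obtain ⟨u, ⟨hu1, hu2⟩, huU⟩ := mem_closure_iff.1 hyc
        (Metric.ball x (ε x) ∩ {u | 0 < inner ℝ (ν x) (u - x)})
        (Metric.isOpen_ball.inter (isOpen_lt continuous_const cont)) ⟨hyx, hgt⟩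
      have := (hb x hx u hu1).1 huU
      have hu2' : 0 < inner ℝ (ν x) (u - x) := hu2
      linarith

theorem faceSet_subset_frontier (U : Set 𝔼) : faceSet U ⊆ frontier U := by
  obtain ⟨V, -, h⟩ := faceSet_eq_inter U
  rw [h]; exact inter_subset_right

theorem isOpen_compl_frontier_diff_faceSet (U : Set 𝔼) : IsOpen (frontier U \ faceSet U)ᶜ := by
  obtain ⟨V, hV, h⟩ := faceSet_eq_inter U
  have : frontier U \ faceSet U = frontier U \ V := by
    rw [h]; ext x; simp only [mem_sdiff, mem_inter_iff]; tauto
  rw [this]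
  exact (isClosed_frontier.sdiff hV).isOpen_compl

theorem measurableSet_faceSet (U : Set 𝔼) : MeasurableSet (faceSet U) := by
  obtain ⟨V, hV, h⟩ := faceSet_eq_inter U
  rw [h]
  exact hV.measurableSet.inter isClosed_frontier.measurableSet

/-- The hyperplane through `a` with normal `ν`. -/
def hyperplane (ν a : 𝔼) : Set 𝔼 := {x | inner ℝ ν (x - a) = 0}

theorem measurableSet_hyperplane (ν a : 𝔼) : MeasurableSet (hyperplane ν a) :=
  (isClosed_eq (by fun_prop) continuous_const).measurableSet

/-- The surface measure of a hyperplane. -/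
def hyperplaneMeasure (ν a : 𝔼) : Measure 𝔼 :=
  (Measure.euclideanHausdorffMeasure (d - 1)).restrict (hyperplane ν a)

theorem hyperplaneMeasure_eq_map {ν : 𝔼} (hν : ‖ν‖ = 1) (a : 𝔼) :
    hyperplaneMeasure ν a =
      (volume : Measure (Submodule.span ℝ {ν})ᗮ).map (fun y : (Submodule.span ℝ {ν})ᗮ => a + (y : 𝔼)) := by
  have hν0 : ν ≠ 0 := by rintro rfl; simp at hν
  have hrank : Module.finrank ℝ (Submodule.span ℝ {ν})ᗮ = d - 1 := by
    have h1 := (Submodule.span ℝ {ν}).finrank_add_finrank_orthogonal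
    rw [finrank_span_singleton hν0, finrank_euclideanSpace_fin] at h1
    omega
  have hiso : Isometry (fun y : (Submodule.span ℝ {ν})ᗮ => a + (y : 𝔼)) :=
    (IsometryEquiv.addLeft a).isometry.comp isometry_subtype_coe
  have hr : range (fun y : (Submodule.span ℝ {ν})ᗮ => a + (y : 𝔼)) = hyperplane ν a := by
    ext x
    simp only [mem_range, hyperplane, mem_ofPred_eq]
    constructor
    · rintro ⟨y, rfl⟩
      rw [add_sub_cancel_left]
      exact Submodule.mem_orthogonal_singleton_iff_inner_right.1 y.2
    · intro hx
      exact ⟨⟨x - a, Submodule.mem_orthogonal_singleton_iff_inner_right.2 hx⟩, by simp⟩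
  have hvol : (volume : Measure (Submodule.span ℝ {ν})ᗮ) =
      Measure.euclideanHausdorffMeasure (d - 1) := by
    rw [← InnerProductSpace.euclideanHausdorffMeasure_eq_volume, hrank]
  rw [hvol, hiso.map_euclideanHausdorffMeasure, hr, hyperplaneMeasure]

theorem sFinite_hyperplaneMeasure {ν : 𝔼} (hν : ‖ν‖ = 1) (a : 𝔼) :
    SFinite (hyperplaneMeasure ν a) := by
  rw [hyperplaneMeasure_eq_map hν]; infer_instance

/-- Integration over the space by slicing along a hyperplane and a transversal direction. -/
theorem lintegral_hyperplaneMeasure {ν : 𝔼} (hν : ‖ν‖ = 1) (a e : 𝔼) (he : inner ℝ ν e ≠ 0)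
    {f : 𝔼 → ℝ≥0∞} (hf : Measurable f) :
    ∫⁻ x, (∫⁻ t : ℝ, f (x + t • e)) ∂(hyperplaneMeasure ν a) =
      ENNReal.ofReal |(inner ℝ ν e)⁻¹| * ∫⁻ x, f x := by
  set c : ℝ := inner ℝ ν e
  set W := Submodule.span ℝ {ν}
  let e' : Wᗮ := ⟨e - c • ν, Submodule.mem_orthogonal_singleton_iff_inner_right.2 (by
    rw [inner_sub_right, inner_smul_right, real_inner_self_eq_norm_sq, hν]; simp [c])⟩
  have hFm : Measurable fun q : 𝔼 × ℝ => f (q.1 + q.2 • e) :=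
    hf.comp (Continuous.measurable (by fun_prop))
  have hmι : Measurable (fun y : Wᗮ => a + (y : 𝔼)) := by fun_prop
  rw [hyperplaneMeasure_eq_map hν, lintegral_map (Measurable.lintegral_prod_right' hFm) hmι]
  have m1 : Measurable fun q : Wᗮ × ℝ => f (a + (q.1 : 𝔼) + q.2 • e) :=
    hf.comp (Continuous.measurable (by fun_prop))
  rw [lintegral_lintegral_swap (f := fun (y : Wᗮ) (t : ℝ) => f (a + (y : 𝔼) + t • e)) m1.aemeasurable]
  have h1 : ∀ t : ℝ, ∫⁻ y : Wᗮ, f (a + (y : 𝔼) + t • e) =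
      ∫⁻ y : Wᗮ, f (a + (y : 𝔼) + (c * t) • ν) := by
    intro t
    rw [← lintegral_add_right_eq_self (fun y : Wᗮ => f (a + (y : 𝔼) + (c * t) • ν)) (t • e')]
    refine lintegral_congr fun y => ?_
    congr 1
    simp only [e', Submodule.coe_add, Submodule.coe_smul]
    module
  simp only [h1]
  have m2 : Measurable fun t : ℝ => ∫⁻ y : Wᗮ, f (a + (y : 𝔼) + t • ν) :=
    Measurable.lintegral_prod_left' (f := fun q : Wᗮ × ℝ => f (a + (q.1 : 𝔼) + q.2 • ν))
      (hf.comp (Continuous.measurable (by fun_prop)))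
  have h2 : ∫⁻ t : ℝ, ∫⁻ y : Wᗮ, f (a + (y : 𝔼) + (c * t) • ν) =
      ENNReal.ofReal |c⁻¹| * ∫⁻ t : ℝ, ∫⁻ y : Wᗮ, f (a + (y : 𝔼) + t • ν) := by
    rw [← lintegral_map (f := fun t : ℝ => ∫⁻ y : Wᗮ, f (a + (y : 𝔼) + t • ν)) m2
      (measurable_const_mul c), Real.map_volume_mul_left he, lintegral_smul_measure, smul_eq_mul]
  rw [h2]
  congr 1
  have hmp := W.measurePreserving_measurableEquivProd a
  have hvol : (Measure.euclideanHausdorffMeasure (Module.finrank ℝ 𝔼) : Measure 𝔼) = volume :=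
    InnerProductSpace.euclideanHausdorffMeasure_eq_volume
  rw [hvol] at hmp
  rw [← hmp.symm.lintegral_comp_emb (MeasurableEquiv.measurableEmbedding _)]
  rw [Measure.volume_eq_prod, lintegral_prod (fun q => f ((W.measurableEquivProd a).symm q))
    (hf.comp (MeasurableEquiv.measurable _)).aemeasurable]
  have hu := (LinearIsometryEquiv.toSpanUnitSingleton ν hν).measurePreserving
  rw [← hu.lintegral_comp_emb
    (LinearIsometryEquiv.toSpanUnitSingleton ν hν).toHomeomorph.measurableEmbedding]
  refine lintegral_congr fun t => lintegral_congr fun y => ?_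
  congr 1
  rw [Submodule.measurableEquivProd_symm_apply]
  simp only [LinearIsometryEquiv.toSpanUnitSingleton_apply, vadd_eq_add]
  abel

theorem map_hyperplaneMeasure_prod {ν : 𝔼} (hν : ‖ν‖ = 1) (a e : 𝔼) (he : inner ℝ ν e ≠ 0) :
    ((hyperplaneMeasure ν a).prod (volume : Measure ℝ)).map (fun q : 𝔼 × ℝ => q.1 + q.2 • e) =
      ENNReal.ofReal |(inner ℝ ν e)⁻¹| • volume := by
  have := sFinite_hyperplaneMeasure hν a
  have hm : Measurable (fun q : 𝔼 × ℝ => q.1 + q.2 • e) := Continuous.measurable (by fun_prop)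
  refine Measure.ext fun B hB => ?_
  rw [← lintegral_indicator_one hB, lintegral_map (measurable_one.indicator hB) hm,
    lintegral_prod (fun q : 𝔼 × ℝ => B.indicator (1 : 𝔼 → ℝ≥0∞) (q.1 + q.2 • e))
      ((measurable_one.indicator hB).comp hm).aemeasurable,
    lintegral_hyperplaneMeasure hν a e he (measurable_one.indicator hB),
    lintegral_indicator_one hB, Measure.smul_apply, smul_eq_mul]

theorem Integrable.comp_hyperplane {ν : 𝔼} (hν : ‖ν‖ = 1) (a e : 𝔼) (he : inner ℝ ν e ≠ 0)
    {f : 𝔼 → ℝ} (hf : Integrable f) :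
    Integrable (fun q : 𝔼 × ℝ => f (q.1 + q.2 • e))
      ((hyperplaneMeasure ν a).prod (volume : Measure ℝ)) := by
  have hm : Measurable (fun q : 𝔼 × ℝ => q.1 + q.2 • e) := Continuous.measurable (by fun_prop)
  have h1 : Integrable f
      (((hyperplaneMeasure ν a).prod (volume : Measure ℝ)).map (fun q : 𝔼 × ℝ => q.1 + q.2 • e)) := by
    rw [map_hyperplaneMeasure_prod hν a e he]
    exact hf.smul_measure ENNReal.ofReal_ne_top
  exact h1.comp_measurable hm

theorem integral_hyperplaneMeasure {ν : 𝔼} (hν : ‖ν‖ = 1) (a e : 𝔼) (he : inner ℝ ν e ≠ 0)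
    {f : 𝔼 → ℝ} (hf : Integrable f) :
    ∫ x, (∫ t : ℝ, f (x + t • e)) ∂(hyperplaneMeasure ν a) = |(inner ℝ ν e)⁻¹| * ∫ x, f x := by
  have := sFinite_hyperplaneMeasure hν a
  have hm : Measurable (fun q : 𝔼 × ℝ => q.1 + q.2 • e) := Continuous.measurable (by fun_prop)
  have h1 : AEStronglyMeasurable f
      (((hyperplaneMeasure ν a).prod (volume : Measure ℝ)).map (fun q : 𝔼 × ℝ => q.1 + q.2 • e)) := by
    rw [map_hyperplaneMeasure_prod hν a e he]
    exact hf.aestronglyMeasurable.mono_ac Measure.smul_absolutelyContinuous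
  rw [← integral_prod _ (Integrable.comp_hyperplane hν a e he hf), ← integral_map hm.aemeasurable h1,
    map_hyperplaneMeasure_prod hν a e he, integral_smul_measure, smul_eq_mul,
    ENNReal.toReal_ofReal (abs_nonneg _)]

/-- The faces are covered by countably many disjoint measurable pieces of hyperplanes. -/
theorem exists_faceSet_decomposition (U : Set 𝔼) (hne : (faceSet U).Nonempty) :
    ∃ (P : ℕ → Set 𝔼) (ν a : ℕ → 𝔼), Pairwise (Function.onFun Disjoint P) ∧
      (∀ k, MeasurableSet (P k)) ∧ (⋃ k, P k) = faceSet U ∧ (∀ k, ‖ν k‖ = 1) ∧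
      ∀ k, ∀ x ∈ P k, x ∈ hyperplane (ν k) (a k) ∧ IsHalfSpaceNear U (ν k) x := by
  choose! ν hν using fun (x : 𝔼) (hx : x ∈ faceSet U) => hx
  choose! ε hε hb using fun (x : 𝔼) (hx : x ∈ faceSet U) => (hν x hx).2
  obtain ⟨T, hTs, hTc, hT⟩ := TopologicalSpace.countable_cover_nhdsWithin
    (f := fun x => Metric.ball x (ε x)) (s := faceSet U)
    (fun x hx => mem_nhdsWithin_of_mem_nhds (Metric.ball_mem_nhds x (hε x hx)))
  have hTne : T.Nonempty := by
    rw [nonempty_iff_ne_empty]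
    rintro rfl
    obtain ⟨x, hx⟩ := hne
    simpa using hT hx
  obtain ⟨g, rfl⟩ := hTc.exists_eq_range hTne
  have hg : ∀ k, g k ∈ faceSet U := fun k => hTs ⟨k, rfl⟩
  let B : ℕ → Set 𝔼 := fun k => Metric.ball (g k) (ε (g k))
  refine ⟨fun k => faceSet U ∩ disjointed B k, fun k => ν (g k), g, ?_, ?_, ?_, ?_, ?_⟩
  · intro i j hij
    exact (disjoint_disjointed B hij).mono inter_subset_right inter_subset_right
  · intro k
    exact (measurableSet_faceSet U).inter
      (MeasurableSet.disjointed (fun j => Metric.isOpen_ball.measurableSet) k)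
  · rw [← inter_iUnion, iUnion_disjointed]
    refine inter_eq_left.2 (hT.trans ?_)
    rw [biUnion_range]
  · exact fun k => (hν _ (hg k)).1
  · rintro k x ⟨hx, hxB⟩
    have hxB' : x ∈ B k := disjointed_subset B k hxB
    have h0 := (mem_faceSet_iff_of_mem_ball (hν _ (hg k)).1 (hb _ (hg k)) hxB').1 hx
    exact ⟨h0, IsHalfSpaceNear.of_mem_ball (hν _ (hg k)).1 (hb _ (hg k)) hxB' h0⟩

theorem faceMeasure_eq (U : Set 𝔼) : faceMeasure U =
    (Measure.euclideanHausdorffMeasure (d - 1)).restrict (faceSet U) := by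
  rw [faceMeasure, sUnion_hyperplanarFaces]

instance sFinite_faceMeasure (U : Set 𝔼) : SFinite (faceMeasure U) := by
  rw [faceMeasure_eq]
  rcases (faceSet U).eq_empty_or_nonempty with h | h
  · rw [h, Measure.restrict_empty]; infer_instance
  obtain ⟨P, ν, a, hd, hm, hP, hν, hx⟩ := exists_faceSet_decomposition U h
  rw [← hP, Measure.restrict_iUnion hd hm]
  have : ∀ k, SFinite ((Measure.euclideanHausdorffMeasure (d - 1) : Measure 𝔼).restrict (P k)) := by
    intro k
    have hsub : P k ⊆ hyperplane (ν k) (a k) := fun x hxk => (hx k x hxk).1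
    rw [← Measure.restrict_restrict_of_subset hsub]
    have := sFinite_hyperplaneMeasure (hν k) (a k)
    unfold hyperplaneMeasure at this
    infer_instance
  infer_instance

/-- The points of the faces from which the segment in the direction `e` enters `U` with an angle
bounded from below. -/
def enteringSet (U : Set 𝔼) (β : ℝ) (e : 𝔼) : Set 𝔼 :=
  {x | ∃ ν, IsHalfSpaceNear U ν x ∧ inner ℝ ν e ≤ -β ∧ ∀ t ∈ Ioc (0 : ℝ) 1, x + t • e ∈ U}

theorem enteringSet_subset (U : Set 𝔼) (β : ℝ) (e : 𝔼) : enteringSet U β e ⊆ faceSet U :=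
  fun _ ⟨ν, hν, _⟩ => ⟨ν, hν⟩

/-- Local description of the faces around a point of an entering set. -/
theorem exists_ball_enteringSet {U : Set 𝔼} (hU : IsOpen U) {β : ℝ} (hβ : 0 < β) {e x : 𝔼}
    (hx : x ∈ enteringSet U β e) :
    ∃ ν, IsHalfSpaceNear U ν x ∧ inner ℝ ν e ≤ -β ∧ ∃ ε > 0,
      (∀ y ∈ Metric.ball x ε, (y ∈ U ↔ inner ℝ ν (y - x) < 0)) ∧
      ∀ y ∈ Metric.ball x ε, inner ℝ ν (y - x) = 0 → ∀ t ∈ Ioc (0 : ℝ) 1, y + t • e ∈ U := by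
  obtain ⟨ν, hν, hβe, hseg⟩ := hx
  obtain ⟨ε₀, hε₀, hb⟩ := hν.2
  set t₀ : ℝ := min 1 (ε₀ / (2 * (‖e‖ + 1))) with ht₀
  have ht₀pos : 0 < t₀ := lt_min one_pos (by positivity)
  let K : Set 𝔼 := (fun t : ℝ => x + t • e) '' Icc t₀ 1
  have hK : IsCompact K := isCompact_Icc.image (by fun_prop)
  have hKU : K ⊆ U := by
    rintro _ ⟨t, ht, rfl⟩
    exact hseg t ⟨ht₀pos.trans_le ht.1, ht.2⟩
  obtain ⟨δ, hδ, hδU⟩ := hK.exists_thickening_subset_open hU hKU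
  refine ⟨ν, hν, hβe, min δ (ε₀ / 2), lt_min hδ (by positivity), fun y hy => hb y ?_, ?_⟩
  · exact Metric.ball_subset_ball ((min_le_right _ _).trans (by linarith)) hy
  · intro y hy h0 t ht
    rcases le_total t t₀ with h | h
    · have hyb : y + t • e ∈ Metric.ball x ε₀ := by
        rw [Metric.mem_ball, dist_eq_norm]
        have h1 : ‖y - x‖ < ε₀ / 2 := by
          rw [← dist_eq_norm]; exact (Metric.mem_ball.1 hy).trans_le (min_le_right _ _)
        have h2 : ‖t • e‖ ≤ ε₀ / 2 := by
          rw [norm_smul, Real.norm_eq_abs, abs_of_pos ht.1]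
          have h3 : t ≤ ε₀ / (2 * (‖e‖ + 1)) := h.trans (min_le_right _ _)
          calc t * ‖e‖ ≤ ε₀ / (2 * (‖e‖ + 1)) * (‖e‖ + 1) := by gcongr; linarith
            _ = ε₀ / 2 := by field_simp
        calc ‖y + t • e - x‖ = ‖(y - x) + t • e‖ := by congr 1; abel
          _ ≤ ‖y - x‖ + ‖t • e‖ := norm_add_le _ _
          _ < ε₀ := by linarith
      rw [hb _ hyb]
      have : y + t • e - x = (y - x) + t • e := by abel
      rw [this, inner_add_right, h0, inner_smul_right, zero_add]
      exact mul_neg_of_pos_of_neg ht.1 (by linarith)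
    · refine hδU (Metric.mem_thickening_iff.2 ⟨x + t • e, ⟨t, ⟨h, ht.2⟩, rfl⟩, ?_⟩)
      rw [dist_add_right]
      exact (Metric.mem_ball.1 hy).trans_le (min_le_left _ _)

theorem measurableSet_enteringSet {U : Set 𝔼} (hU : IsOpen U) {β : ℝ} (hβ : 0 < β) (e : 𝔼) :
    MeasurableSet (enteringSet U β e) := by
  choose! ν hν hβe ε hε hb hseg using fun (x : 𝔼) (hx : x ∈ enteringSet U β e) =>
    exists_ball_enteringSet hU hβ hx
  have : enteringSet U β e = faceSet U ∩ ⋃ x ∈ enteringSet U β e, Metric.ball x (ε x) := by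
    refine Subset.antisymm (fun x hx => ⟨enteringSet_subset U β e hx,
      mem_biUnion hx (Metric.mem_ball_self (hε x hx))⟩) ?_
    rintro y ⟨hy, hyB⟩
    obtain ⟨x, hx, hyx⟩ := mem_iUnion₂.1 hyB
    have h0 := (mem_faceSet_iff_of_mem_ball (hν x hx).1 (hb x hx) hyx).1 hy
    exact ⟨ν x, IsHalfSpaceNear.of_mem_ball (hν x hx).1 (hb x hx) hyx h0, hβe x hx,
      hseg x hx y hyx h0⟩
  rw [this]
  exact (measurableSet_faceSet U).inter
    (isOpen_biUnion fun x _ => Metric.isOpen_ball).measurableSet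

theorem enteringSet_injOn {U : Set 𝔼} {β : ℝ} {e : 𝔼} :
    InjOn (fun q : 𝔼 × ℝ => q.1 + q.2 • e) (enteringSet U β e ×ˢ Ioc (0 : ℝ) 1) := by
  have key : ∀ x ∈ enteringSet U β e, ∀ x' ∈ enteringSet U β e, ∀ t ∈ Ioc (0 : ℝ) 1,
      ∀ t' ∈ Ioc (0 : ℝ) 1, x + t • e = x' + t' • e → ¬ t < t' := by
    rintro x ⟨ν, hν, -⟩ x' ⟨-, -, -, hseg⟩ t ht t' ht' h hlt
    refine hν.notMem ?_
    have : x = x' + (t' - t) • e := by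
      rw [sub_smul, ← add_sub_assoc, ← h, add_sub_cancel_right]
    rw [this]
    exact hseg _ ⟨by linarith, by linarith [ht.1, ht'.2]⟩
  rintro ⟨x, t⟩ ⟨hx, ht⟩ ⟨x', t'⟩ ⟨hx', ht'⟩ h
  simp only at hx ht hx' ht' h
  have htt : t = t' := le_antisymm (not_lt.1 (key x' hx' x hx t' ht' t ht h.symm))
    (not_lt.1 (key x hx x' hx' t ht t' ht' h))
  subst htt
  rw [add_left_inj] at h
  rw [h]

/-- Translating the entering set along its direction does not concentrate mass. -/
theorem map_enteringSet_le {U : Set 𝔼} (hU : IsOpen U) {β : ℝ} (hβ : 0 < β) (e : 𝔼) :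
    (((faceMeasure U).restrict (enteringSet U β e)).prod (volume.restrict (Ioc (0 : ℝ) 1))).map
      (fun q : 𝔼 × ℝ => q.1 + q.2 • e) ≤ ENNReal.ofReal β⁻¹ • volume.restrict U := by
  rcases (faceSet U).eq_empty_or_nonempty with h | h
  · rw [faceMeasure_eq, h]; simp [Measure.zero_le]
  obtain ⟨P, ν, a, hd, hm, hP, hν, hx⟩ := exists_faceSet_decomposition U h
  set O := enteringSet U β e with hO
  have hOm : MeasurableSet O := measurableSet_enteringSet hU hβ e
  have hΨ : Measurable (fun q : 𝔼 × ℝ => q.1 + q.2 • e) := Continuous.measurable (by fun_prop)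
  let Q : ℕ → Set 𝔼 := fun k => (fun q : 𝔼 × ℝ => q.1 + q.2 • e) '' ((O ∩ P k) ×ˢ Ioc (0 : ℝ) 1)
  have hQm : ∀ k, MeasurableSet (Q k) := fun k =>
    ((hOm.inter (hm k)).prod measurableSet_Ioc).image_of_measurable_injOn hΨ
      (enteringSet_injOn.mono (prod_mono inter_subset_left le_rfl))
  have hQU : ∀ k, Q k ⊆ U := by
    rintro k _ ⟨⟨x, t⟩, ⟨⟨⟨-, -, -, hseg⟩, -⟩, ht⟩, rfl⟩
    exact hseg t ht
  have hQd : Pairwise (Function.onFun Disjoint Q) := by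
    intro i j hij
    rw [Function.onFun, Set.disjoint_left]
    rintro _ ⟨⟨x, t⟩, ⟨⟨hx1, hx2⟩, ht⟩, rfl⟩ ⟨⟨x', t'⟩, ⟨⟨hx1', hx2'⟩, ht'⟩, heq⟩
    have := enteringSet_injOn ⟨hx1', ht'⟩ ⟨hx1, ht⟩ heq
    simp only [Prod.mk.injEq] at this
    rw [this.1] at hx2'
    exact Set.disjoint_left.1 (hd hij) hx2 hx2'
  refine Measure.le_iff.2 fun A hA => ?_
  have hr : (faceMeasure U).restrict O =
      Measure.sum fun k => (Measure.euclideanHausdorffMeasure (d - 1)).restrict (O ∩ P k) := by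
    rw [faceMeasure_eq, Measure.restrict_restrict hOm, ← hP, inter_iUnion,
      Measure.restrict_iUnion (fun i j hij => (hd hij).mono inter_subset_right inter_subset_right)
        (fun k => hOm.inter (hm k))]
  rw [Measure.map_apply hΨ hA, Measure.prod_apply (hΨ hA), hr, lintegral_sum_measure,
    Measure.smul_apply, smul_eq_mul, Measure.restrict_apply hA]
  have hk : ∀ k, ∫⁻ x, (volume.restrict (Ioc (0 : ℝ) 1))
      (Prod.mk x ⁻¹' ((fun q : 𝔼 × ℝ => q.1 + q.2 • e) ⁻¹' A))
        ∂((Measure.euclideanHausdorffMeasure (d - 1)).restrict (O ∩ P k)) ≤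
      ENNReal.ofReal β⁻¹ * volume (A ∩ Q k) := by
    intro k
    rcases (O ∩ P k).eq_empty_or_nonempty with hempty | ⟨x₀, hx₀O, hx₀P⟩
    · rw [hempty]; simp
    have hang : inner ℝ (ν k) e ≤ -β := by
      obtain ⟨ν', hν', hβ', -⟩ := hx₀O
      rwa [hν'.unique (hx k x₀ hx₀P).2] at hβ'
    have hang0 : inner ℝ (ν k) e ≠ 0 := by linarith
    have hAQ : MeasurableSet (A ∩ Q k) := hA.inter (hQm k)
    have hsub : O ∩ P k ⊆ hyperplane (ν k) (a k) := fun x hxk => (hx k x hxk.2).1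
    calc _ ≤ ∫⁻ x, (∫⁻ t : ℝ, (A ∩ Q k).indicator 1 (x + t • e))
          ∂((Measure.euclideanHausdorffMeasure (d - 1)).restrict (O ∩ P k)) := by
          refine setLIntegral_mono' (hOm.inter (hm k)) fun x hxk => ?_
          have hm1 : Measurable fun t : ℝ => x + t • e := Continuous.measurable (by fun_prop)
          rw [Measure.restrict_apply ((hΨ hA).preimage measurable_prodMk_left)]
          have hi : ∀ t : ℝ, (A ∩ Q k).indicator (1 : 𝔼 → ℝ≥0∞) (x + t • e) =
              ((fun t : ℝ => x + t • e) ⁻¹' (A ∩ Q k)).indicator 1 t := fun t => rfl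
          simp only [hi]
          rw [lintegral_indicator_one (hm1 hAQ)]
          refine measure_mono ?_
          rintro t ⟨ht1, ht2⟩
          exact ⟨ht1, ⟨(x, t), ⟨hxk, ht2⟩, rfl⟩⟩
      _ ≤ ∫⁻ x, (∫⁻ t : ℝ, (A ∩ Q k).indicator 1 (x + t • e)) ∂(hyperplaneMeasure (ν k) (a k)) :=
          lintegral_mono' (Measure.restrict_mono hsub le_rfl) le_rfl
      _ = ENNReal.ofReal |(inner ℝ (ν k) e)⁻¹| * volume (A ∩ Q k) := by
          rw [lintegral_hyperplaneMeasure (hν k) (a k) e hang0 (measurable_one.indicator hAQ),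
            lintegral_indicator_one hAQ]
      _ ≤ _ := by
          gcongr
          rw [abs_inv]
          refine inv_anti₀ hβ ?_
          rw [abs_of_neg (by linarith)]; linarith
  calc _ ≤ ∑' k, ENNReal.ofReal β⁻¹ * volume (A ∩ Q k) := ENNReal.tsum_le_tsum hk
    _ = ENNReal.ofReal β⁻¹ * volume (⋃ k, A ∩ Q k) := by
        rw [ENNReal.tsum_mul_left, measure_iUnion
          (fun i j hij => (hQd hij).mono inter_subset_right inter_subset_right)
          (fun k => hA.inter (hQm k))]
    _ ≤ _ := by
        gcongr
        exact iUnion_subset fun k => inter_subset_inter_right _ (hQU k)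

open Filter Topology in
theorem exists_smoothStep : ∃ θ : ℝ → ℝ,
    ContDiff ℝ ∞ θ ∧ (∀ t ≤ 1, θ t = 0) ∧ (∀ t, 2 ≤ t → θ t = 1) ∧
    (∀ t, |θ t| ≤ 1) ∧ (∀ t < 1, deriv θ t = 0) ∧ (∀ t, 2 < t → deriv θ t = 0) ∧
    ∃ C : ℝ, ∀ t, |deriv θ t| ≤ C := by
  have hs : ContDiff ℝ ∞ (fun t : ℝ => Real.smoothTransition (t - 1)) :=
    Real.smoothTransition.contDiff.comp (contDiff_id.sub contDiff_const)
  have h0 : ∀ t : ℝ, t ≤ 1 → Real.smoothTransition (t - 1) = 0 := fun t ht =>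
    Real.smoothTransition.zero_of_nonpos (by linarith)
  have h1 : ∀ t : ℝ, 2 ≤ t → Real.smoothTransition (t - 1) = 1 := fun t ht =>
    Real.smoothTransition.one_of_one_le (by linarith)
  have d0 : ∀ t < 1, deriv (fun t : ℝ => Real.smoothTransition (t - 1)) t = 0 := by
    intro t ht
    have : (fun t : ℝ => Real.smoothTransition (t - 1)) =ᶠ[𝓝 t] fun _ => (0 : ℝ) := by
      filter_upwards [Iio_mem_nhds ht] with u hu using h0 u (le_of_lt hu)
    rw [this.deriv_eq]; simp
  have d1 : ∀ t, 2 < t → deriv (fun t : ℝ => Real.smoothTransition (t - 1)) t = 0 := by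
    intro t ht
    have : (fun t : ℝ => Real.smoothTransition (t - 1)) =ᶠ[𝓝 t] fun _ => (1 : ℝ) := by
      filter_upwards [Ioi_mem_nhds ht] with u hu using h1 u (le_of_lt hu)
    rw [this.deriv_eq]; simp
  refine ⟨_, hs, h0, h1, fun t => ?_, d0, d1, ?_⟩
  · rw [abs_of_nonneg (Real.smoothTransition.nonneg _)]; exact Real.smoothTransition.le_one _
  · have hc : Continuous (deriv (fun t : ℝ => Real.smoothTransition (t - 1))) :=
      hs.continuous_deriv (by simp)
    obtain ⟨C, hC⟩ := isCompact_Icc.exists_bound_of_continuousOn (s := Icc (1 : ℝ) 2) hc.continuousOn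
    refine ⟨max C 0, fun t => ?_⟩
    by_cases ht : t ∈ Icc (1 : ℝ) 2
    · exact (hC t ht).trans (le_max_left _ _)
    · rw [mem_Icc, not_and_or, not_le, not_le] at ht
      rcases ht with ht | ht
      · rw [d0 t ht]; simp
      · rw [d1 t ht]; simp

/-- The signed distance to a hyperplane, positive on the inner side. -/
def depth (ν a y : 𝔼) : ℝ := - inner ℝ ν (y - a)

theorem contDiff_depth (ν a : 𝔼) : ContDiff ℝ ∞ (depth ν a) := by
  exact (contDiff_const.inner ℝ (contDiff_id.sub contDiff_const)).neg

theorem depth_add_smul (ν a y z : 𝔼) (s : ℝ) :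
    depth ν a (y + s • z) = depth ν a y - s * inner ℝ ν z := by
  have : y + s • z - a = (y - a) + s • z := by abel
  rw [depth, this, inner_add_right, inner_smul_right, depth]; ring

/-- The boundary layer integrals converge to the boundary functional of Green's formula. -/
theorem HasWeakGrad.tendsto_layer {U : Set 𝔼} {w : 𝔼 → ℝ} {G : Fin d → 𝔼 → ℝ}
    (h : HasWeakGrad U w G) (hw : Integrable w) (hG : ∀ i, Integrable (G i)) (ν a : 𝔼)
    {θ : ℝ → ℝ} (hθ : ContDiff ℝ ∞ θ) (hθ0 : ∀ t ≤ 1, θ t = 0) (hθ1 : ∀ t, 2 ≤ t → θ t = 1)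
    (hθb : ∀ t, |θ t| ≤ 1) (hθC : ∃ C : ℝ, ∀ t, |deriv θ t| ≤ C)
    {ψ : 𝔼 → ℝ} (hψ : ContDiff ℝ ∞ ψ) (hc : HasCompactSupport ψ)
    (hs : ∀ y ∈ tsupport ψ, 0 < depth ν a y → y ∈ U) (z : 𝔼) :
    Filter.Tendsto (fun k : ℕ => inner ℝ ν z *
        ∫ y, w y * (ψ y * (k * deriv θ (k * depth ν a y)))) Filter.atTop
      (nhds (∫ y in {y | 0 < depth ν a y}, (w y * fderiv ℝ ψ y z + dirGrad G z y * ψ y))) := by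
  obtain ⟨C, hC⟩ := hθC
  have hdc := contDiff_depth ν a
  have hHm : MeasurableSet {y : 𝔼 | 0 < depth ν a y} :=
    (isOpen_lt continuous_const hdc.continuous).measurableSet
  have hθc' : Continuous (deriv θ) := hθ.continuous_deriv (by simp)
  have hφ1 : Continuous fun x => fderiv ℝ ψ x z :=
    (hψ.continuous_fderiv (by simp)).clm_apply continuous_const
  obtain ⟨C1, hC1⟩ := (hc.fderiv_apply ℝ z).exists_bound_of_continuous hφ1
  obtain ⟨C2, hC2⟩ := hc.exists_bound_of_continuous hψ.continuous
  have hgi := integrable_dirGrad hG z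
  have i1 : Integrable fun y => w y * fderiv ℝ ψ y z :=
    hw.mul_bdd (c := C1) hφ1.aestronglyMeasurable (Filter.Eventually.of_forall hC1)
  have i2 : Integrable fun y => dirGrad G z y * ψ y :=
    hgi.mul_bdd (c := C2) hψ.continuous.aestronglyMeasurable (Filter.Eventually.of_forall hC2)
  have eq : ∀ k : ℕ, 1 ≤ k → inner ℝ ν z * ∫ y, w y * (ψ y * (k * deriv θ (k * depth ν a y))) =
      ∫ y, (w y * fderiv ℝ ψ y z + dirGrad G z y * ψ y) * θ (k * depth ν a y) := by
    intro k hk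
    have hkpos : (0 : ℝ) < k := by exact_mod_cast hk
    let ξ : 𝔼 → ℝ := fun y => θ (k * depth ν a y)
    have hξ : ContDiff ℝ ∞ ξ := hθ.comp (contDiff_const.mul hdc)
    have hξb : ∀ y, ‖ξ y‖ ≤ 1 := fun y => hθb _
    have hψk : ContDiff ℝ ∞ (fun y => ψ y * ξ y) := hψ.mul hξ
    have hck : HasCompactSupport (fun y => ψ y * ξ y) := hc.mul_right
    have hsk : tsupport (fun y => ψ y * ξ y) ⊆ U := by
      intro y hy
      have hy1 : y ∈ tsupport ψ := closure_mono (Function.support_mul_subset_left ψ ξ) hy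
      have hy2 : y ∈ tsupport ξ := closure_mono (Function.support_mul_subset_right ψ ξ) hy
      have hcl : IsClosed {y : 𝔼 | 1 ≤ k * depth ν a y} :=
        isClosed_le continuous_const (continuous_const.mul hdc.continuous)
      have hsub : tsupport ξ ⊆ {y : 𝔼 | 1 ≤ k * depth ν a y} := by
        refine closure_minimal (fun u hu => ?_) hcl
        by_contra hlt
        exact hu (hθ0 _ (le_of_lt (not_le.1 hlt)))
      have h1 : (1 : ℝ) ≤ k * depth ν a y := hsub hy2
      refine hs y hy1 ?_
      by_contra hneg
      have := mul_nonpos_of_nonneg_of_nonpos hkpos.le (not_lt.1 hneg)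
      linarith
    have e := h.integral_fderiv hψk hck hsk z
    have hfd : ∀ y, fderiv ℝ (fun y => ψ y * ξ y) y z =
        ξ y * fderiv ℝ ψ y z - inner ℝ ν z * (ψ y * (k * deriv θ (k * depth ν a y))) := by
      intro y
      have hd1 : DifferentiableAt ℝ ψ y := hψ.differentiable (by simp) y
      have hd2 : DifferentiableAt ℝ ξ y := hξ.differentiable (by simp) y
      rw [fderiv_fun_mul hd1 hd2]
      have h3 : fderiv ℝ ξ y z = - (inner ℝ ν z * (k * deriv θ (k * depth ν a y))) := by
        rw [← hd2.lineDeriv_eq_fderiv]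
        have hder : HasDerivAt (fun s : ℝ => θ (k * depth ν a (y + s • z)))
            (deriv θ (k * depth ν a y) * (k * -inner ℝ ν z)) 0 := by
          have g1 : HasDerivAt (fun s : ℝ => k * depth ν a (y + s • z)) (k * - inner ℝ ν z) 0 := by
            simp only [depth_add_smul]
            have := (((hasDerivAt_id (0 : ℝ)).mul_const (inner ℝ ν z)).const_sub
              (depth ν a y)).const_mul (k : ℝ)
            simpa using this
          have g2 : HasDerivAt θ (deriv θ (k * depth ν a y)) (k * depth ν a (y + (0 : ℝ) • z)) := by
            rw [zero_smul, add_zero]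
            exact (hθ.differentiable (by simp) _).hasDerivAt
          exact g2.comp 0 g1
        rw [lineDeriv, hder.deriv]; ring
      simp only [_root_.add_apply, _root_.smul_apply, smul_eq_mul, h3]
      ring
    simp only [hfd] at e
    have i3 : Integrable fun y => w y * (ψ y * (k * deriv θ (k * depth ν a y))) := by
      refine hw.mul_bdd (c := C2 * (k * C)) ?_ (Filter.Eventually.of_forall fun y => ?_)
      · exact (hψ.continuous.mul (continuous_const.mul
          (hθc'.comp (continuous_const.mul hdc.continuous)))).aestronglyMeasurable
      · rw [norm_mul, norm_mul, Real.norm_natCast]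
        have := hC2 y
        have := hC (k * depth ν a y)
        have := (abs_nonneg _).trans this
        gcongr
        · exact (norm_nonneg _).trans (hC2 y)
        · exact hC _
    have i4 : Integrable fun y => w y * fderiv ℝ ψ y z * ξ y :=
      i1.mul_bdd (c := 1) hξ.continuous.aestronglyMeasurable (Filter.Eventually.of_forall hξb)
    have i5 : Integrable fun y => dirGrad G z y * ψ y * ξ y :=
      i2.mul_bdd (c := 1) hξ.continuous.aestronglyMeasurable (Filter.Eventually.of_forall hξb)
    have e1 : ∫ y, w y * (ξ y * fderiv ℝ ψ y z -
        inner ℝ ν z * (ψ y * (k * deriv θ (k * depth ν a y)))) =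
        (∫ y, w y * fderiv ℝ ψ y z * ξ y) -
        inner ℝ ν z * ∫ y, w y * (ψ y * (k * deriv θ (k * depth ν a y))) := by
      rw [← integral_const_mul, ← integral_sub i4 (i3.const_mul _)]
      refine integral_congr_ae (Filter.Eventually.of_forall fun y => ?_)
      simp only []; ring
    have e2 : ∫ y, dirGrad G z y * (ψ y * ξ y) = ∫ y, dirGrad G z y * ψ y * ξ y :=
      integral_congr_ae (Filter.Eventually.of_forall fun y => by simp only []; ring)
    rw [e1, e2] at e
    simp only [add_mul]
    rw [integral_add i4 i5]
    linarith
  have lim : Filter.Tendsto (fun k : ℕ =>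
      ∫ y, (w y * fderiv ℝ ψ y z + dirGrad G z y * ψ y) * θ (k * depth ν a y)) Filter.atTop
      (nhds (∫ y, {y | 0 < depth ν a y}.indicator
        (fun y => w y * fderiv ℝ ψ y z + dirGrad G z y * ψ y) y)) := by
    refine tendsto_integral_of_dominated_convergence
      (fun y => ‖w y * fderiv ℝ ψ y z + dirGrad G z y * ψ y‖) ?_ (i1.add i2).norm ?_ ?_
    · intro k
      exact (i1.add i2).aestronglyMeasurable.mul
        (hθ.continuous.comp (continuous_const.mul hdc.continuous)).aestronglyMeasurable
    · intro k
      refine Filter.Eventually.of_forall fun y => ?_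
      rw [norm_mul]
      exact mul_le_of_le_one_right (norm_nonneg _) (hθb _)
    · refine Filter.Eventually.of_forall fun y => ?_
      by_cases hy : 0 < depth ν a y
      · rw [indicator_of_mem (by exact hy)]
        refine tendsto_const_nhds.congr' ?_
        obtain ⟨k₀, hk₀⟩ := exists_nat_ge (2 / depth ν a y)
        filter_upwards [Filter.eventually_ge_atTop k₀] with k hk
        rw [hθ1, mul_one]
        have : (2 / depth ν a y) ≤ k := hk₀.trans (by exact_mod_cast hk)
        rwa [div_le_iff₀ hy] at this
      · rw [indicator_of_notMem (by exact hy)]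
        refine tendsto_const_nhds.congr' (Filter.Eventually.of_forall fun k => ?_)
        have : (k : ℝ) * depth ν a y ≤ 0 :=
          mul_nonpos_of_nonneg_of_nonpos (by positivity) (not_lt.1 hy)
        change 0 = _ * θ (k * depth ν a y)
        rw [hθ0 _ (by linarith), mul_zero]
  rw [integral_indicator hHm] at lim
  refine lim.congr' ?_
  filter_upwards [Filter.eventually_ge_atTop 1] with k hk using (eq k hk).symm

/-- Boundary layer integrals of test functions vanishing on the hyperplane tend to zero. -/
theorem tendsto_layer_zero {w : 𝔼 → ℝ} (hw : Integrable w) {ν : 𝔼} (hν : ‖ν‖ = 1) (a : 𝔼)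
    {θ : ℝ → ℝ} (hθ : ContDiff ℝ ∞ θ) (hd0 : ∀ t < 1, deriv θ t = 0)
    (hd1 : ∀ t, 2 < t → deriv θ t = 0) (hθC : ∃ C : ℝ, ∀ t, |deriv θ t| ≤ C)
    {ψ : 𝔼 → ℝ} (hψ : ContDiff ℝ ∞ ψ) (hc : HasCompactSupport ψ)
    (hz : ∀ y, depth ν a y = 0 → ψ y = 0) :
    Filter.Tendsto (fun k : ℕ => ∫ y, w y * (ψ y * (k * deriv θ (k * depth ν a y)))) Filter.atTop
      (nhds 0) := by
  obtain ⟨C, hC⟩ := hθC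
  obtain ⟨L, hL⟩ := ContDiff.lipschitzWith_of_hasCompactSupport hc hψ (by simp)
  have hC0 : 0 ≤ C := (abs_nonneg _).trans (hC 0)
  have hdc := contDiff_depth ν a
  have hθc' : Continuous (deriv θ) := hθ.continuous_deriv (by simp)
  have hψb : ∀ y, |ψ y| ≤ L * |depth ν a y| := by
    intro y
    have h0 : depth ν a (y + depth ν a y • ν) = 0 := by
      rw [depth_add_smul, real_inner_self_eq_norm_sq, hν]; ring
    have := hL.dist_le_mul y (y + depth ν a y • ν)
    rw [hz _ h0, Real.dist_eq, sub_zero, dist_eq_norm, sub_add_cancel_left, norm_neg, norm_smul, hν,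
      mul_one, Real.norm_eq_abs] at this
    exact this
  have hbound : ∀ (k : ℕ) (y : 𝔼), |ψ y * (k * deriv θ (k * depth ν a y))| ≤ 2 * L * C := by
    intro k y
    by_cases hk : (k : ℝ) * depth ν a y ∈ Icc (1 : ℝ) 2
    · rw [abs_mul, abs_mul, abs_of_nonneg (Nat.cast_nonneg k : (0 : ℝ) ≤ k)]
      have e1 : (k : ℝ) * |depth ν a y| ≤ 2 := by
        rw [← abs_of_nonneg (Nat.cast_nonneg k : (0 : ℝ) ≤ k), ← abs_mul, abs_of_nonneg
          (by linarith [hk.1])]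
        exact hk.2
      calc |ψ y| * (k * |deriv θ (k * depth ν a y)|) ≤ (L * |depth ν a y|) * (k * C) := by
            gcongr
            · exact hψb y
            · exact hC _
        _ = (k * |depth ν a y|) * (L * C) := by ring
        _ ≤ 2 * (L * C) := by gcongr
        _ = 2 * L * C := by ring
    · have : deriv θ (k * depth ν a y) = 0 := by
        rw [mem_Icc, not_and_or, not_le, not_le] at hk
        rcases hk with hk | hk
        · exact hd0 _ hk
        · exact hd1 _ hk
      rw [this]; simp; positivity
  have key : Filter.Tendsto (fun k : ℕ => ∫ y, w y * (ψ y * (k * deriv θ (k * depth ν a y))))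
      Filter.atTop (nhds (∫ _y : 𝔼, (0 : ℝ))) := by
    refine tendsto_integral_of_dominated_convergence (fun y => ‖w y‖ * (2 * L * C)) ?_
      (hw.norm.mul_const _) ?_ ?_
    · intro k
      exact hw.aestronglyMeasurable.mul (hψ.continuous.mul (continuous_const.mul
          (hθc'.comp (continuous_const.mul hdc.continuous)))).aestronglyMeasurable
    · intro k
      refine Filter.Eventually.of_forall fun y => ?_
      rw [norm_mul]
      exact mul_le_mul_of_nonneg_left (hbound k y) (norm_nonneg _)
    · refine Filter.Eventually.of_forall fun y => ?_
      refine tendsto_const_nhds.congr' ?_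
      by_cases hy : 0 < depth ν a y
      · obtain ⟨k₀, hk₀⟩ := exists_nat_gt (2 / depth ν a y)
        filter_upwards [Filter.eventually_ge_atTop k₀] with k hk
        have : (2 / depth ν a y) < k := hk₀.trans_le (by exact_mod_cast hk)
        rw [div_lt_iff₀ hy] at this
        rw [hd1 _ this]; simp
      · refine Filter.Eventually.of_forall fun k => ?_
        have : (k : ℝ) * depth ν a y ≤ 0 :=
          mul_nonpos_of_nonneg_of_nonpos (by positivity) (not_lt.1 hy)
        change 0 = w y * (ψ y * (k * deriv θ (k * depth ν a y)))
        rw [hd0 _ (by linarith)]; simp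
  simpa using key

/-- A smooth cutoff function on the line. -/
def lineCutoff : ContDiffBump (0 : ℝ) := ⟨1 / 4, 1 / 2, by norm_num, by norm_num⟩

theorem lineCutoff_eq_zero {t : ℝ} (ht : 1 / 2 ≤ |t|) : lineCutoff t = 0 :=
  lineCutoff.zero_of_le_dist (by simpa [lineCutoff] using ht)

theorem contDiff_lineCutoff : ContDiff ℝ ∞ lineCutoff := lineCutoff.contDiff

theorem deriv_lineCutoff_eq_zero {t : ℝ} (ht : 1 / 2 < |t|) : deriv lineCutoff t = 0 := by
  have : (lineCutoff : ℝ → ℝ) =ᶠ[nhds t] fun _ => (0 : ℝ) := by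
    filter_upwards [(isOpen_lt continuous_const continuous_abs).mem_nhds ht] with u hu
    exact lineCutoff_eq_zero (le_of_lt hu)
  rw [this.deriv_eq]; simp

theorem exists_deriv_lineCutoff_bound : ∃ C : ℝ, 1 ≤ C ∧ ∀ t, |deriv lineCutoff t| ≤ C := by
  have hc : HasCompactSupport (deriv lineCutoff) := lineCutoff.hasCompactSupport.deriv
  obtain ⟨C, hC⟩ := hc.exists_bound_of_continuous (contDiff_lineCutoff.continuous_deriv (by simp))
  exact ⟨max C 1, le_max_right _ _, fun t => (hC t).trans (le_max_left _ _)⟩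

theorem abs_lineCutoff_le (t : ℝ) : |lineCutoff t| ≤ 1 := by
  rw [abs_of_nonneg lineCutoff.nonneg]; exact lineCutoff.le_one

/-- The trace of `w` computed by integration along the direction `e`. -/
def lineTrace (w : 𝔼 → ℝ) (G : Fin d → 𝔼 → ℝ) (e x : 𝔼) : ℝ :=
  - ∫ t in Ioc (0 : ℝ) 1,
    (deriv lineCutoff t * w (x + t • e) + lineCutoff t * dirGrad G e (x + t • e))

theorem dirGrad_single (G : Fin d → 𝔼 → ℝ) (i : Fin d) :
    dirGrad G (EuclideanSpace.single i 1) = G i := by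
  funext x
  simp [dirGrad]

/-- The integrand in the boundary functional along `e`, in the flattened coordinates. -/
theorem setIntegral_depth_pos {w : 𝔼 → ℝ} {G : Fin d → 𝔼 → ℝ} (hw : Integrable w)
    (hG : ∀ i, Integrable (G i)) {ν : 𝔼} (hν : ‖ν‖ = 1) (a : 𝔼) {e : 𝔼} (he : inner ℝ ν e < 0)
    {φ : 𝔼 → ℝ} (hφ : Continuous φ) (hc : HasCompactSupport φ) :
    ∫ y in {y | 0 < depth ν a y},
      φ (y - (depth ν a y / -inner ℝ ν e) • e) *
        (deriv lineCutoff (depth ν a y / -inner ℝ ν e) * w y +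
          lineCutoff (depth ν a y / -inner ℝ ν e) * dirGrad G e y) =
      inner ℝ ν e * ∫ x, lineTrace w G e x * φ x ∂(hyperplaneMeasure ν a) := by
  set b : ℝ := -inner ℝ ν e with hb
  have hbpos : 0 < b := by rw [hb]; linarith
  have hdc := (contDiff_depth ν a).continuous
  have hHm : MeasurableSet {y : 𝔼 | 0 < depth ν a y} :=
    (isOpen_lt continuous_const hdc).measurableSet
  obtain ⟨C, hC1, hC⟩ := exists_deriv_lineCutoff_bound
  obtain ⟨C2, hC2⟩ := hc.exists_bound_of_continuous hφ
  have hcd : Continuous (deriv lineCutoff) := contDiff_lineCutoff.continuous_deriv (by simp)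
  have hcc : Continuous lineCutoff := contDiff_lineCutoff.continuous
  let F : 𝔼 → ℝ := fun y => φ (y - (depth ν a y / b) • e) *
        (deriv lineCutoff (depth ν a y / b) * w y + lineCutoff (depth ν a y / b) * dirGrad G e y)
  have hF : Integrable F := by
    have i1 : Integrable fun y => deriv lineCutoff (depth ν a y / b) * w y :=
      hw.bdd_mul (c := C) (hcd.comp (hdc.div_const b)).aestronglyMeasurable
        (Filter.Eventually.of_forall fun y => hC _)
    have i2 : Integrable fun y => lineCutoff (depth ν a y / b) * dirGrad G e y :=
      (integrable_dirGrad hG e).bdd_mul (c := 1) (hcc.comp (hdc.div_const b)).aestronglyMeasurable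
        (Filter.Eventually.of_forall fun y => abs_lineCutoff_le _)
    refine (i1.add i2).bdd_mul (c := C2) ?_ (Filter.Eventually.of_forall fun y => hC2 _)
    exact (hφ.comp (by fun_prop)).aestronglyMeasurable
  rw [← integral_indicator hHm]
  have key := integral_hyperplaneMeasure hν a e he.ne (hF.indicator hHm)
  have hin : ∀ x ∈ hyperplane ν a, ∫ t : ℝ, {y : 𝔼 | 0 < depth ν a y}.indicator F (x + t • e) =
      - (lineTrace w G e x * φ x) := by
    intro x hx
    have hx0 : depth ν a x = 0 := by
      have : inner ℝ ν (x - a) = 0 := hx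
      rw [depth, this, neg_zero]
    have hdep : ∀ t : ℝ, depth ν a (x + t • e) = t * b := by
      intro t; rw [depth_add_smul, hx0, hb]; ring
    have hpt : ∀ t : ℝ, {y : 𝔼 | 0 < depth ν a y}.indicator F (x + t • e) =
        (Ioc (0 : ℝ) 1).indicator (fun t => φ x *
          (deriv lineCutoff t * w (x + t • e) + lineCutoff t * dirGrad G e (x + t • e))) t := by
      intro t
      by_cases ht : 0 < t
      · have hmem : x + t • e ∈ {y : 𝔼 | 0 < depth ν a y} := by
          change 0 < depth ν a (x + t • e)
          rw [hdep]; positivity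
        have hFx : F (x + t • e) = φ x *
          (deriv lineCutoff t * w (x + t • e) + lineCutoff t * dirGrad G e (x + t • e)) := by
          simp only [F, hdep, mul_div_cancel_right₀ _ hbpos.ne', add_sub_cancel_right]
        rw [indicator_of_mem hmem, hFx]
        by_cases ht1 : t ≤ 1
        · rw [indicator_of_mem (show t ∈ Ioc (0 : ℝ) 1 from ⟨ht, ht1⟩)]
        · rw [indicator_of_notMem (fun hh => ht1 hh.2)]
          have : 1 < |t| := by rw [abs_of_pos ht]; linarith
          rw [deriv_lineCutoff_eq_zero (by linarith), lineCutoff_eq_zero (by linarith)]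
          simp
      · have hnm : x + t • e ∉ {y : 𝔼 | 0 < depth ν a y} := by
          change ¬ 0 < depth ν a (x + t • e)
          rw [hdep, not_lt]
          exact mul_nonpos_of_nonpos_of_nonneg (not_lt.1 ht) hbpos.le
        rw [indicator_of_notMem hnm, indicator_of_notMem (fun hh => ht hh.1)]
    simp only [hpt]
    rw [integral_indicator measurableSet_Ioc, integral_const_mul, lineTrace]
    ring
  have e1 : ∫ x, (∫ t : ℝ, {y : 𝔼 | 0 < depth ν a y}.indicator F (x + t • e))
      ∂(hyperplaneMeasure ν a) = ∫ x, - (lineTrace w G e x * φ x) ∂(hyperplaneMeasure ν a) :=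
    setIntegral_congr_fun (measurableSet_hyperplane ν a) hin
  rw [e1, integral_neg, abs_inv, abs_of_neg he, ← hb] at key
  have e2 : inner ℝ ν e = -b := by rw [hb]; ring
  rw [e2]
  have : ∫ y, {y : 𝔼 | 0 < depth ν a y}.indicator F y =
      b * (b⁻¹ * ∫ y, {y : 𝔼 | 0 < depth ν a y}.indicator F y) := by field_simp
  rw [this, ← key]; ring

/-- Green's formula near a point of a face, with the trace computed along a direction `e`. -/
theorem HasWeakGrad.local_green {U : Set 𝔼} (hU : IsOpen U) {w : 𝔼 → ℝ} {G : Fin d → 𝔼 → ℝ}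
    (h : HasWeakGrad U w G) (hw : Integrable w) (hG : ∀ i, Integrable (G i)) {ν a e : 𝔼}
    (hν : ‖ν‖ = 1) (he : inner ℝ ν e < 0) {ε : ℝ}
    (hb : ∀ y ∈ Metric.ball a ε, (y ∈ U ↔ inner ℝ ν (y - a) < 0))
    (hseg : ∀ y ∈ Metric.ball a ε, inner ℝ ν (y - a) = 0 → ∀ t ∈ Ioc (0 : ℝ) 1, y + t • e ∈ U)
    {φ : 𝔼 → ℝ} (hφ : ContDiff ℝ ∞ φ) (hc : HasCompactSupport φ)
    (hs : tsupport φ ⊆ Metric.ball a ε) (i : Fin d) :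
    ∫ y in U, (w y * partialDeriv i φ y + G i y * φ y) =
      ν i * ∫ x, lineTrace w G e x * φ x ∂(hyperplaneMeasure ν a) := by
  obtain ⟨θ, hθ, hθ0, hθ1, hθb, hd0, hd1, hθC⟩ := exists_smoothStep
  set b : ℝ := -inner ℝ ν e with hbdef
  have hbpos : 0 < b := by rw [hbdef]; linarith
  have hdc := contDiff_depth ν a
  let X : 𝔼 → 𝔼 := fun y => y - (depth ν a y / b) • e
  have hX : ContDiff ℝ ∞ X := contDiff_id.sub ((hdc.div_const b).smul contDiff_const)
  let φ' : 𝔼 → ℝ := fun y => φ (X y) * lineCutoff (depth ν a y / b)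
  have hφ' : ContDiff ℝ ∞ φ' :=
    (hφ.comp hX).mul (contDiff_lineCutoff.comp (hdc.div_const b))
  have hXH : ∀ y, X y ∈ hyperplane ν a := by
    intro y
    have : depth ν a (X y) = 0 := by
      have e1 : X y = y + (-(depth ν a y / b)) • e := by simp only [X]; module
      rw [e1, depth_add_smul]
      have : inner ℝ ν e = -b := by rw [hbdef]; ring
      rw [this]; field_simp; ring
    exact neg_eq_zero.1 this
  have hHcl : IsClosed (hyperplane ν a) := isClosed_eq (by fun_prop) continuous_const
  let K : Set 𝔼 := (fun q : 𝔼 × ℝ => q.1 + q.2 • e) ''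
    ((tsupport φ ∩ hyperplane ν a) ×ˢ Icc (-(1 / 2) : ℝ) (1 / 2))
  have hK : IsCompact K :=
    ((IsCompact.inter_right hc hHcl).prod isCompact_Icc).image (by fun_prop)
  have hsuppK : Function.support φ' ⊆ K := by
    intro y hy
    have h1 : φ (X y) ≠ 0 := left_ne_zero_of_mul hy
    have h2 : lineCutoff (depth ν a y / b) ≠ 0 := right_ne_zero_of_mul hy
    have h3 : |depth ν a y / b| < 1 / 2 := by
      by_contra hcon; exact h2 (lineCutoff_eq_zero (not_lt.1 hcon))
    refine ⟨(X y, depth ν a y / b), ⟨⟨subset_tsupport _ h1, hXH y⟩, ?_⟩, ?_⟩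
    · exact ⟨(abs_lt.1 h3).1.le, (abs_lt.1 h3).2.le⟩
    · simp [X]
  have hc' : HasCompactSupport φ' := HasCompactSupport.of_support_subset_isCompact hK hsuppK
  have hs' : ∀ y ∈ tsupport φ', 0 < depth ν a y → y ∈ U := by
    intro y hy hpos
    obtain ⟨⟨x, t⟩, ⟨⟨hx1, hx2⟩, ht⟩, rfl⟩ := closure_minimal hsuppK hK.isClosed hy
    have hx2' : inner ℝ ν (x - a) = 0 := hx2
    have hdep : depth ν a (x + t • e) = t * b := by
      rw [depth_add_smul, depth, hx2', hbdef]; ring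
    simp only [hdep] at hpos
    have htpos : 0 < t := pos_of_mul_pos_left hpos hbpos.le
    exact hseg x (hs hx1) hx2' t ⟨htpos, by have := ht.2; simp only at this; linarith⟩
  have hs0 : ∀ y ∈ tsupport φ, 0 < depth ν a y → y ∈ U := by
    intro y hy hpos
    rw [hb y (hs hy)]
    unfold depth at hpos; linarith
  -- the layer integrals
  let I : (𝔼 → ℝ) → ℕ → ℝ := fun ψ k => ∫ y, w y * (ψ y * (k * deriv θ (k * depth ν a y)))
  have limφ := h.tendsto_layer hw hG ν a hθ hθ0 hθ1 hθb hθC hφ hc hs0 (EuclideanSpace.single i 1)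
  have limφ' := h.tendsto_layer hw hG ν a hθ hθ0 hθ1 hθb hθC hφ' hc' hs' e
  have limdiff := tendsto_layer_zero hw hν a hθ hd0 hd1 hθC (hφ.sub hφ') (hc.sub hc') (by
    intro y hy
    simp only [φ', X, hy, zero_div, zero_smul, sub_zero]
    rw [lineCutoff.one_of_mem_closedBall (by simp [lineCutoff]), mul_one, sub_self])
  have hfd : ∀ y, fderiv ℝ φ' y e = φ (X y) * deriv lineCutoff (depth ν a y / b) := by
    intro y
    rw [← (hφ'.differentiable (by simp) y).lineDeriv_eq_fderiv, lineDeriv]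
    have e1 : ∀ s : ℝ, φ' (y + s • e) = φ (X y) * lineCutoff (depth ν a y / b + s) := by
      intro s
      have hd : depth ν a (y + s • e) / b = depth ν a y / b + s := by
        rw [depth_add_smul]
        have : inner ℝ ν e = -b := by rw [hbdef]; ring
        rw [this]; field_simp; ring
      have hXs : X (y + s • e) = X y := by
        simp only [X, hd]; module
      simp only [φ', hd, hXs]
    simp only [e1]
    have g1 : HasDerivAt (fun s : ℝ => depth ν a y / b + s) 1 0 :=
      (hasDerivAt_id (0 : ℝ)).const_add _
    have g2 : HasDerivAt lineCutoff (deriv lineCutoff (depth ν a y / b)) (depth ν a y / b + 0) := by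
      rw [add_zero]
      exact (contDiff_lineCutoff.differentiable (by simp) _).hasDerivAt
    have g3 := (g2.comp 0 g1).const_mul (φ (X y))
    rw [mul_one] at g3
    exact g3.deriv
  have hlimit : ∫ y in {y | 0 < depth ν a y}, (w y * fderiv ℝ φ' y e + dirGrad G e y * φ' y) =
      inner ℝ ν e * ∫ x, lineTrace w G e x * φ x ∂(hyperplaneMeasure ν a) := by
    rw [← setIntegral_depth_pos hw hG hν a he hφ.continuous hc]
    refine integral_congr_ae (Filter.Eventually.of_forall fun y => ?_)
    simp only [hfd, φ', X]
    ring
  rw [hlimit] at limφ'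
  have lim1 : Filter.Tendsto (I φ') Filter.atTop
      (nhds (∫ x, lineTrace w G e x * φ x ∂(hyperplaneMeasure ν a))) := by
    have := limφ'.const_mul (inner ℝ ν e)⁻¹
    simpa only [inv_mul_cancel_left₀ he.ne] using this
  have hint : ∀ (ψ : 𝔼 → ℝ), ContDiff ℝ ∞ ψ → HasCompactSupport ψ → ∀ k : ℕ,
      Integrable fun y => w y * (ψ y * (k * deriv θ (k * depth ν a y))) := by
    intro ψ hψ hψc k
    have hcont : Continuous fun y => ψ y * (k * deriv θ (k * depth ν a y)) :=
      hψ.continuous.mul (continuous_const.mul ((hθ.continuous_deriv (by simp)).comp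
        (continuous_const.mul hdc.continuous)))
    obtain ⟨C, hC⟩ := (HasCompactSupport.mul_right (f' := fun y => k * deriv θ (k * depth ν a y))
      hψc).exists_bound_of_continuous hcont
    exact hw.mul_bdd (c := C) hcont.aestronglyMeasurable (Filter.Eventually.of_forall hC)
  have lim2 : Filter.Tendsto (I φ) Filter.atTop
      (nhds (∫ x, lineTrace w G e x * φ x ∂(hyperplaneMeasure ν a))) := by
    have := limdiff.add lim1
    rw [zero_add] at this
    refine this.congr fun k => ?_
    simp only [I]
    rw [← integral_add (hint _ (hφ.sub hφ') (hc.sub hc') k) (hint φ' hφ' hc' k)]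
    refine integral_congr_ae (Filter.Eventually.of_forall fun y => ?_)
    simp only []; ring
  have lim3 := lim2.const_mul (inner ℝ ν (EuclideanSpace.single i 1))
  have heq := tendsto_nhds_unique limφ lim3
  rw [dirGrad_single] at heq
  have hνi : inner ℝ ν (EuclideanSpace.single i (1 : ℝ)) = ν i := by
    rw [EuclideanSpace.inner_single_right]; simp
  rw [hνi] at heq
  rw [← heq, ← integral_indicator hU.measurableSet,
    ← integral_indicator (isOpen_lt continuous_const hdc.continuous).measurableSet]
  refine integral_congr_ae (Filter.Eventually.of_forall fun y => ?_)
  by_cases hy : y ∈ tsupport φ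
  · have hiff : y ∈ U ↔ y ∈ {y | 0 < depth ν a y} := by
      rw [hb y (hs hy), mem_ofPred_eq, depth, neg_pos]
    by_cases hyU : y ∈ U
    · simp only [indicator_of_mem hyU, indicator_of_mem (hiff.1 hyU), partialDeriv]
    · simp only [indicator_of_notMem hyU, indicator_of_notMem (fun hh => hyU (hiff.2 hh))]
  · have h1 : φ y = 0 := image_eq_zero_of_notMem_tsupport hy
    have h2 : partialDeriv i φ y = 0 :=
      image_eq_zero_of_notMem_tsupport fun hh => hy (tsupport_partialDeriv i φ hh)
    have h3 : fderiv ℝ φ y (EuclideanSpace.single i 1) = 0 := h2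
    simp only [indicator, h1, h2, h3, mul_zero, add_zero, ite_self]

theorem norm_outwardNormal {U : Set 𝔼} {x : 𝔼} (hx : x ∈ faceSet U) : ‖outwardNormal U x‖ = 1 := by
  obtain ⟨ν, hν⟩ := hx
  rw [hν.outwardNormal_eq, hν.1]

theorem norm_outwardNormal_le (U : Set 𝔼) (x : 𝔼) : ‖outwardNormal U x‖ ≤ 1 := by
  by_cases hx : x ∈ faceSet U
  · exact (norm_outwardNormal hx).le
  · rw [outwardNormal, dif_neg (show ¬ ∃ ν, IsHalfSpaceNear U ν x from hx)]; simp

theorem aestronglyMeasurable_outwardNormal (U : Set 𝔼) (i : Fin d) :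
    AEStronglyMeasurable (fun x => outwardNormal U x i) (faceMeasure U) := by
  rw [faceMeasure_eq]
  rcases (faceSet U).eq_empty_or_nonempty with h | h
  · rw [h, Measure.restrict_empty]; exact aestronglyMeasurable_zero_measure _
  obtain ⟨P, ν, a, hd, hm, hP, hν, hx⟩ := exists_faceSet_decomposition U h
  rw [← hP, aestronglyMeasurable_iUnion_iff]
  intro k
  refine (aestronglyMeasurable_const (b := ν k i)).congr ?_
  rw [Filter.EventuallyEq, ae_restrict_iff' (hm k)]
  refine Filter.Eventually.of_forall fun x hxk => ?_
  rw [(hx k x hxk).2.outwardNormal_eq]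

theorem ae_mem_faceSet (U : Set 𝔼) : ∀ᵐ x ∂(faceMeasure U), x ∈ faceSet U := by
  rw [faceMeasure_eq]; exact ae_restrict_mem (measurableSet_faceSet U)

theorem integrable_mul_outwardNormal {U : Set 𝔼} {f : 𝔼 → ℝ} (hf : Integrable f (faceMeasure U))
    (i : Fin d) : Integrable (fun x => f x * outwardNormal U x i) (faceMeasure U) :=
  hf.mul_bdd (c := 1) (aestronglyMeasurable_outwardNormal U i)
    (Filter.Eventually.of_forall fun x => (PiLp.norm_apply_le _ i).trans (norm_outwardNormal_le U x))

theorem ae_eq_of_integral_mul_outwardNormal {U V : Set 𝔼} (hV : IsOpen V) {g₁ g₂ : 𝔼 → ℝ}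
    (h₁ : LocallyIntegrableOn g₁ V (faceMeasure U)) (h₂ : LocallyIntegrableOn g₂ V (faceMeasure U))
    (h : ∀ φ : 𝔼 → ℝ, ContDiff ℝ ∞ φ → HasCompactSupport φ → tsupport φ ⊆ V → ∀ i : Fin d,
      ∫ x, g₁ x * φ x * outwardNormal U x i ∂(faceMeasure U) =
        ∫ x, g₂ x * φ x * outwardNormal U x i ∂(faceMeasure U)) :
    ∀ᵐ x ∂(faceMeasure U), x ∈ V → g₁ x = g₂ x := by
  have key : ∀ i : Fin d, ∀ᵐ x ∂(faceMeasure U), x ∈ V → (g₁ x - g₂ x) * outwardNormal U x i = 0 := by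
    intro i
    refine hV.ae_eq_zero_of_integral_contDiff_smul_eq_zero ?_ fun φ hφ hc hs => ?_
    · have hsub := h₁.sub h₂
      intro x hx
      obtain ⟨A, hA, hAi⟩ := hsub x hx
      refine ⟨A, hA, ?_⟩
      exact Integrable.mul_bdd (c := 1) hAi (aestronglyMeasurable_outwardNormal U i).restrict
        (Filter.Eventually.of_forall fun x =>
          (PiLp.norm_apply_le _ i).trans (norm_outwardNormal_le U x))
    · have i1 := integrable_mul_outwardNormal (h₁.integrable_mul_of_tsupport hφ.continuous hc hs) i
      have i2 := integrable_mul_outwardNormal (h₂.integrable_mul_of_tsupport hφ.continuous hc hs) i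
      have := sub_eq_zero.2 (h φ hφ hc hs i)
      rw [← integral_sub i1 i2] at this
      rw [← this]
      refine integral_congr_ae (Filter.Eventually.of_forall fun x => ?_)
      simp only [smul_eq_mul]; ring
  filter_upwards [ae_all_iff.2 key, ae_mem_faceSet U] with x hx hxf hxV
  by_contra hne
  have h0 : outwardNormal U x = 0 := by
    ext i
    exact (mul_eq_zero.1 (hx i hxV)).resolve_left (sub_ne_zero.2 hne)
  have := norm_outwardNormal hxf
  rw [h0, norm_zero] at this
  exact zero_ne_one this

theorem LocallyIntegrableOn.compl_frontier_diff {U : Set 𝔼} {g : 𝔼 → ℝ}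
    (hg : LocallyIntegrableOn g (faceSet U) (Measure.euclideanHausdorffMeasure (d - 1))) :
    LocallyIntegrableOn g (frontier U \ faceSet U)ᶜ (faceMeasure U) := by
  intro x hx
  by_cases hxf : x ∈ faceSet U
  · obtain ⟨A, hA, hAi⟩ := hg x hxf
    obtain ⟨N, hN, hNA⟩ := mem_nhdsWithin_iff_exists_mem_nhds_inter.1 hA
    obtain ⟨N', hN'N, hN'o, hxN'⟩ := mem_nhds_iff.1 hN
    refine ⟨N', mem_nhdsWithin_of_mem_nhds (hN'o.mem_nhds hxN'), ?_⟩
    rw [faceMeasure_eq, IntegrableOn, Measure.restrict_restrict hN'o.measurableSet]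
    exact hAi.mono_set ((inter_subset_inter_left _ hN'N).trans hNA)
  · have hxfr : x ∉ frontier U := fun h => hx ⟨h, hxf⟩
    refine ⟨(frontier U)ᶜ, mem_nhdsWithin_of_mem_nhds
      (isClosed_frontier.isOpen_compl.mem_nhds hxfr), ?_⟩
    rw [faceMeasure_eq, IntegrableOn,
      Measure.restrict_restrict isClosed_frontier.isOpen_compl.measurableSet]
    have : (frontier U)ᶜ ∩ faceSet U = ∅ := by
      rw [eq_empty_iff_forall_notMem]
      exact fun y hy => hy.1 (faceSet_subset_frontier U hy.2)
    rw [this, Measure.restrict_empty]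
    exact integrable_zero_measure

/-- The trace of a function is unique up to null sets of the surface measure. -/
theorem IsTrace.ae_eq {U : Set 𝔼} {w g₁ g₂ : 𝔼 → ℝ} (h₁ : IsTrace U w g₁) (h₂ : IsTrace U w g₂) :
    g₁ =ᵐ[faceMeasure U] g₂ := by
  have l₁ := h₁.1
  have l₂ := h₂.1
  rw [sUnion_hyperplanarFaces] at l₁ l₂
  have := ae_eq_of_integral_mul_outwardNormal (isOpen_compl_frontier_diff_faceSet U)
    (LocallyIntegrableOn.compl_frontier_diff l₁) (LocallyIntegrableOn.compl_frontier_diff l₂)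
    (fun φ hφ hc hs i => by
      have hs' : tsupport φ ∩ frontier U ⊆ ⋃₀ hyperplanarFaces U := by
        rw [sUnion_hyperplanarFaces]
        intro x hx
        by_contra hxf
        exact hs hx.1 ⟨hx.2, hxf⟩
      rw [← h₁.2 φ hφ hc hs' i, ← h₂.2 φ hφ hc hs' i])
  filter_upwards [this, ae_mem_faceSet U] with x hx hxf
  exact hx fun h => h.2 hxf

theorem IsTrace.faceTrace_ae_eq {U : Set 𝔼} {w g : 𝔼 → ℝ} (h : IsTrace U w g) :
    faceTrace U w =ᵐ[faceMeasure U] g := by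
  have h' : ∃ g, IsTrace U w g := ⟨g, h⟩
  rw [faceTrace, dif_pos h']
  exact h'.choose_spec.ae_eq h

/-- Near a point of a face, the surface measure is that of the tangent hyperplane. -/
theorem faceMeasure_restrict_ball {U : Set 𝔼} {ν x : 𝔼} {ε : ℝ} (hν : ‖ν‖ = 1)
    (hb : ∀ y ∈ Metric.ball x ε, (y ∈ U ↔ inner ℝ ν (y - x) < 0)) :
    (faceMeasure U).restrict (Metric.ball x ε) =
      (hyperplaneMeasure ν x).restrict (Metric.ball x ε) := by
  rw [faceMeasure_eq, hyperplaneMeasure, Measure.restrict_restrict Metric.isOpen_ball.measurableSet,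
    Measure.restrict_restrict Metric.isOpen_ball.measurableSet]
  congr 1
  ext y
  simp only [mem_inter_iff]
  exact and_congr_right fun hy => mem_faceSet_iff_of_mem_ball hν hb hy

theorem integrable_lineTrace_hyperplane {w : 𝔼 → ℝ} {G : Fin d → 𝔼 → ℝ} (hw : Integrable w)
    (hG : ∀ i, Integrable (G i)) {ν : 𝔼} (hν : ‖ν‖ = 1) (a : 𝔼) {e : 𝔼} (he : inner ℝ ν e < 0) :
    Integrable (lineTrace w G e) (hyperplaneMeasure ν a) := by
  have := sFinite_hyperplaneMeasure hν a
  obtain ⟨C, hC1, hC⟩ := exists_deriv_lineCutoff_bound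
  have hcd : Continuous (deriv lineCutoff) := contDiff_lineCutoff.continuous_deriv (by simp)
  have hcc : Continuous lineCutoff := contDiff_lineCutoff.continuous
  have i1 : Integrable (fun q : 𝔼 × ℝ => deriv lineCutoff q.2 * w (q.1 + q.2 • e))
      ((hyperplaneMeasure ν a).prod volume) :=
    (Integrable.comp_hyperplane hν a e he.ne hw).bdd_mul (c := C)
      (hcd.comp continuous_snd).aestronglyMeasurable (Filter.Eventually.of_forall fun q => hC _)
  have i2 : Integrable (fun q : 𝔼 × ℝ => lineCutoff q.2 * dirGrad G e (q.1 + q.2 • e))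
      ((hyperplaneMeasure ν a).prod volume) :=
    (Integrable.comp_hyperplane hν a e he.ne (integrable_dirGrad hG e)).bdd_mul (c := 1)
      (hcc.comp continuous_snd).aestronglyMeasurable
      (Filter.Eventually.of_forall fun q => abs_lineCutoff_le _)
  have i3 := (i1.add i2).mono_measure (Measure.prod_mono (le_refl (hyperplaneMeasure ν a))
    (Measure.restrict_le_self (μ := (volume : Measure ℝ)) (s := Ioc (0 : ℝ) 1)))
  exact i3.integral_prod_left.neg

/-- Green's formula for the trace along the direction `e`, near a point of the entering set. -/
theorem exists_ball_lineTrace {U : Set 𝔼} (hU : IsOpen U) {w : 𝔼 → ℝ} {G : Fin d → 𝔼 → ℝ}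
    (h : HasWeakGrad U w G) (hw : Integrable w) (hG : ∀ i, Integrable (G i)) {β : ℝ} (hβ : 0 < β)
    {e x : 𝔼} (hx : x ∈ enteringSet U β e) :
    ∃ ε > 0, faceSet U ∩ Metric.ball x ε ⊆ enteringSet U β e ∧
      IntegrableOn (lineTrace w G e) (Metric.ball x ε) (faceMeasure U) ∧
      ∀ φ : 𝔼 → ℝ, ContDiff ℝ ∞ φ → HasCompactSupport φ → tsupport φ ⊆ Metric.ball x ε →
        ∀ i : Fin d, ∫ y in U, (w y * partialDeriv i φ y + G i y * φ y) =
          ∫ y, lineTrace w G e y * φ y * outwardNormal U y i ∂(faceMeasure U) := by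
  obtain ⟨ν, hν, hβe, ε, hε, hb, hseg⟩ := exists_ball_enteringSet hU hβ hx
  have he : inner ℝ ν e < 0 := by linarith
  refine ⟨ε, hε, ?_, ?_, fun φ hφ hc hs i => ?_⟩
  · rintro y ⟨hyf, hy⟩
    have h0 := (mem_faceSet_iff_of_mem_ball hν.1 hb hy).1 hyf
    exact ⟨ν, IsHalfSpaceNear.of_mem_ball hν.1 hb hy h0, hβe, hseg y hy h0⟩
  · rw [IntegrableOn, faceMeasure_restrict_ball hν.1 hb]
    exact (integrable_lineTrace_hyperplane hw hG hν.1 x he).integrableOn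
  · rw [h.local_green hU hw hG hν.1 he hb hseg hφ hc hs i]
    have hφ0 : ∀ y ∉ Metric.ball x ε, φ y = 0 := fun y hy =>
      image_eq_zero_of_notMem_tsupport fun hh => hy (hs hh)
    rw [← setIntegral_eq_integral_of_forall_compl_eq_zero (s := Metric.ball x ε)
      (fun y hy => by rw [hφ0 y hy, mul_zero]),
      ← setIntegral_eq_integral_of_forall_compl_eq_zero (s := Metric.ball x ε)
      (μ := faceMeasure U) (fun y hy => by rw [hφ0 y hy, mul_zero, zero_mul]),
      ← integral_const_mul, ← faceMeasure_restrict_ball hν.1 hb]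
    refine integral_congr_ae ?_
    filter_upwards [ae_restrict_mem Metric.isOpen_ball.measurableSet,
      ae_restrict_of_ae (ae_mem_faceSet U)] with y hy hyf
    have h0 := (mem_faceSet_iff_of_mem_ball hν.1 hb hy).1 hyf
    rw [(IsHalfSpaceNear.of_mem_ball hν.1 hb hy h0).outwardNormal_eq]
    ring

theorem lineTrace_ae_eq {U : Set 𝔼} (hU : IsOpen U) {w : 𝔼 → ℝ} {G : Fin d → 𝔼 → ℝ}
    (h : HasWeakGrad U w G) (hw : Integrable w) (hG : ∀ i, Integrable (G i)) {β : ℝ} (hβ : 0 < β)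
    (e e' : 𝔼) : ∀ᵐ x ∂(faceMeasure U), x ∈ enteringSet U β e → x ∈ enteringSet U β e' →
      lineTrace w G e x = lineTrace w G e' x := by
  rw [ae_iff]
  refine measure_null_of_locally_null _ fun x hx => ?_
  simp only [mem_ofPred_eq, Classical.not_imp] at hx
  obtain ⟨hx1, hx2, -⟩ := hx
  obtain ⟨ε, hε, -, hi, hg⟩ := exists_ball_lineTrace hU h hw hG hβ hx1
  obtain ⟨ε', hε', -, hi', hg'⟩ := exists_ball_lineTrace hU h hw hG hβ hx2
  have hm : Metric.ball x (min ε ε') ⊆ Metric.ball x ε := Metric.ball_subset_ball (min_le_left _ _)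
  have hm' : Metric.ball x (min ε ε') ⊆ Metric.ball x ε' :=
    Metric.ball_subset_ball (min_le_right _ _)
  have := ae_eq_of_integral_mul_outwardNormal (U := U) Metric.isOpen_ball
    (hi.mono_set hm).locallyIntegrableOn (hi'.mono_set hm').locallyIntegrableOn
    (fun φ hφ hc hs i => by rw [← hg φ hφ hc (hs.trans hm) i, ← hg' φ hφ hc (hs.trans hm') i])
  rw [ae_iff] at this
  refine ⟨{y | ¬ (y ∈ Metric.ball x (min ε ε') → lineTrace w G e y = lineTrace w G e' y)},
    ?_, this⟩
  filter_upwards [self_mem_nhdsWithin, mem_nhdsWithin_of_mem_nhds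
    (Metric.ball_mem_nhds x (lt_min hε hε'))] with y hy hyb
  simp only [Classical.not_imp] at hy ⊢
  exact ⟨hyb, hy.2.2⟩

/-- A property of smooth functions with compact support that is additive and local holds for all
of them. -/
theorem smooth_induction_on_balls {P : (𝔼 → ℝ) → Prop} {φ : 𝔼 → ℝ} (hφ : ContDiff ℝ ∞ φ)
    (hc : HasCompactSupport φ) (h0 : P 0)
    (hadd : ∀ f g : 𝔼 → ℝ, ContDiff ℝ ∞ f → ContDiff ℝ ∞ g → tsupport f ⊆ tsupport φ →
      tsupport g ⊆ tsupport φ → P f → P g → P (f + g))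
    (hloc : ∀ x ∈ tsupport φ, ∃ r > 0, ∀ f : 𝔼 → ℝ, ContDiff ℝ ∞ f → tsupport f ⊆ tsupport φ →
      tsupport f ⊆ Metric.ball x r → P f) : P φ := by
  classical
  choose r hr hP using fun x : tsupport φ => hloc x x.2
  obtain ⟨f, hf⟩ := SmoothPartitionOfUnity.exists_isSubordinate (modelWithCornersSelf ℝ (EuclideanSpace ℝ (Fin d)))
    (isClosed_tsupport φ) (fun x : tsupport φ => Metric.ball (x : 𝔼) (r x))
    (fun x => Metric.isOpen_ball)
    (fun x hx => mem_iUnion.2 ⟨⟨x, hx⟩, Metric.mem_ball_self (hr _)⟩)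
  have hfin := f.locallyFinite.finite_nonempty_inter_compact hc
  set T := hfin.toFinset with hT
  have hsm : ∀ x, ContDiff ℝ ∞ (fun y => f x y * φ y) := fun x =>
    ((f x).contMDiff.contDiff).mul hφ
  have hsum : φ = ∑ x ∈ T, fun y => f x y * φ y := by
    funext y
    rw [Finset.sum_apply, ← Finset.sum_mul]
    by_cases hy : y ∈ tsupport φ
    · have h1 := f.sum_eq_one hy
      rw [finsum_eq_sum_of_support_subset (s := T)] at h1
      · rw [h1, one_mul]
      · intro x hx
        rw [hT, hfin.coe_toFinset]
        exact ⟨y, hx, hy⟩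
    · rw [image_eq_zero_of_notMem_tsupport hy, mul_zero]
  have hts : ∀ x, tsupport (fun y => f x y * φ y) ⊆ tsupport φ := fun x =>
    closure_mono (Function.support_mul_subset_right (f x) φ)
  have hP' : ∀ x, P (fun y => f x y * φ y) := fun x =>
    hP x _ (hsm x) (hts x)
      ((closure_mono (Function.support_mul_subset_left (f x) φ)).trans (hf x))
  have key : ∀ T : Finset (tsupport φ), ContDiff ℝ ∞ (∑ x ∈ T, fun y => f x y * φ y) ∧
      tsupport (∑ x ∈ T, fun y => f x y * φ y) ⊆ tsupport φ ∧
      P (∑ x ∈ T, fun y => f x y * φ y) := by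
    intro T
    induction T using Finset.induction_on with
    | empty => simpa using ⟨contDiff_const, h0⟩
    | insert x T hx ih =>
      rw [Finset.sum_insert hx]
      refine ⟨(hsm x).add ih.1, (tsupport_add _ _).trans (union_subset (hts x) ih.2.1),
        hadd _ _ (hsm x) ih.1 (hts x) ih.2.1 (hP' x) ih.2.2⟩
  rw [hsum]
  exact (key T).2.2

theorem eLpNorm_restrict_biUnion_le {X ι : Type*} [MeasurableSpace X] {μ : Measure X}
    (E : Finset ι) {A : ι → Set X} (hA : ∀ i ∈ E, MeasurableSet (A i)) {f : X → ℝ}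
    (hf : AEStronglyMeasurable f μ) {p : ℝ≥0∞} (hp : 1 ≤ p) :
    eLpNorm f p (μ.restrict (⋃ i ∈ E, A i)) ≤ ∑ i ∈ E, eLpNorm f p (μ.restrict (A i)) := by
  classical
  induction E using Finset.induction_on with
  | empty => simp
  | insert i E hi ih =>
    rw [Finset.sum_insert hi, Finset.set_biUnion_insert]
    have hm : ∀ j ∈ E, MeasurableSet (A j) := fun j hj => hA j (Finset.mem_insert_of_mem hj)
    exact (eLpNorm_restrict_union_le (hA i (Finset.mem_insert_self _ _))
      (Finset.measurableSet_biUnion _ hm) hf.restrict hf.restrict hp).trans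
      (add_le_add le_rfl (ih hm))

theorem eLpNorm_sum_abs_le {μ : Measure 𝔼} {w : 𝔼 → ℝ} {G : Fin d → 𝔼 → ℝ}
    (hw : AEStronglyMeasurable w μ) (hG : ∀ i, AEStronglyMeasurable (G i) μ) {a b : ℝ} (ha : 0 ≤ a)
    (hb : 0 ≤ b) {p : ℝ≥0∞} (hp : 1 ≤ p) :
    eLpNorm (fun x => a * |w x| + b * ∑ i, |G i x|) p μ ≤
      ENNReal.ofReal a * eLpNorm w p μ + ENNReal.ofReal b * ∑ i, eLpNorm (G i) p μ := by
  have hw' : AEStronglyMeasurable (fun x => |w x|) μ := hw.norm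
  have hG' : ∀ i, AEStronglyMeasurable (fun x => |G i x|) μ := fun i => (hG i).norm
  have e1 : (fun x => a * |w x| + b * ∑ i, |G i x|) =
      (a • fun x => |w x|) + (b • ∑ i, fun x => |G i x|) := by
    funext x; simp [Finset.sum_apply]
  rw [e1]
  refine (eLpNorm_add_le (hw'.const_smul a) ((Finset.aestronglyMeasurable_sum _ fun i _ =>
    hG' i).const_smul b) hp).trans ?_
  rw [eLpNorm_const_smul, eLpNorm_const_smul, Real.enorm_of_nonneg ha, Real.enorm_of_nonneg hb]
  gcongr
  · exact (eLpNorm_norm w).le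
  · refine (eLpNorm_sum_le (fun i _ => hG' i) hp).trans (Finset.sum_le_sum fun i _ => ?_)
    exact (eLpNorm_norm (G i)).le

theorem eLpNorm_lineTrace_le {U : Set 𝔼} (hU : IsOpen U) {β : ℝ} (hβ : 0 < β) {C : ℝ} (hC1 : 1 ≤ C)
    (hC : ∀ t, |deriv lineCutoff t| ≤ C) {w : 𝔼 → ℝ} {G : Fin d → 𝔼 → ℝ}
    (hw : Measurable w) (hG : ∀ i, Measurable (G i)) (e : 𝔼) {p : ℝ≥0∞} (hp : 1 ≤ p) :
    eLpNorm (lineTrace w G e) p ((faceMeasure U).restrict (enteringSet U β e)) ≤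
      ENNReal.ofReal β⁻¹ ^ (1 / p).toReal *
        (ENNReal.ofReal C * eLpNorm w p (volume.restrict U) +
          ENNReal.ofReal ‖e‖ * ∑ i, eLpNorm (G i) p (volume.restrict U)) := by
  let f : 𝔼 → ℝ := fun x => C * |w x| + ‖e‖ * ∑ i, |G i x|
  have hC0 : 0 ≤ C := by linarith
  have hf0 : ∀ x, 0 ≤ f x := fun x => by positivity
  have hf : Measurable f :=
    (hw.abs.const_mul C).add ((Finset.measurable_sum _ fun i _ => (hG i).abs).const_mul _)
  have hΨ : Measurable (fun q : 𝔼 × ℝ => q.1 + q.2 • e) := Continuous.measurable (by fun_prop)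
  refine (eLpNorm_le_of_map_prod_le hΨ ?_ (map_enteringSet_le hU hβ e) hf ?_ hp).trans ?_
  · rw [Ne, ENNReal.ofReal_eq_zero, not_le]; positivity
  · refine Filter.Eventually.of_forall fun x => ?_
    rw [lineTrace, enorm_neg]
    refine (enorm_integral_le_lintegral_enorm _).trans (lintegral_mono fun t => ?_)
    rw [enorm_le_iff_norm_le, Real.norm_of_nonneg (hf0 _)]
    refine (norm_add_le _ _).trans (add_le_add ?_ ?_)
    · rw [norm_mul]
      exact mul_le_mul_of_nonneg_right (hC t) (abs_nonneg _)
    · rw [norm_mul]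
      exact (mul_le_of_le_one_left (norm_nonneg _) (abs_lineCutoff_le t)).trans
        (abs_dirGrad_le G e _)
  · gcongr
    exact eLpNorm_sum_abs_le hw.aestronglyMeasurable (fun i => (hG i).aestronglyMeasurable) hC0
      (norm_nonneg e) hp

open Classical in
/-- The trace obtained by integrating along one of the directions entering `U`. -/
def glueTrace (U : Set 𝔼) (β : ℝ) (E : Finset 𝔼) (w : 𝔼 → ℝ) (G : Fin d → 𝔼 → ℝ) (x : 𝔼) : ℝ :=
  if h : ∃ e ∈ E, x ∈ enteringSet U β e then lineTrace w G h.choose x else 0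

theorem glueTrace_ae_eq {U : Set 𝔼} (hU : IsOpen U) {w : 𝔼 → ℝ} {G : Fin d → 𝔼 → ℝ}
    (h : HasWeakGrad U w G) (hw : Integrable w) (hG : ∀ i, Integrable (G i)) {β : ℝ} (hβ : 0 < β)
    (E : Finset 𝔼) : ∀ᵐ x ∂(faceMeasure U), ∀ e ∈ E, x ∈ enteringSet U β e →
      glueTrace U β E w G x = lineTrace w G e x := by
  have key : ∀ᵐ x ∂(faceMeasure U), ∀ e ∈ E, ∀ e' ∈ E, x ∈ enteringSet U β e →
      x ∈ enteringSet U β e' → lineTrace w G e x = lineTrace w G e' x := by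
    refine (Filter.eventually_all_finset E).2 fun e _ => (Filter.eventually_all_finset E).2 fun e' _ => ?_
    exact lineTrace_ae_eq hU h hw hG hβ e e'
  filter_upwards [key] with x hx e he hxe
  have hex : ∃ e ∈ E, x ∈ enteringSet U β e := ⟨e, he, hxe⟩
  rw [glueTrace, dif_pos hex]
  exact hx _ hex.choose_spec.1 e he hex.choose_spec.2 hxe

/-- The glued function satisfies Green's formula. -/
theorem glueTrace_green {U : Set 𝔼} (hU : IsOpen U) {w : 𝔼 → ℝ} {G : Fin d → 𝔼 → ℝ}
    (h : HasWeakGrad U w G) (hw : Integrable w) (hG : ∀ i, Integrable (G i)) {β : ℝ} (hβ : 0 < β)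
    {E : Finset 𝔼} (hE : ∀ x ∈ faceSet U, ∃ e ∈ E, x ∈ enteringSet U β e) :
    LocallyIntegrableOn (glueTrace U β E w G) (faceSet U)
      (Measure.euclideanHausdorffMeasure (d - 1)) ∧
    ∀ φ : 𝔼 → ℝ, ContDiff ℝ ∞ φ → HasCompactSupport φ → tsupport φ ∩ frontier U ⊆ faceSet U →
      ∀ i : Fin d, ∫ y in U, (w y * partialDeriv i φ y + G i y * φ y) =
        ∫ y, glueTrace U β E w G y * φ y * outwardNormal U y i ∂(faceMeasure U) := by
  have hae := glueTrace_ae_eq hU h hw hG hβ E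
  set g := glueTrace U β E w G with hg
  have hloc : LocallyIntegrableOn g (faceSet U) (Measure.euclideanHausdorffMeasure (d - 1)) := by
    intro x hx
    obtain ⟨e, he, hxe⟩ := hE x hx
    obtain ⟨ε, hε, hsub, hi, -⟩ := exists_ball_lineTrace hU h hw hG hβ hxe
    refine ⟨Metric.ball x ε ∩ faceSet U,
      Filter.inter_mem (mem_nhdsWithin_of_mem_nhds (Metric.ball_mem_nhds x hε))
        self_mem_nhdsWithin, ?_⟩
    rw [IntegrableOn, ← Measure.restrict_restrict Metric.isOpen_ball.measurableSet,
      ← faceMeasure_eq]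
    refine hi.congr ?_
    filter_upwards [ae_restrict_of_ae hae, ae_restrict_of_ae (ae_mem_faceSet U),
      ae_restrict_mem Metric.isOpen_ball.measurableSet] with y hy hyf hyb
    exact (hy e he (hsub ⟨hyf, hyb⟩)).symm
  refine ⟨hloc, fun φ hφ hc hs i => ?_⟩
  have hVs : tsupport φ ⊆ (frontier U \ faceSet U)ᶜ := fun x hx hx' => hx'.2 (hs ⟨hx, hx'.1⟩)
  have hlV := LocallyIntegrableOn.compl_frontier_diff hloc
  have intL : ∀ f : 𝔼 → ℝ, ContDiff ℝ ∞ f → HasCompactSupport f →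
      Integrable (fun y => w y * partialDeriv i f y + G i y * f y) (volume.restrict U) := by
    intro f hf hfc
    have i1 := (hw.locallyIntegrable.locallyIntegrableOn univ).integrable_mul_of_tsupport
      (contDiff_partialDeriv i hf).continuous (hasCompactSupport_partialDeriv i hfc)
      (subset_univ _)
    have i2 := ((hG i).locallyIntegrable.locallyIntegrableOn univ).integrable_mul_of_tsupport
      hf.continuous hfc (subset_univ _)
    exact (i1.add i2).restrict
  have intR : ∀ f : 𝔼 → ℝ, ContDiff ℝ ∞ f → HasCompactSupport f → tsupport f ⊆ tsupport φ →
      Integrable (fun y => g y * f y * outwardNormal U y i) (faceMeasure U) := by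
    intro f hf hfc hfs
    exact integrable_mul_outwardNormal
      (hlV.integrable_mul_of_tsupport hf.continuous hfc (hfs.trans hVs)) i
  have hcs : ∀ f : 𝔼 → ℝ, tsupport f ⊆ tsupport φ → HasCompactSupport f := fun f hf =>
    hc.of_isClosed_subset (isClosed_tsupport f) hf
  refine smooth_induction_on_balls (P := fun f =>
    ∫ y in U, (w y * partialDeriv i f y + G i y * f y) =
        ∫ y, g y * f y * outwardNormal U y i ∂(faceMeasure U)) hφ hc ?_ ?_ ?_
  · simp [partialDeriv]
  · intro f₁ f₂ hf₁ hf₂ hs₁ hs₂ h₁ h₂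
    have e1 : ∀ y, w y * partialDeriv i (f₁ + f₂) y + G i y * (f₁ + f₂) y =
        (w y * partialDeriv i f₁ y + G i y * f₁ y) + (w y * partialDeriv i f₂ y + G i y * f₂ y) := by
      intro y
      have : partialDeriv i (f₁ + f₂) y = partialDeriv i f₁ y + partialDeriv i f₂ y := by
        unfold partialDeriv
        rw [fderiv_add (hf₁.differentiable (by simp) y) (hf₂.differentiable (by simp) y)]
        rfl
      rw [this, Pi.add_apply]; ring
    have e2 : ∀ y, g y * (f₁ + f₂) y * outwardNormal U y i =
        g y * f₁ y * outwardNormal U y i + g y * f₂ y * outwardNormal U y i := by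
      intro y; rw [Pi.add_apply]; ring
    simp only [e1, e2]
    rw [integral_add (intL f₁ hf₁ (hcs f₁ hs₁)) (intL f₂ hf₂ (hcs f₂ hs₂)),
      integral_add (intR f₁ hf₁ (hcs f₁ hs₁) hs₁) (intR f₂ hf₂ (hcs f₂ hs₂) hs₂), h₁, h₂]
  · intro x hx
    have hzero : ∀ f : 𝔼 → ℝ, (∀ y ∈ frontier U, f y = 0) →
        ∫ y, g y * f y * outwardNormal U y i ∂(faceMeasure U) = 0 := by
      intro f hf
      refine integral_eq_zero_of_ae ?_
      filter_upwards [ae_mem_faceSet U] with y hy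
      rw [hf y (faceSet_subset_frontier U hy)]; simp
    by_cases hxU : x ∈ U
    · obtain ⟨r, hr, hrU⟩ := Metric.isOpen_iff.1 hU x hxU
      refine ⟨r, hr, fun f hf hfs hfb => ?_⟩
      have hfU : tsupport f ⊆ U := hfb.trans hrU
      rw [hzero f fun y hy => image_eq_zero_of_notMem_tsupport fun hh => by
        rw [hU.frontier_eq] at hy; exact hy.2 (hfU hh)]
      have e := h.integral_partialDeriv hf (hcs f hfs) hfU i
      rw [setIntegral_eq_integral_of_forall_compl_eq_zero fun y hy => by
        rw [image_eq_zero_of_notMem_tsupport fun hh => hy (hfU hh),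
          image_eq_zero_of_notMem_tsupport fun hh => hy (hfU (tsupport_partialDeriv i f hh))]
        simp]
      have i1 := (hw.locallyIntegrable.locallyIntegrableOn univ).integrable_mul_of_tsupport
        (contDiff_partialDeriv i hf).continuous (hasCompactSupport_partialDeriv i (hcs f hfs))
        (subset_univ _)
      have i2 := ((hG i).locallyIntegrable.locallyIntegrableOn univ).integrable_mul_of_tsupport
        hf.continuous (hcs f hfs) (subset_univ _)
      rw [integral_add i1 i2, e]; ring
    by_cases hxc : x ∈ closure U
    · have hxf : x ∈ faceSet U := hs ⟨hx, by rw [hU.frontier_eq]; exact ⟨hxc, hxU⟩⟩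
      obtain ⟨e, he, hxe⟩ := hE x hxf
      obtain ⟨ε, hε, hsub, -, hgr⟩ := exists_ball_lineTrace hU h hw hG hβ hxe
      refine ⟨ε, hε, fun f hf hfs hfb => ?_⟩
      rw [hgr f hf (hcs f hfs) hfb i]
      refine integral_congr_ae ?_
      filter_upwards [hae, ae_mem_faceSet U] with y hy hyf
      by_cases hyb : y ∈ Metric.ball x ε
      · rw [hy e he (hsub ⟨hyf, hyb⟩)]
      · rw [image_eq_zero_of_notMem_tsupport fun hh => hyb (hfb hh)]; simp
    · obtain ⟨r, hr, hrU⟩ := Metric.isOpen_iff.1 isClosed_closure.isOpen_compl x hxc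
      refine ⟨r, hr, fun f hf hfs hfb => ?_⟩
      have hfU : tsupport f ⊆ (closure U)ᶜ := hfb.trans hrU
      rw [hzero f fun y hy => image_eq_zero_of_notMem_tsupport fun hh =>
        hfU hh (frontier_subset_closure hy)]
      refine setIntegral_eq_zero_of_forall_eq_zero fun y hy => ?_
      rw [image_eq_zero_of_notMem_tsupport fun hh => hfU hh (subset_closure hy),
        image_eq_zero_of_notMem_tsupport fun hh =>
          hfU (tsupport_partialDeriv i f hh) (subset_closure hy)]
      simp

/-- Existence of the trace, with a bound, for a domain whose faces are entered by finitely many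
directions. -/
theorem HasWeakGrad.exists_isTrace {U : Set 𝔼} (hU : IsOpen U) {w : 𝔼 → ℝ} {G : Fin d → 𝔼 → ℝ}
    (h : HasWeakGrad U w G) (hw : IntegrableOn w U) (hG : ∀ i, IntegrableOn (G i) U) {β : ℝ}
    (hβ : 0 < β) {E : Finset 𝔼} (hE : ∀ x ∈ faceSet U, ∃ e ∈ E, x ∈ enteringSet U β e)
    {C : ℝ} (hC1 : 1 ≤ C) (hC : ∀ t, |deriv lineCutoff t| ≤ C) :
    ∃ g, IsTrace U w g ∧ ∀ p : ℝ≥0∞, 1 ≤ p → eLpNorm g p (faceMeasure U) ≤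
      ∑ e ∈ E, ENNReal.ofReal β⁻¹ ^ (1 / p).toReal *
        (ENNReal.ofReal C * eLpNorm w p (volume.restrict U) +
          ENNReal.ofReal ‖e‖ * ∑ i, eLpNorm (G i) p (volume.restrict U)) := by
  obtain ⟨w', hwm, hwi, -, hww⟩ := exists_measurable_integrable_rep hU.measurableSet hw
  choose G' hGm hGi hG0 hGG using fun i => exists_measurable_integrable_rep hU.measurableSet (hG i)
  have h' : HasWeakGrad U w' G' := h.congr hU hww hGG
  obtain ⟨hl, hgr⟩ := glueTrace_green hU h' hwi hGi hβ hE
  have hae := glueTrace_ae_eq hU h' hwi hGi hβ E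
  refine ⟨glueTrace U β E w' G', ⟨?_, fun φ hφ hc hs i => ?_⟩, fun p hp => ?_⟩
  · rwa [sUnion_hyperplanarFaces]
  · rw [sUnion_hyperplanarFaces] at hs
    rw [← hgr φ hφ hc hs i]
    refine integral_congr_ae ?_
    filter_upwards [hww, hGG i, (h i).weakDeriv_ae_eq hU] with y h1 h2 h3
    rw [h3, h1, h2, partialDeriv]
  · have hm : AEStronglyMeasurable (glueTrace U β E w' G') (faceMeasure U) := by
      rw [faceMeasure_eq]; exact hl.aestronglyMeasurable
    have hres : faceMeasure U = (faceMeasure U).restrict (⋃ e ∈ E, enteringSet U β e) := by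
      refine (Measure.restrict_eq_self_of_ae_mem ?_).symm
      filter_upwards [ae_mem_faceSet U] with x hx
      obtain ⟨e, he, hxe⟩ := hE x hx
      exact mem_biUnion (Finset.mem_coe.2 he) hxe
    rw [hres]
    refine (eLpNorm_restrict_biUnion_le E (fun e _ => measurableSet_enteringSet hU hβ e) hm
      hp).trans (Finset.sum_le_sum fun e he => ?_)
    rw [eLpNorm_congr_ae hww]
    simp only [eLpNorm_congr_ae (hGG _)]
    refine le_trans (eLpNorm_congr_ae ?_).le (eLpNorm_lineTrace_le hU hβ hC1 hC hwm hGm e hp)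
    filter_upwards [ae_restrict_of_ae hae, ae_restrict_mem (measurableSet_enteringSet hU hβ e)]
      with y hy hye
    exact hy e he hye

/-- A convex subset of `closure U` containing a face point lies on the inner side of the face. -/
theorem IsHalfSpaceNear.inner_nonpos {U : Set 𝔼} {ν x : 𝔼} (h : IsHalfSpaceNear U ν x) {A : Set 𝔼}
    (hA : Convex ℝ A) (hAU : A ⊆ closure U) (hx : x ∈ A) {y : 𝔼} (hy : y ∈ A) :
    inner ℝ ν (y - x) ≤ 0 := by
  obtain ⟨hν, ε, hε, hb⟩ := h
  obtain ⟨t, ht, htb⟩ := exists_small_smul (x := x) (z := y - x) hε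
  set t' := min t 1 with ht'
  have ht'0 : 0 < t' := lt_min ht one_pos
  have hmem : x + t' • (y - x) ∈ A := hA.add_smul_sub_mem hx hy ⟨ht'0.le, min_le_right _ _⟩
  have hball : x + t' • (y - x) ∈ Metric.ball x ε := by
    rw [mem_ball_iff_norm, add_sub_cancel_left, norm_smul, Real.norm_of_nonneg] at htb ⊢
    · exact (mul_le_mul_of_nonneg_right (min_le_left _ _) (norm_nonneg _)).trans_lt htb
    · exact ht'0.le
    · exact ht.le
  by_contra hpos
  rw [not_le] at hpos
  obtain ⟨u, hu, huU⟩ := mem_closure_iff.1 (hAU hmem)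
    (Metric.ball x ε ∩ {u | 0 < inner ℝ ν (u - x)})
    (Metric.isOpen_ball.inter (isOpen_lt continuous_const (by fun_prop)))
    ⟨hball, by
      change 0 < inner ℝ ν (x + t' • (y - x) - x)
      rw [add_sub_cancel_left, inner_smul_right]; positivity⟩
  have := (hb u hu.1).1 huU
  have h2 : 0 < inner ℝ ν (u - x) := hu.2
  linarith

namespace IsRegularPolytope

variable {ρ : ℝ} {U : Set (EuclideanSpace ℝ (Fin d))}
  {𝒮 : Finset (Finset (EuclideanSpace ℝ (Fin d)))}

theorem mem_enteringSet (h : IsRegularPolytope ρ U 𝒮) {S : Finset 𝔼} (hS : S ∈ 𝒮) {c x z : 𝔼}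
    (hc : Metric.ball c (radius ρ U) ⊆ convexHull ℝ (S : Set 𝔼)) (hx : x ∈ faceSet U)
    (hxS : x ∈ convexHull ℝ (S : Set 𝔼)) (hz : dist x z ≤ radius ρ U / 4) :
    x ∈ enteringSet U (radius ρ U / 2) (c - z) := by
  have hr := h.radius_pos
  obtain ⟨ν, hν⟩ := hx
  have hconv := convex_convexHull ℝ (S : Set 𝔼)
  have hxz : ‖x - z‖ ≤ radius ρ U / 4 := by rwa [← dist_eq_norm]
  refine ⟨ν, hν, ?_, fun t ht => ?_⟩
  · have hy : c + (3 * radius ρ U / 4) • ν ∈ convexHull ℝ (S : Set 𝔼) := by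
      refine hc ?_
      rw [mem_ball_iff_norm, add_sub_cancel_left, norm_smul, hν.1, mul_one,
        Real.norm_of_nonneg (by positivity)]
      linarith
    have h1 := hν.inner_nonpos hconv (h.convexHull_subset hS) hxS hy
    have e1 : c + (3 * radius ρ U / 4) • ν - x = (c - z) - (x - z) + (3 * radius ρ U / 4) • ν := by
      abel
    rw [e1, inner_add_right, inner_sub_right, inner_smul_right, real_inner_self_eq_norm_sq,
      hν.1] at h1
    have h2 : inner ℝ ν (x - z) ≤ radius ρ U / 4 := by
      refine (real_inner_le_norm _ _).trans ?_
      rw [hν.1, one_mul]; exact hxz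
    linarith
  · have hy : c + (x - z) ∈ interior (convexHull ℝ (S : Set 𝔼)) := by
      refine ball_subset_interior hc ?_
      rw [mem_ball_iff_norm, add_sub_cancel_left]
      linarith
    have := hconv.add_smul_sub_mem_interior hxS hy ht
    have e1 : x + t • (c + (x - z) - x) = x + t • (c - z) := by congr 2; abel
    rw [e1] at this
    exact h.interior_convexHull_subset hS this

end IsRegularPolytope

/-- The faces of a regular polytope are entered by a controlled number of directions. -/
theorem exists_card_directions (d : ℕ) {ρ : ℝ} (hρ : 0 < ρ) :
    ∃ M : ℕ, ∀ (U : Set (EuclideanSpace ℝ (Fin d)))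
      (𝒮 : Finset (Finset (EuclideanSpace ℝ (Fin d)))), IsRegularPolytope ρ U 𝒮 →
      ∃ E : Finset (EuclideanSpace ℝ (Fin d)), E.card ≤ M ∧ (∀ e ∈ E, ‖e‖ ≤ 2 * Metric.diam U) ∧
        ∀ x ∈ faceSet U, ∃ e ∈ E,
          x ∈ enteringSet U (IsRegularPolytope.radius ρ U / 2) e := by
  classical
  obtain ⟨T, hT1, hTfin, hT⟩ := Metric.finite_approx_of_totallyBounded
    (isCompact_closedBall (0 : EuclideanSpace ℝ (Fin d)) 1).totallyBounded (ρ ^ 2 / 8)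
    (by positivity)
  refine ⟨⌊(2 / ρ ^ 2) ^ d⌋₊ * hTfin.toFinset.card, fun U 𝒮 h => ?_⟩
  have hdiam := h.diam_pos
  obtain ⟨x₀, hx₀⟩ := h.isConnected.nonempty
  have hx₀' := subset_closure hx₀
  choose! c hc using fun (S : Finset (EuclideanSpace ℝ (Fin d))) (hS : S ∈ 𝒮) =>
    h.exists_ball_subset hS
  refine ⟨Finset.image₂ (fun S z => c S - (x₀ + Metric.diam U • z)) 𝒮 hTfin.toFinset, ?_, ?_, ?_⟩
  · refine (Finset.card_image₂_le _ _ _).trans (Nat.mul_le_mul_right _ ?_)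
    exact Nat.le_floor h.card_le
  · intro e he
    obtain ⟨S, hS, z, hz, rfl⟩ := Finset.mem_image₂.1 he
    have hcU : c S ∈ closure U :=
      h.convexHull_subset hS (hc S hS (Metric.mem_ball_self h.radius_pos))
    have h1 : ‖c S - x₀‖ ≤ Metric.diam U := by
      rw [← dist_eq_norm]; exact h.dist_le_diam hcU hx₀'
    have h2 : ‖z‖ ≤ 1 := by simpa using hT1 (hTfin.mem_toFinset.1 hz)
    calc ‖c S - (x₀ + Metric.diam U • z)‖ = ‖(c S - x₀) - Metric.diam U • z‖ := by
          congr 1; abel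
      _ ≤ ‖c S - x₀‖ + ‖Metric.diam U • z‖ := norm_sub_le _ _
      _ ≤ Metric.diam U + Metric.diam U * 1 := by
          rw [norm_smul, Real.norm_of_nonneg hdiam.le]; gcongr
      _ = 2 * Metric.diam U := by ring
  · intro x hx
    have hxc : x ∈ closure U := frontier_subset_closure (faceSet_subset_frontier U hx)
    obtain ⟨S, hS, hxS⟩ := h.exists_mem hxc
    have hu : (Metric.diam U)⁻¹ • (x - x₀) ∈ Metric.closedBall
        (0 : EuclideanSpace ℝ (Fin d)) 1 := by
      rw [mem_closedBall_zero_iff, norm_smul, norm_inv, Real.norm_of_nonneg hdiam.le,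
        inv_mul_le_one₀ hdiam, ← dist_eq_norm]
      exact h.dist_le_diam hxc hx₀'
    obtain ⟨z, hz, hzx⟩ := mem_iUnion₂.1 (hT hu)
    refine ⟨_, Finset.mem_image₂.2 ⟨S, hS, z, hTfin.mem_toFinset.2 hz, rfl⟩,
      h.mem_enteringSet hS (hc S hS) hx hxS ?_⟩
    have e1 : x - (x₀ + Metric.diam U • z) =
        Metric.diam U • ((Metric.diam U)⁻¹ • (x - x₀) - z) := by
      rw [smul_sub, smul_inv_smul₀ hdiam.ne']; abel
    rw [dist_eq_norm, e1, norm_smul, Real.norm_of_nonneg hdiam.le]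
    rw [mem_ball_iff_norm] at hzx
    calc Metric.diam U * ‖(Metric.diam U)⁻¹ • (x - x₀) - z‖ ≤ Metric.diam U * (ρ ^ 2 / 8) := by
          gcongr
      _ = IsRegularPolytope.radius ρ U / 4 := by unfold IsRegularPolytope.radius; ring

/-- The trace inequality on regular polytopes. -/
theorem exists_trace_const (d : ℕ) {ρ : ℝ} (hρ : 0 < ρ) :
    ∃ K : ℝ, 0 < K ∧ ∀ (U : Set (EuclideanSpace ℝ (Fin d)))
      (𝒮 : Finset (Finset (EuclideanSpace ℝ (Fin d)))), IsRegularPolytope ρ U 𝒮 →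
      ∀ (w : EuclideanSpace ℝ (Fin d) → ℝ) (G : Fin d → EuclideanSpace ℝ (Fin d) → ℝ),
      HasWeakGrad U w G → IntegrableOn w U → (∀ i, IntegrableOn (G i) U) →
      ∃ g, IsTrace U w g ∧ ∀ p : ℝ≥0∞, 1 ≤ p →
        ENNReal.ofReal (Metric.diam U) ^ (1 / p).toReal * eLpNorm g p (faceMeasure U) ≤
          ENNReal.ofReal K * (eLpNorm w p (volume.restrict U) +
            ENNReal.ofReal (Metric.diam U) * ∑ i, eLpNorm (G i) p (volume.restrict U)) := by
  obtain ⟨M, hM⟩ := exists_card_directions d hρ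
  obtain ⟨C, hC1, hC⟩ := exists_deriv_lineCutoff_bound
  have hC0 : 0 < C := by linarith
  set Q : ℝ := 1 + 4 / ρ ^ 2 with hQ
  have hQ1 : 1 ≤ Q := by rw [hQ]; have : 0 < 4 / ρ ^ 2 := by positivity
                         linarith
  refine ⟨(M + 1) * (Q * (C + 2)), by positivity, fun U 𝒮 h w G hwG hw hG => ?_⟩
  obtain ⟨E, hEM, hEn, hE⟩ := hM U 𝒮 h
  have hr := h.radius_pos
  have hdiam := h.diam_pos
  obtain ⟨g, hg, hgb⟩ := hwG.exists_isTrace h.isOpen hw hG (half_pos hr) hE hC1 hC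
  refine ⟨g, hg, fun p hp => ?_⟩
  have ha1 : (1 / p).toReal ≤ 1 := by
    refine ENNReal.toReal_le_of_le_ofReal zero_le_one ?_
    rw [ENNReal.ofReal_one, one_div]
    exact ENNReal.inv_le_one.2 hp
  have ha0 : 0 ≤ (1 / p).toReal := ENNReal.toReal_nonneg
  set W := eLpNorm w p (volume.restrict U)
  set S := ∑ i, eLpNorm (G i) p (volume.restrict U)
  set D := ENNReal.ofReal (Metric.diam U) with hD
  have hscale : D ^ (1 / p).toReal *
      ENNReal.ofReal (IsRegularPolytope.radius ρ U / 2)⁻¹ ^ (1 / p).toReal ≤ ENNReal.ofReal Q := by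
    rw [← ENNReal.mul_rpow_of_nonneg _ _ ha0, hD, ← ENNReal.ofReal_mul hdiam.le]
    have e1 : Metric.diam U * (IsRegularPolytope.radius ρ U / 2)⁻¹ = 4 / ρ ^ 2 := by
      unfold IsRegularPolytope.radius; field_simp; norm_num
    rw [e1]
    have hle : (1 : ℝ≥0∞) ≤ ENNReal.ofReal Q := by
      rw [← ENNReal.ofReal_one]; exact ENNReal.ofReal_le_ofReal hQ1
    calc ENNReal.ofReal (4 / ρ ^ 2) ^ (1 / p).toReal ≤ ENNReal.ofReal Q ^ (1 / p).toReal := by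
          refine ENNReal.rpow_le_rpow (ENNReal.ofReal_le_ofReal ?_) ha0
          rw [hQ]; linarith
      _ ≤ ENNReal.ofReal Q ^ (1 : ℝ) := ENNReal.rpow_le_rpow_of_exponent_le hle ha1
      _ = ENNReal.ofReal Q := ENNReal.rpow_one _
  have hterm : ∀ e ∈ E, D ^ (1 / p).toReal *
      (ENNReal.ofReal (IsRegularPolytope.radius ρ U / 2)⁻¹ ^ (1 / p).toReal *
        (ENNReal.ofReal C * W + ENNReal.ofReal ‖e‖ * S)) ≤
      ENNReal.ofReal (Q * (C + 2)) * (W + D * S) := by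
    intro e he
    rw [← mul_assoc, ENNReal.ofReal_mul (by linarith), mul_assoc (ENNReal.ofReal Q)]
    refine mul_le_mul' hscale ?_
    rw [mul_add, ← mul_assoc]
    have h2 : ENNReal.ofReal ‖e‖ ≤ ENNReal.ofReal (C + 2) * D := by
      rw [hD, ← ENNReal.ofReal_mul (by linarith)]
      refine ENNReal.ofReal_le_ofReal ((hEn e he).trans ?_)
      gcongr; linarith
    gcongr
    linarith
  calc D ^ (1 / p).toReal * eLpNorm g p (faceMeasure U)
      ≤ D ^ (1 / p).toReal * _ := by gcongr; exact hgb p hp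
    _ = ∑ e ∈ E, _ := Finset.mul_sum _ _ _
    _ ≤ ∑ _e ∈ E, ENNReal.ofReal (Q * (C + 2)) * (W + D * S) := Finset.sum_le_sum hterm
    _ = (E.card : ℝ≥0∞) * (ENNReal.ofReal (Q * (C + 2)) * (W + D * S)) := by
        rw [Finset.sum_const, nsmul_eq_mul]
    _ ≤ ENNReal.ofReal ((M : ℝ) + 1) * (ENNReal.ofReal (Q * (C + 2)) * (W + D * S)) := by
        gcongr
        rw [← ENNReal.ofReal_natCast]
        refine ENNReal.ofReal_le_ofReal ?_
        have : (E.card : ℝ) ≤ M := by exact_mod_cast hEM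
        linarith
    _ = _ := by rw [← mul_assoc, ← ENNReal.ofReal_mul (by positivity)]

theorem contDiff_polyEval (q : MvPolynomial (Fin d) ℝ) : ContDiff ℝ ∞ (polyEval q) := by
  induction q using MvPolynomial.induction_on with
  | C a =>
    have : polyEval (MvPolynomial.C a) = fun _ : 𝔼 => a := by funext x; simp [polyEval]
    rw [this]; exact contDiff_const
  | add p q hp hq =>
    have : polyEval (p + q) = fun x => polyEval p x + polyEval q x := by
      funext x; simp [polyEval]
    rw [this]; exact hp.add hq
  | mul_X p i hp =>
    have : polyEval (p * MvPolynomial.X i) = fun x : 𝔼 => polyEval p x * x i := by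
      funext x; simp [polyEval]
    rw [this]
    exact hp.mul (EuclideanSpace.proj (𝕜 := ℝ) i).contDiff

theorem continuous_polyEval (q : MvPolynomial (Fin d) ℝ) : Continuous (polyEval q) :=
  (contDiff_polyEval q).continuous

theorem partialDeriv_polyEval (i : Fin d) (q : MvPolynomial (Fin d) ℝ) :
    partialDeriv i (polyEval q) = polyEval (MvPolynomial.pderiv i q) := by
  have hd : ∀ q : MvPolynomial (Fin d) ℝ, Differentiable ℝ (polyEval q) := fun q =>
    (contDiff_polyEval q).differentiable (by simp)
  induction q using MvPolynomial.induction_on with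
  | C a =>
    have : polyEval (MvPolynomial.C a) = fun _ : 𝔼 => a := by funext x; simp [polyEval]
    funext x
    rw [partialDeriv, this]
    simp [polyEval]
  | add p q hp hq =>
    have : polyEval (p + q) = fun x => polyEval p x + polyEval q x := by
      funext x; simp [polyEval]
    funext x
    have hpx := congrFun hp x
    have hqx := congrFun hq x
    rw [partialDeriv] at hpx hqx
    rw [partialDeriv, this, fderiv_fun_add (hd p x) (hd q x), _root_.add_apply, hpx, hqx]
    simp [polyEval]
  | mul_X p j hp =>
    have : polyEval (p * MvPolynomial.X j) = fun x : 𝔼 => polyEval p x * x j := by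
      funext x; simp [polyEval]
    funext x
    have hpx := congrFun hp x
    rw [partialDeriv] at hpx
    have hj : HasFDerivAt (fun x : 𝔼 => x j)
      (EuclideanSpace.proj (𝕜 := ℝ) j : 𝔼 →L[ℝ] ℝ) x := (EuclideanSpace.proj (𝕜 := ℝ) j).hasFDerivAt
    rw [partialDeriv, this, fderiv_fun_mul (hd p x) hj.differentiableAt, hj.fderiv,
      _root_.add_apply, _root_.smul_apply, _root_.smul_apply, hpx]
    by_cases hij : i = j
    · subst hij; simp [polyEval]
    · simp [polyEval, MvPolynomial.pderiv_X, hij]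

/-- The space of polynomials of degree less than `k`. -/
def polySpace (d k : ℕ) : Submodule ℝ (MvPolynomial (Fin d) ℝ) :=
  MvPolynomial.restrictSupport ℝ {n | n.degree < k}

theorem mem_polySpace {k : ℕ} {q : MvPolynomial (Fin d) ℝ} :
    q ∈ polySpace d k ↔ ∀ n ∈ q.support, n.degree < k := by
  rw [polySpace, MvPolynomial.mem_restrictSupport_iff]; rfl

theorem mem_polySpace_succ {k : ℕ} {q : MvPolynomial (Fin d) ℝ} :
    q ∈ polySpace d (k + 1) ↔ q.totalDegree ≤ k := by
  rw [mem_polySpace, MvPolynomial.totalDegree, Finset.sup_le_iff]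
  exact forall₂_congr fun n _ => Nat.lt_succ_iff

theorem polySpace_mono {k k' : ℕ} (h : k ≤ k') : polySpace d k ≤ polySpace d k' :=
  MvPolynomial.restrictSupport_mono ℝ fun _ hn => lt_of_lt_of_le hn h

theorem eq_zero_of_mem_polySpace_zero {q : MvPolynomial (Fin d) ℝ} (h : q ∈ polySpace d 0) :
    q = 0 := by
  rw [mem_polySpace] at h
  ext n
  by_contra hn
  exact absurd (h n (MvPolynomial.mem_support_iff.2 (by simpa using hn))) (by simp)

theorem pderiv_mem_polySpace {k : ℕ} (i : Fin d) {q : MvPolynomial (Fin d) ℝ}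
    (h : q ∈ polySpace d k) : MvPolynomial.pderiv i q ∈ polySpace d (k - 1) := by
  rw [mem_polySpace] at h ⊢
  intro n hn
  rw [MvPolynomial.mem_support_iff, MvPolynomial.coeff_pderiv] at hn
  have := h _ (MvPolynomial.mem_support_iff.2 (left_ne_zero_of_mul hn))
  rw [map_add, Finsupp.degree_single] at this
  omega

instance finite_polySpace (k : ℕ) : Module.Finite ℝ (polySpace d k) := by
  have hf : {n : Fin d →₀ ℕ | n.degree < k}.Finite :=
    (Finsupp.finite_of_degree_le k).subset fun n (hn : n.degree < k) =>
      (show n.degree ≤ k from hn.le)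
  have : Finite {n : Fin d →₀ ℕ | n.degree < k} := hf
  exact Module.Finite.of_basis (MvPolynomial.basisRestrictSupport ℝ {n : Fin d →₀ ℕ | n.degree < k})

theorem polyEval_add (p q : MvPolynomial (Fin d) ℝ) (x : 𝔼) :
    polyEval (p + q) x = polyEval p x + polyEval q x := by simp [polyEval]

theorem polyEval_smul (a : ℝ) (q : MvPolynomial (Fin d) ℝ) (x : 𝔼) :
    polyEval (a • q) x = a * polyEval q x := by simp [polyEval, MvPolynomial.smul_eval]

theorem polyEval_sub (p q : MvPolynomial (Fin d) ℝ) (x : 𝔼) :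
    polyEval (p - q) x = polyEval p x - polyEval q x := by simp [polyEval]

theorem eq_zero_of_polyEval_eq_zero {V : Set 𝔼} (hV : IsOpen V) (hne : V.Nonempty)
    {q : MvPolynomial (Fin d) ℝ} (h : ∀ x ∈ V, polyEval q x = 0) : q = 0 := by
  obtain ⟨x, hx⟩ := hne
  have hcont : Continuous (fun y : Fin d → ℝ => (WithLp.toLp 2 y : 𝔼)) := PiLp.continuous_toLp 2 _
  obtain ⟨ε, hε, hb⟩ := Metric.isOpen_iff.1 (hV.preimage hcont) (WithLp.ofLp x) hx
  refine MvPolynomial.funext_set (fun i => Metric.ball (x i) ε) (fun i => ?_) fun y hy => ?_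
  · rw [Real.ball_eq_Ioo]; exact Ioo_infinite (by linarith)
  · rw [map_zero]
    refine h (WithLp.toLp 2 y) (hb ?_)
    rw [ball_pi _ hε]
    exact hy

theorem exists_polyEval_affine (c : 𝔼) (t : ℝ) {k : ℕ} {q : MvPolynomial (Fin d) ℝ}
    (h : q ∈ polySpace d k) : ∃ q' ∈ polySpace d k, ∀ y, polyEval q' y = polyEval q (c + t • y) := by
  let f : Fin d → MvPolynomial (Fin d) ℝ := fun i =>
    MvPolynomial.C (c i) + MvPolynomial.C t * MvPolynomial.X i
  have hf : ∀ i, (f i).totalDegree ≤ 1 := by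
    intro i
    refine (MvPolynomial.totalDegree_add _ _).trans (max_le (by simp) ?_)
    refine (MvPolynomial.totalDegree_mul _ _).trans ?_
    simp
  refine ⟨MvPolynomial.bind₁ f q, ?_, fun y => ?_⟩
  · rw [q.as_sum, map_sum]
    refine Submodule.sum_mem _ fun n hn => ?_
    have hn' := mem_polySpace.1 h n hn
    refine polySpace_mono (Nat.succ_le_of_lt hn') (mem_polySpace_succ.2 ?_)
    rw [MvPolynomial.bind₁_monomial]
    refine (MvPolynomial.totalDegree_mul _ _).trans ?_
    rw [MvPolynomial.totalDegree_C, zero_add, Finsupp.degree]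
    refine (MvPolynomial.totalDegree_finsetProd _ _).trans (Finset.sum_le_sum fun i _ => ?_)
    refine (MvPolynomial.totalDegree_pow _ _).trans ?_
    calc n i * (f i).totalDegree ≤ n i * 1 := Nat.mul_le_mul_left _ (hf i)
      _ = n i := mul_one _
  · simp only [polyEval]
    refine (MvPolynomial.eval₂Hom_bind₁ _ _ _ _).trans ?_
    change MvPolynomial.eval (fun i => MvPolynomial.eval (fun i => y i) (f i)) q =
      MvPolynomial.eval (fun i => (c + t • y) i) q
    congr 2
    funext i
    simp [f]

/-- Norm equivalence for polynomials of bounded degree on the unit ball. -/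
theorem exists_polySpace_bound_unit (k : ℕ) {κ : ℝ} (hκ : 0 < κ) :
    ∃ C : ℝ, 0 < C ∧ ∀ q ∈ polySpace d k, ∀ x ∈ Metric.closedBall (0 : 𝔼) 1,
      |polyEval q x| ≤ C * ∫ y in Metric.ball (0 : 𝔼) κ, |polyEval q y| ∧
      ∀ i, |polyEval (MvPolynomial.pderiv i q) x| ≤
        C * ∫ y in Metric.ball (0 : 𝔼) κ, |polyEval q y| := by
  let V := polySpace d k
  let n := Module.finrank ℝ V
  let b := Module.finBasis ℝ V
  have hsum : ∀ q : V, (q : MvPolynomial (Fin d) ℝ) = ∑ j, b.repr q j • (b j : MvPolynomial (Fin d) ℝ) := by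
    intro q
    calc (q : MvPolynomial (Fin d) ℝ) = ((∑ j, b.repr q j • b j : V) : MvPolynomial (Fin d) ℝ) := by
          rw [b.sum_repr]
      _ = _ := by simp only [Submodule.coe_sum, Submodule.coe_smul]
  have hlin : ∀ (a : Fin n → ℝ) (x : 𝔼),
      polyEval (∑ j, a j • (b j : MvPolynomial (Fin d) ℝ)) x = ∑ j, a j * polyEval (b j) x := by
    intro a x
    simp [polyEval, MvPolynomial.smul_eval]
  let F : (Fin n → ℝ) → ℝ := fun a =>
    ∫ y in Metric.closedBall (0 : 𝔼) (κ / 2), |∑ j, a j * polyEval (b j) y|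
  have hF : Continuous F := by
    refine continuous_parametric_integral_of_continuous (f := fun (a : Fin n → ℝ) (y : 𝔼) =>
      |∑ j, a j * polyEval (b j) y|) ?_ (isCompact_closedBall _ _)
    refine continuous_abs.comp (continuous_finsetSum _ fun j _ => ?_)
    exact ((continuous_apply j).comp continuous_fst).mul
      ((continuous_polyEval _).comp continuous_snd)
  have hFpos : ∀ a : Fin n → ℝ, a ≠ 0 → 0 < F a := by
    intro a ha
    have hnn : 0 ≤ F a := integral_nonneg fun y => abs_nonneg _
    refine lt_of_le_of_ne hnn fun h0 => ha ?_
    have hcont : Continuous fun y : 𝔼 => |∑ j, a j * polyEval (b j) y| :=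
      continuous_abs.comp (continuous_finsetSum _ fun j _ =>
        continuous_const.mul (continuous_polyEval _))
    have hae := (setIntegral_eq_zero_iff_of_nonneg_ae
      (Filter.Eventually.of_forall fun y => abs_nonneg _)
      (hcont.continuousOn.integrableOn_compact (isCompact_closedBall (0 : 𝔼) (κ / 2)))).1 h0.symm
    have hball : ∀ y ∈ Metric.ball (0 : 𝔼) (κ / 2),
        polyEval (∑ j, a j • (b j : MvPolynomial (Fin d) ℝ)) y = 0 := by
      have h1 := Measure.eqOn_open_of_ae_eq (μ := (volume : Measure 𝔼))
        (ae_restrict_of_ae_restrict_of_subset Metric.ball_subset_closedBall hae)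
        Metric.isOpen_ball hcont.continuousOn continuousOn_const
      intro y hy
      rw [hlin]
      exact abs_eq_zero.1 (h1 hy)
    have hz := eq_zero_of_polyEval_eq_zero Metric.isOpen_ball ⟨0, Metric.mem_ball_self (half_pos hκ)⟩ hball
    have hz' : ∑ j, a j • b j = 0 := by
      apply Subtype.ext
      refine Eq.trans ?_ hz
      simp
    funext j
    exact Fintype.linearIndependent_iff.1 b.linearIndependent a hz' j
  have hFhom : ∀ (t : ℝ) (a : Fin n → ℝ), F (t • a) = |t| * F a := by
    intro t a
    simp only [F]
    rw [← integral_const_mul]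
    refine integral_congr_ae (Filter.Eventually.of_forall fun y => ?_)
    simp only [Pi.smul_apply, smul_eq_mul, mul_assoc, ← Finset.mul_sum, abs_mul]
  obtain ⟨δ, hδ, hFδ⟩ : ∃ δ > 0, ∀ a : Fin n → ℝ, δ * ‖a‖ ≤ F a := by
    rcases (Metric.sphere (0 : Fin n → ℝ) 1).eq_empty_or_nonempty with he | hne
    · refine ⟨1, one_pos, fun a => ?_⟩
      have ha : a = 0 := by
        by_contra ha
        have : ‖a‖⁻¹ • a ∈ Metric.sphere (0 : Fin n → ℝ) 1 := by
          rw [mem_sphere_zero_iff_norm, norm_smul, norm_inv, norm_norm,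
            inv_mul_cancel₀ (norm_ne_zero_iff.2 ha)]
        rw [he] at this; exact this
      rw [ha, norm_zero, mul_zero]
      exact integral_nonneg fun y => abs_nonneg _
    · obtain ⟨a₀, ha₀, hmin⟩ := (isCompact_sphere (0 : Fin n → ℝ) 1).exists_isMinOn hne hF.continuousOn
      have ha₀' : a₀ ≠ 0 := by
        rintro rfl; simp at ha₀
      refine ⟨F a₀, hFpos a₀ ha₀', fun a => ?_⟩
      by_cases ha : a = 0
      · rw [ha, norm_zero, mul_zero]; exact integral_nonneg fun y => abs_nonneg _
      have hna : 0 < ‖a‖ := norm_pos_iff.2 ha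
      have hm : ‖a‖⁻¹ • a ∈ Metric.sphere (0 : Fin n → ℝ) 1 := by
        rw [mem_sphere_zero_iff_norm, norm_smul, norm_inv, norm_norm, inv_mul_cancel₀ hna.ne']
      have h1 : F a₀ ≤ F (‖a‖⁻¹ • a) := hmin hm
      rw [hFhom, abs_inv, abs_norm, ← div_eq_inv_mul, le_div_iff₀ hna] at h1
      exact h1
  have hbound : ∀ f : Fin n → 𝔼 → ℝ, (∀ j, Continuous (f j)) →
      ∃ M : ℝ, 0 ≤ M ∧ ∀ (a : Fin n → ℝ), ∀ x ∈ Metric.closedBall (0 : 𝔼) 1,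
        |∑ j, a j * f j x| ≤ M * ‖a‖ := by
    intro f hf
    choose M hM using fun j => (isCompact_closedBall (0 : 𝔼) 1).exists_bound_of_continuousOn
      (hf j).continuousOn
    refine ⟨∑ j, |M j|, Finset.sum_nonneg fun j _ => abs_nonneg _, fun a x hx => ?_⟩
    rw [Finset.sum_mul]
    refine (Finset.abs_sum_le_sum_abs _ _).trans (Finset.sum_le_sum fun j _ => ?_)
    rw [abs_mul, mul_comm]
    exact mul_le_mul ((hM j x hx).trans (le_abs_self _)) (norm_le_pi_norm a j) (abs_nonneg _)
      (abs_nonneg _)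
  obtain ⟨M, hM0, hM⟩ := hbound (fun j => polyEval (b j)) fun j => continuous_polyEval _
  choose M' hM0' hM' using fun i : Fin d => hbound
    (fun j => polyEval (MvPolynomial.pderiv i (b j : MvPolynomial (Fin d) ℝ)))
    fun j => continuous_polyEval _
  refine ⟨(M + ∑ i, M' i + 1) / δ, by
    have := Finset.sum_nonneg fun i (_ : i ∈ Finset.univ) => hM0' i
    positivity, fun q hq x hx => ?_⟩
  have hS := Finset.sum_nonneg fun i (_ : i ∈ Finset.univ) => hM0' i
  set a := b.repr ⟨q, hq⟩ with ha
  have hqa : q = ∑ j, a j • (b j : MvPolynomial (Fin d) ℝ) := hsum ⟨q, hq⟩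
  have hFq : F a = ∫ y in Metric.closedBall (0 : 𝔼) (κ / 2), |polyEval q y| := by
    simp only [F]
    refine integral_congr_ae (Filter.Eventually.of_forall fun y => ?_)
    simp only []
    rw [← hlin, ← hqa]
  have hI : F a ≤ ∫ y in Metric.ball (0 : 𝔼) κ, |polyEval q y| := by
    rw [hFq]
    refine setIntegral_mono_set ?_ (Filter.Eventually.of_forall fun y => abs_nonneg _)
      (Metric.closedBall_subset_ball (by linarith)).eventuallyLE
    exact ((continuous_polyEval q).abs.continuousOn.integrableOn_compact
      (isCompact_closedBall (0 : 𝔼) κ)).mono_set Metric.ball_subset_closedBall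
  have hna : ‖(a : Fin n → ℝ)‖ ≤ F a / δ := by
    rw [le_div_iff₀ hδ, mul_comm]; exact hFδ a
  have key : ∀ L : ℝ, 0 ≤ L → L ≤ M + ∑ i, M' i + 1 → ∀ z : ℝ, |z| ≤ L * ‖(a : Fin n → ℝ)‖ →
      |z| ≤ (M + ∑ i, M' i + 1) / δ * ∫ y in Metric.ball (0 : 𝔼) κ, |polyEval q y| := by
    intro L hL0 hL z hz
    calc |z| ≤ L * ‖(a : Fin n → ℝ)‖ := hz
      _ ≤ (M + ∑ i, M' i + 1) * (F a / δ) := by gcongr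
      _ = (M + ∑ i, M' i + 1) / δ * F a := by ring
      _ ≤ _ := by gcongr
  refine ⟨key M hM0 (by linarith) _ ?_, fun i => key (M' i) (hM0' i) ?_ _ ?_⟩
  · rw [hqa, hlin]; exact hM a x hx
  · have := Finset.single_le_sum (fun i _ => hM0' i) (Finset.mem_univ i)
    linarith
  · have : polyEval (MvPolynomial.pderiv i q) x =
        ∑ j, a j * polyEval (MvPolynomial.pderiv i (b j : MvPolynomial (Fin d) ℝ)) x := by
      rw [hqa]; simp [polyEval, MvPolynomial.smul_eval]
    rw [this]; exact hM' i a x hx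

theorem setIntegral_ball_affine (f : 𝔼 → ℝ) (c : 𝔼) {t κ : ℝ} (ht : 0 < t) :
    ∫ y in Metric.ball (0 : 𝔼) κ, f (c + t • y) =
      (t ^ d)⁻¹ * ∫ x in Metric.ball c (κ * t), f x := by
  have e1 := Measure.setIntegral_comp_smul_of_pos (volume : Measure 𝔼) (fun z => f (c + z))
    (Metric.ball (0 : 𝔼) κ) ht
  rw [finrank_euclideanSpace_fin, smul_ball ht.ne', smul_zero, Real.norm_of_nonneg ht.le,
    smul_eq_mul] at e1
  rw [e1, mul_comm t κ]
  congr 1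
  have e2 := (measurePreserving_add_left (volume : Measure 𝔼) c).setIntegral_preimage_emb
    (measurableEmbedding_addLeft c) f (Metric.ball c (κ * t))
  rw [← e2]
  congr 2
  ext y
  simp

/-- Inverse estimates for polynomials of bounded degree. -/
theorem exists_polySpace_bound_ball (d k : ℕ) {κ : ℝ} (hκ : 0 < κ) :
    ∃ C : ℝ, 0 < C ∧ ∀ q ∈ polySpace d k, ∀ (c : EuclideanSpace ℝ (Fin d)) (t : ℝ), 0 < t →
      ∀ x ∈ Metric.closedBall c t,
      |polyEval q x| ≤ C * ((t ^ d)⁻¹ * ∫ y in Metric.ball c (κ * t), |polyEval q y|) ∧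
      ∀ i, |polyEval (MvPolynomial.pderiv i q) x| ≤
        C / t * ((t ^ d)⁻¹ * ∫ y in Metric.ball c (κ * t), |polyEval q y|) := by
  obtain ⟨C, hC, h⟩ := exists_polySpace_bound_unit (d := d) k hκ
  refine ⟨C, hC, fun q hq c t ht x hx => ?_⟩
  obtain ⟨q', hq', he⟩ := exists_polyEval_affine c t hq
  set y := t⁻¹ • (x - c) with hy
  have hyx : c + t • y = x := by rw [hy, smul_inv_smul₀ ht.ne']; abel
  have hy1 : y ∈ Metric.closedBall (0 : EuclideanSpace ℝ (Fin d)) 1 := by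
    rw [mem_closedBall_zero_iff, hy, norm_smul, norm_inv, Real.norm_of_nonneg ht.le,
      inv_mul_le_one₀ ht, ← dist_eq_norm]
    exact hx
  obtain ⟨h1, h2⟩ := h q' hq' y hy1
  simp only [he, hyx] at h1
  rw [setIntegral_ball_affine (fun x => |polyEval q x|) c ht] at h1
  refine ⟨h1, fun i => ?_⟩
  have h3 := h2 i
  simp only [he] at h3
  rw [setIntegral_ball_affine (fun x => |polyEval q x|) c ht] at h3
  have h4 : polyEval (MvPolynomial.pderiv i q') y = t * polyEval (MvPolynomial.pderiv i q) x := by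
    rw [← partialDeriv_polyEval, ← partialDeriv_polyEval, partialDeriv, partialDeriv]
    have e1 : polyEval q' = fun y => polyEval q (c + t • y) := funext he
    have hd : HasFDerivAt (polyEval q) (fderiv ℝ (polyEval q) x) (c + t • y) := by
      rw [hyx]; exact ((contDiff_polyEval q).differentiable (by simp) x).hasFDerivAt
    have hd2 : HasFDerivAt (fun y : EuclideanSpace ℝ (Fin d) => c + t • y)
        (t • ContinuousLinearMap.id ℝ (EuclideanSpace ℝ (Fin d))) y :=
      ((hasFDerivAt_id y).const_smul t).const_add c
    have hd3 := (hd.comp y hd2).fderiv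
    have e2 : polyEval q' = polyEval q ∘ fun y => c + t • y := e1
    rw [e2, hd3]
    simp
  rw [h4, abs_mul, abs_of_pos ht] at h3
  rw [div_mul_eq_mul_div, le_div_iff₀ ht, mul_comm]
  exact h3

/-- Inverse estimates on regular polytopes, in terms of the mean value of a polynomial. -/
theorem exists_polySpace_bound (d k : ℕ) {ρ : ℝ} (hρ : 0 < ρ) :
    ∃ C : ℝ, 0 < C ∧ ∀ (U : Set (EuclideanSpace ℝ (Fin d)))
      (𝒮 : Finset (Finset (EuclideanSpace ℝ (Fin d)))), IsRegularPolytope ρ U 𝒮 →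
      ∀ q ∈ polySpace d k, ∀ x ∈ U,
      |polyEval q x| ≤ C * ⨍ y in U, |polyEval q y| ∧
      ∀ i, |polyEval (MvPolynomial.pderiv i q) x| ≤
        C / Metric.diam U * ⨍ y in U, |polyEval q y| := by
  have hκ : 0 < ρ ^ 2 / 2 := by positivity
  obtain ⟨C, hC, h⟩ := exists_polySpace_bound_ball d k hκ
  set vol := volume.real (Metric.closedBall (0 : EuclideanSpace ℝ (Fin d)) 1) with hvol
  have hvol0 : 0 < vol := by
    rw [hvol, measureReal_def]
    exact ENNReal.toReal_pos (Metric.measure_closedBall_pos volume _ one_pos).ne'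
      (isCompact_closedBall _ _).measure_lt_top.ne
  refine ⟨C * vol, by positivity, fun U 𝒮 hU q hq x hx => ?_⟩
  obtain ⟨x₀, hx₀⟩ := hU.isConnected.nonempty
  obtain ⟨S, hS, -⟩ := hU.exists_mem (subset_closure hx₀)
  obtain ⟨c, hc⟩ := hU.exists_ball_subset hS
  have hh := hU.diam_pos
  have hcU : Metric.ball c (ρ ^ 2 / 2 * Metric.diam U) ⊆ U := by
    have : ρ ^ 2 / 2 * Metric.diam U = IsRegularPolytope.radius ρ U := by
      unfold IsRegularPolytope.radius; ring
    rw [this]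
    exact (IsRegularPolytope.ball_subset_interior hc).trans (hU.interior_convexHull_subset hS)
  have hcm : c ∈ U := hcU (Metric.mem_ball_self (by positivity))
  have hUsub : U ⊆ Metric.closedBall c (Metric.diam U) := fun y hy =>
    hU.dist_le_diam (subset_closure hy) (subset_closure hcm)
  have hvol0 : 0 < volume.real U := by
    rw [measureReal_def]
    exact ENNReal.toReal_pos (hU.isOpen.measure_pos volume ⟨x, hx⟩).ne'
      hU.isBounded.measure_lt_top.ne
  have hvol : volume.real U ≤ Metric.diam U ^ d * vol := by
    have e1 : volume.real (Metric.closedBall c (Metric.diam U)) = Metric.diam U ^ d * vol := by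
      rw [measureReal_def, Measure.addHaar_closedBall' volume c hh.le, ENNReal.toReal_mul,
        ENNReal.toReal_ofReal (by positivity), finrank_euclideanSpace_fin, hvol, measureReal_def]
    rw [← e1]
    exact measureReal_mono hUsub (isCompact_closedBall _ _).measure_lt_top.ne
  have hint : IntegrableOn (fun y => |polyEval q y|) U :=
    ((continuous_polyEval q).abs.continuousOn.integrableOn_compact
      hU.isCompact_closure).mono_set subset_closure
  set I := ∫ y in U, |polyEval q y| with hI
  have hI0 : 0 ≤ I := integral_nonneg fun y => abs_nonneg _
  have hIle : ∫ y in Metric.ball c (ρ ^ 2 / 2 * Metric.diam U), |polyEval q y| ≤ I :=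
    setIntegral_mono_set hint (Filter.Eventually.of_forall fun y => abs_nonneg _) hcU.eventuallyLE
  have havg : (Metric.diam U ^ d)⁻¹ *
      ∫ y in Metric.ball c (ρ ^ 2 / 2 * Metric.diam U), |polyEval q y| ≤
      vol * ⨍ y in U, |polyEval q y| := by
    rw [setAverage_eq, smul_eq_mul, ← hI]
    calc _ ≤ (Metric.diam U ^ d)⁻¹ * I := by gcongr
      _ = vol * ((Metric.diam U ^ d * vol)⁻¹ * I) := by field_simp
      _ ≤ vol * ((volume.real U)⁻¹ * I) := by gcongr
  obtain ⟨h1, h2⟩ := h q hq c _ hh x (hUsub hx)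
  refine ⟨h1.trans ?_, fun i => (h2 i).trans ?_⟩
  · rw [mul_assoc]; gcongr
  · rw [mul_div_right_comm, mul_assoc]; gcongr

theorem exists_eq_add_single {α : Fin d → ℕ} {n : ℕ} (h : ∑ i, α i = n + 1) :
    ∃ (β : Fin d → ℕ) (i : Fin d), ∑ j, β j = n ∧ α = β + Pi.single i 1 := by
  obtain ⟨i, -, hi⟩ : ∃ i ∈ Finset.univ, α i ≠ 0 := by
    by_contra hcon
    push Not at hcon
    rw [Finset.sum_eq_zero hcon] at h
    omega
  have e : α = (α - Pi.single i 1) + Pi.single i 1 := by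
    funext j
    by_cases hj : j = i
    · subst hj; simp; omega
    · simp [hj]
  refine ⟨α - Pi.single i 1, i, ?_, e⟩
  have h2 : ∑ j, α j = ∑ j, (α - Pi.single i 1 : Fin d → ℕ) j + 1 := by
    conv_lhs => rw [e]
    simp [Finset.sum_add_distrib]
  omega

theorem sum_add_single (α : Fin d → ℕ) (i : Fin d) :
    ∑ j, (α + Pi.single i 1 : Fin d → ℕ) j = ∑ j, α j + 1 := by
  simp [Finset.sum_add_distrib]

theorem isWeakDeriv_zero {U : Set 𝔼} {v : 𝔼 → ℝ} (hv : LocallyIntegrableOn v U) :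
    IsWeakDeriv U 0 v v :=
  ⟨hv, hv, fun φ _ _ _ => by simp [multiDeriv_zero]⟩

/-- Classical derivatives of a smooth function are weak derivatives. -/
theorem isWeakDeriv_of_contDiff {U : Set 𝔼} {f : 𝔼 → ℝ} (hf : ContDiff ℝ ∞ f)
    (α : Fin d → ℕ) : IsWeakDeriv U α f (multiDeriv α f) := by
  obtain ⟨n, hn⟩ : ∃ n, ∑ i, α i = n := ⟨_, rfl⟩
  induction n generalizing α with
  | zero =>
    have : α = 0 := by
      funext i
      exact (Finset.sum_eq_zero_iff.1 hn) i (Finset.mem_univ i)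
    subst this
    rw [multiDeriv_zero]
    exact isWeakDeriv_zero (hf.continuous.locallyIntegrable.locallyIntegrableOn U)
  | succ n ih =>
    obtain ⟨β, i, hβ, rfl⟩ := exists_eq_add_single hn
    have h1 := isWeakDeriv_single_of_contDiff (U := U) i (contDiff_multiDeriv β hf)
    rw [partialDeriv_multiDeriv β i hf, ← multiDeriv_add_single β i hf] at h1
    exact (ih β hβ).comp_single h1

theorem exists_multiDeriv_polyEval {k : ℕ} {q : MvPolynomial (Fin d) ℝ} (hq : q ∈ polySpace d k)
    (α : Fin d → ℕ) :
    ∃ q' ∈ polySpace d (k - ∑ i, α i), multiDeriv α (polyEval q) = polyEval q' := by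
  obtain ⟨n, hn⟩ : ∃ n, ∑ i, α i = n := ⟨_, rfl⟩
  induction n generalizing α with
  | zero =>
    have : α = 0 := by
      funext i
      exact (Finset.sum_eq_zero_iff.1 hn) i (Finset.mem_univ i)
    subst this
    exact ⟨q, by simpa using hq, multiDeriv_zero _⟩
  | succ n ih =>
    obtain ⟨β, i, hβ, rfl⟩ := exists_eq_add_single hn
    obtain ⟨q', hq', he⟩ := ih β hβ
    refine ⟨MvPolynomial.pderiv i q', ?_, ?_⟩
    · rw [sum_add_single, ← Nat.sub_sub]
      exact pderiv_mem_polySpace i hq'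
    · rw [multiDeriv_add_single β i (contDiff_polyEval q), ← partialDeriv_multiDeriv β i (contDiff_polyEval q), he, partialDeriv_polyEval]

theorem mem_piAntidiag_univ {α : Fin d → ℕ} {m : ℕ} :
    α ∈ Finset.piAntidiag (Finset.univ : Finset (Fin d)) m ↔ ∑ i, α i = m := by
  simp [Finset.mem_piAntidiag]

theorem MemSobolev.isWeakDeriv {U : Set 𝔼} {s : ℕ} {p : ℝ≥0∞} {v : 𝔼 → ℝ} (h : MemSobolev U s p v)
    {α : Fin d → ℕ} (hα : ∑ i, α i ≤ s) : IsWeakDeriv U α v (weakDeriv U α v) := by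
  obtain ⟨w, hw, -⟩ := h α hα
  exact isWeakDeriv_weakDeriv ⟨w, hw⟩

theorem MemSobolev.memLp {U : Set 𝔼} (hU : IsOpen U) {s : ℕ} {p : ℝ≥0∞} {v : 𝔼 → ℝ}
    (h : MemSobolev U s p v) {α : Fin d → ℕ} (hα : ∑ i, α i ≤ s) :
    MemLp (weakDeriv U α v) p (volume.restrict U) := by
  obtain ⟨w, hw, hwp⟩ := h α hα
  exact hwp.ae_eq (hw.weakDeriv_ae_eq hU).symm

theorem MemSobolev.hasWeakGrad {U : Set 𝔼} {s : ℕ} {p : ℝ≥0∞} {v : 𝔼 → ℝ} (h : MemSobolev U s p v)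
    {α : Fin d → ℕ} (hα : ∑ i, α i < s) :
    HasWeakGrad U (weakDeriv U α v) fun i => weakDeriv U (α + Pi.single i 1) v := fun i =>
  (h.isWeakDeriv hα.le).single_of_add (h.isWeakDeriv (by rw [sum_add_single]; exact hα))

theorem MemSobolev.sub {U : Set 𝔼} {s : ℕ} {p : ℝ≥0∞} {v v' : 𝔼 → ℝ}
    (h : MemSobolev U s p v) (h' : MemSobolev U s p v') : MemSobolev U s p (v - v') := by
  intro α hα
  obtain ⟨w, hw, hwp⟩ := h α hα
  obtain ⟨w', hw', hwp'⟩ := h' α hα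
  exact ⟨w - w', hw.sub hw', hwp.sub hwp'⟩

theorem MemSobolev.weakDeriv_sub_ae_eq {U : Set 𝔼} (hU : IsOpen U) {s : ℕ} {p : ℝ≥0∞}
    {v v' : 𝔼 → ℝ} (h : MemSobolev U s p v) (h' : MemSobolev U s p v') {α : Fin d → ℕ}
    (hα : ∑ i, α i ≤ s) :
    weakDeriv U α (v - v') =ᵐ[volume.restrict U] weakDeriv U α v - weakDeriv U α v' :=
  ((h.isWeakDeriv hα).sub (h'.isWeakDeriv hα)).weakDeriv_ae_eq hU

theorem weakDeriv_zero_ae_eq {U : Set 𝔼} (hU : IsOpen U) {v : 𝔼 → ℝ}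
    (hv : LocallyIntegrableOn v U) : weakDeriv U 0 v =ᵐ[volume.restrict U] v :=
  (isWeakDeriv_zero hv).weakDeriv_ae_eq hU

theorem weakDeriv_ae_eq_of_contDiff {U : Set 𝔼} (hU : IsOpen U) {f : 𝔼 → ℝ} (hf : ContDiff ℝ ∞ f)
    (α : Fin d → ℕ) : weakDeriv U α f =ᵐ[volume.restrict U] multiDeriv α f :=
  (isWeakDeriv_of_contDiff hf α).weakDeriv_ae_eq hU

theorem memLp_restrict_of_continuous {U : Set 𝔼} (hc : IsCompact (closure U))
    {f : 𝔼 → ℝ} (hf : Continuous f) (p : ℝ≥0∞) : MemLp f p (volume.restrict U) := by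
  obtain ⟨C, hC⟩ := hc.exists_bound_of_continuousOn hf.continuousOn
  have hfin : IsFiniteMeasure (volume.restrict (closure U)) :=
    ⟨by rw [Measure.restrict_apply_univ]; exact hc.measure_lt_top⟩
  have h1 : MemLp f p (volume.restrict (closure U)) := by
    refine MemLp.of_bound hf.aestronglyMeasurable C ?_
    exact (ae_restrict_iff' isClosed_closure.measurableSet).2 (Filter.Eventually.of_forall hC)
  exact h1.mono_measure (Measure.restrict_mono subset_closure le_rfl)

theorem memSobolev_of_contDiff {U : Set 𝔼} (hc : IsCompact (closure U)) {f : 𝔼 → ℝ}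
    (hf : ContDiff ℝ ∞ f) (s : ℕ) (p : ℝ≥0∞) : MemSobolev U s p f := fun α _ =>
  ⟨multiDeriv α f, isWeakDeriv_of_contDiff hf α,
    memLp_restrict_of_continuous hc (contDiff_multiDeriv α hf).continuous p⟩

theorem MemSobolev.integrableOn {U : Set 𝔼} (hU : IsOpen U) (hb : Bornology.IsBounded U) {s : ℕ}
    {p : ℝ≥0∞} (hp : 1 ≤ p) {v : 𝔼 → ℝ} (h : MemSobolev U s p v) {α : Fin d → ℕ}
    (hα : ∑ i, α i ≤ s) : IntegrableOn (weakDeriv U α v) U := by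
  have hfin : IsFiniteMeasure (volume.restrict U) :=
    ⟨by rw [Measure.restrict_apply_univ]; exact hb.measure_lt_top⟩
  exact (h.memLp hU hα).integrable hp

/-- Iterated Poincaré inequality for functions whose derivatives have mean value zero. -/
theorem exists_iterated_poincare_const (d s : ℕ) (ρ : ℝ) :
    ∃ K : ℝ, 0 < K ∧ ∀ (U : Set (EuclideanSpace ℝ (Fin d)))
      (𝒮 : Finset (Finset (EuclideanSpace ℝ (Fin d)))), IsRegularPolytope ρ U 𝒮 →
      ∀ p : ℝ≥0∞, 1 ≤ p → ∀ u, MemSobolev U s p u →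
      (∀ α : Fin d → ℕ, ∑ i, α i < s → ∫ x in U, weakDeriv U α u x = 0) →
      ∀ j ≤ s, sobolevSeminorm U (s - j) p u ≤
        ENNReal.ofReal ((K * Metric.diam U) ^ j) * sobolevSeminorm U s p u := by
  obtain ⟨K, hK, hP⟩ := exists_poincare_const d ρ
  obtain ⟨N, hN0, hN⟩ : ∃ N : ℝ, 0 ≤ N ∧ ∀ m < s,
      ((Finset.piAntidiag (Finset.univ : Finset (Fin d)) m).card : ℝ) ≤ N :=
    ⟨∑ m ∈ Finset.range s, ((Finset.piAntidiag (Finset.univ : Finset (Fin d)) m).card : ℝ),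
      Finset.sum_nonneg fun _ _ => Nat.cast_nonneg _, fun m hm =>
      Finset.single_le_sum (f := fun m =>
          ((Finset.piAntidiag (Finset.univ : Finset (Fin d)) m).card : ℝ))
          (fun _ _ => Nat.cast_nonneg _) (Finset.mem_range.2 hm)⟩
  refine ⟨(N + 1) * (K * (d + 1)), by positivity, fun U 𝒮 hU p hp u hu hz j => ?_⟩
  have hh := hU.diam_pos
  induction j with
  | zero => intro _; simp
  | succ j ih =>
    intro hj
    have hstep : sobolevSeminorm U (s - (j + 1)) p u ≤
        ENNReal.ofReal ((N + 1) * (K * (d + 1)) * Metric.diam U) *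
          sobolevSeminorm U (s - j) p u := by
      have hterm : ∀ α ∈ Finset.piAntidiag (Finset.univ : Finset (Fin d)) (s - (j + 1)),
          eLpNorm (weakDeriv U α u) p (volume.restrict U) ≤
            ENNReal.ofReal (K * Metric.diam U) * ((d : ℝ≥0∞) * sobolevSeminorm U (s - j) p u) := by
        intro α hα
        rw [mem_piAntidiag_univ] at hα
        refine (hP U 𝒮 hU _ _ (hu.hasWeakGrad (α := α) (by omega))
          (hu.integrableOn hU.isOpen hU.isBounded hp (by omega))
          (fun i => hu.integrableOn hU.isOpen hU.isBounded hp
            (by rw [sum_add_single]; omega)) (hz α (by omega)) p hp).trans ?_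
        gcongr
        calc ∑ i, eLpNorm (weakDeriv U (α + Pi.single i 1) u) p (volume.restrict U)
            ≤ ∑ _i : Fin d, sobolevSeminorm U (s - j) p u := by
              refine Finset.sum_le_sum fun i _ => ?_
              refine Finset.single_le_sum (f := fun α =>
                eLpNorm (weakDeriv U α u) p (volume.restrict U)) (fun _ _ => zero_le) ?_
              rw [mem_piAntidiag_univ, sum_add_single]; omega
          _ = _ := by simp
      rw [sobolevSeminorm]
      refine (Finset.sum_le_sum hterm).trans ?_
      rw [Finset.sum_const, nsmul_eq_mul, ← mul_assoc, ← mul_assoc]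
      gcongr
      rw [← ENNReal.ofReal_natCast, ← ENNReal.ofReal_natCast,
        ← ENNReal.ofReal_mul (by positivity), ← ENNReal.ofReal_mul (by positivity)]
      refine ENNReal.ofReal_le_ofReal ?_
      have hcard : ((Finset.piAntidiag (Finset.univ : Finset (Fin d)) (s - (j + 1))).card : ℝ) ≤ N :=
        hN _ (by omega)
      calc _ ≤ (N + 1) * (K * Metric.diam U) * (d + 1) := by
            gcongr
            · linarith
            · linarith
        _ = _ := by ring
    refine hstep.trans ((mul_le_mul' le_rfl (ih (by omega))).trans_eq ?_)
    rw [← mul_assoc, ← ENNReal.ofReal_mul (by positivity), pow_succ']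

theorem multiDeriv_add {f g : 𝔼 → ℝ} (hf : ContDiff ℝ ∞ f) (hg : ContDiff ℝ ∞ g)
    (α : Fin d → ℕ) : multiDeriv α (f + g) = multiDeriv α f + multiDeriv α g := by
  obtain ⟨n, hn⟩ : ∃ n, ∑ i, α i = n := ⟨_, rfl⟩
  induction n generalizing α f g with
  | zero =>
    have : α = 0 := by
      funext i
      exact (Finset.sum_eq_zero_iff.1 hn) i (Finset.mem_univ i)
    subst this
    simp only [multiDeriv_zero]
  | succ n ih =>
    obtain ⟨β, i, hβ, rfl⟩ := exists_eq_add_single hn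
    have : partialDeriv i (f + g) = partialDeriv i f + partialDeriv i g := by
      funext x
      rw [partialDeriv, fderiv_add (hf.differentiable (by simp) x) (hg.differentiable (by simp) x)]
      rfl
    rw [multiDeriv_add_single (f := f + g) β i (hf.add hg), multiDeriv_add_single β i hf,
      multiDeriv_add_single β i hg, this,
      ih (contDiff_partialDeriv i hf) (contDiff_partialDeriv i hg) β hβ]

theorem multiDeriv_const_smul {f : 𝔼 → ℝ} (hf : ContDiff ℝ ∞ f) (a : ℝ)
    (α : Fin d → ℕ) : multiDeriv α (a • f) = a • multiDeriv α f := by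
  obtain ⟨n, hn⟩ : ∃ n, ∑ i, α i = n := ⟨_, rfl⟩
  induction n generalizing α f with
  | zero =>
    have : α = 0 := by
      funext i
      exact (Finset.sum_eq_zero_iff.1 hn) i (Finset.mem_univ i)
    subst this
    simp only [multiDeriv_zero]
  | succ n ih =>
    obtain ⟨β, i, hβ, rfl⟩ := exists_eq_add_single hn
    have : partialDeriv i (a • f) = a • partialDeriv i f := by
      funext x
      rw [partialDeriv, fderiv_const_smul (hf.differentiable (by simp) x)]
      rfl
    rw [multiDeriv_add_single (f := a • f) β i (hf.const_smul a), multiDeriv_add_single β i hf, this,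
      ih (contDiff_partialDeriv i hf) β hβ]

theorem sobolevSeminorm_polyEval_eq_zero {U : Set 𝔼} (hU : IsOpen U) {s : ℕ} (p : ℝ≥0∞)
    {q : MvPolynomial (Fin d) ℝ} (hq : q ∈ polySpace d s) : sobolevSeminorm U s p (polyEval q) = 0 := by
  refine Finset.sum_eq_zero fun α hα => ?_
  rw [mem_piAntidiag_univ] at hα
  obtain ⟨q', hq', he⟩ := exists_multiDeriv_polyEval hq α
  rw [hα, Nat.sub_self] at hq'
  rw [eLpNorm_congr_ae (weakDeriv_ae_eq_of_contDiff hU (contDiff_polyEval q) α), he,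
    eq_zero_of_mem_polySpace_zero hq']
  have : polyEval (0 : MvPolynomial (Fin d) ℝ) = 0 := by funext x; simp [polyEval]
  rw [this, eLpNorm_zero]

theorem polyEval_eq_zero_of_ae {U : Set 𝔼} (hU : IsOpen U) {q : MvPolynomial (Fin d) ℝ}
    (h : polyEval q =ᵐ[volume.restrict U] 0) : ∀ x ∈ U, polyEval q x = 0 := fun _ hx =>
  Measure.eqOn_open_of_ae_eq h hU (continuous_polyEval q).continuousOn continuousOn_const hx

/-- A polynomial whose derivatives of order less than `s` have the same mean values as those of a
given function. -/
theorem IsRegularPolytope.exists_polynomial_integral_eq {ρ : ℝ} {U : Set 𝔼} {𝒮 : Finset (Finset 𝔼)}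
    (hU : IsRegularPolytope ρ U 𝒮) {s : ℕ} {p : ℝ≥0∞} (hp : 1 ≤ p) {v : 𝔼 → ℝ}
    (hv : MemSobolev U s p v) : ∃ q ∈ polySpace d s, ∀ α : Fin d → ℕ, ∑ i, α i < s →
      ∫ x in U, weakDeriv U α (v - polyEval q) x = 0 := by
  let I := {n : Fin d →₀ ℕ | n.degree < s}
  have hIfin : Finite I := (Finsupp.finite_of_degree_le s).subset fun n (hn : n.degree < s) =>
      (show n.degree ≤ s from hn.le)
  have := Fintype.ofFinite I
  have hint : ∀ (α : Fin d → ℕ) (q : MvPolynomial (Fin d) ℝ),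
      IntegrableOn (multiDeriv α (polyEval q)) U := fun α q =>
    ((contDiff_multiDeriv α (contDiff_polyEval q)).continuous.continuousOn.integrableOn_compact
      hU.isCompact_closure).mono_set subset_closure
  let Φ : polySpace d s →ₗ[ℝ] (I → ℝ) :=
    { toFun := fun q n => ∫ x in U, multiDeriv (n : Fin d →₀ ℕ) (polyEval (q : MvPolynomial (Fin d) ℝ)) x
      map_add' := by
        intro q q'
        funext n
        have : polyEval ((q + q' : polySpace d s) : MvPolynomial (Fin d) ℝ) =
            polyEval (q : MvPolynomial (Fin d) ℝ) + polyEval (q' : MvPolynomial (Fin d) ℝ) := by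
          funext x; simp [polyEval]
        rw [this, multiDeriv_add (contDiff_polyEval _) (contDiff_polyEval _)]
        exact integral_add (hint _ _) (hint _ _)
      map_smul' := by
        intro a q
        funext n
        have : polyEval ((a • q : polySpace d s) : MvPolynomial (Fin d) ℝ) =
            a • polyEval (q : MvPolynomial (Fin d) ℝ) := by
          funext x; simp [polyEval, MvPolynomial.smul_eval]
        rw [this, multiDeriv_const_smul (contDiff_polyEval _)]
        exact integral_const_mul _ _ }
  have hdeg : ∀ α : Fin d → ℕ, (Finsupp.equivFunOnFinite.symm α).degree = ∑ i, α i := by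
    intro α; rw [Finsupp.degree_eq_sum]; simp
  have hinj : Function.Injective Φ := by
    rw [← LinearMap.ker_eq_bot, LinearMap.ker_eq_bot']
    rintro ⟨q, hq⟩ h0
    obtain ⟨K, hK, hP⟩ := exists_iterated_poincare_const d s ρ
    have hz : ∀ α : Fin d → ℕ, ∑ i, α i < s → ∫ x in U, weakDeriv U α (polyEval q) x = 0 := by
      intro α hα
      rw [integral_congr_ae (weakDeriv_ae_eq_of_contDiff hU.isOpen (contDiff_polyEval q) α)]
      exact congrFun h0 ⟨Finsupp.equivFunOnFinite.symm α, by
        change (Finsupp.equivFunOnFinite.symm α).degree < s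
        rwa [hdeg]⟩
    have h1 := hP U 𝒮 hU 1 le_rfl _
      (memSobolev_of_contDiff hU.isCompact_closure (contDiff_polyEval q) s 1) hz s le_rfl
    rw [sobolevSeminorm_polyEval_eq_zero hU.isOpen 1 hq, mul_zero, Nat.sub_self,
      nonpos_iff_eq_zero, sobolevSeminorm] at h1
    have h2 := (Finset.sum_eq_zero_iff.1 h1) 0 (by rw [mem_piAntidiag_univ]; simp)
    have hae := weakDeriv_ae_eq_of_contDiff hU.isOpen (contDiff_polyEval q) 0
    rw [multiDeriv_zero] at hae
    rw [eLpNorm_congr_ae hae, eLpNorm_eq_zero_iff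
      (continuous_polyEval q).aestronglyMeasurable one_ne_zero] at h2
    exact Subtype.ext (eq_zero_of_polyEval_eq_zero hU.isOpen hU.isConnected.nonempty
      (polyEval_eq_zero_of_ae hU.isOpen h2))
  have hrank : Module.finrank ℝ (polySpace d s) = Module.finrank ℝ (I → ℝ) := by
    rw [Module.finrank_fintype_fun_eq_card]
    exact Module.finrank_eq_card_basis (MvPolynomial.basisRestrictSupport ℝ I)
  have hsurj : Function.Surjective Φ :=
    (LinearMap.injective_iff_surjective_of_finrank_eq_finrank hrank).1 hinj
  obtain ⟨⟨q, hq⟩, hΦ⟩ := hsurj fun n => ∫ x in U, weakDeriv U (n : Fin d →₀ ℕ) v x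
  refine ⟨q, hq, fun α hα => ?_⟩
  have hqS := memSobolev_of_contDiff hU.isCompact_closure (contDiff_polyEval q) s p
  rw [integral_congr_ae (hv.weakDeriv_sub_ae_eq hU.isOpen hqS hα.le)]
  have hmem : Finsupp.equivFunOnFinite.symm α ∈ I := by
    change (Finsupp.equivFunOnFinite.symm α).degree < s
    rwa [hdeg]
  have h3 := congrFun hΦ ⟨_, hmem⟩
  have h4 : ∫ x in U, multiDeriv α (polyEval q) x = ∫ x in U, weakDeriv U α v x := h3
  rw [Pi.sub_def, integral_sub (hv.integrableOn hU.isOpen hU.isBounded hp hα.le)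
    (hqS.integrableOn hU.isOpen hU.isBounded hp hα.le),
    integral_congr_ae (weakDeriv_ae_eq_of_contDiff hU.isOpen (contDiff_polyEval q) α), h4, sub_self]

/-- The Dirichlet pairing of a vector field with the gradient of a polynomial. -/
def gradPairing (U : Set 𝔼) (G : Fin d → 𝔼 → ℝ) (w : MvPolynomial (Fin d) ℝ) : ℝ :=
  ∫ x in U, ∑ i, G i x * polyEval (MvPolynomial.pderiv i w) x

theorem integrable_gradPairing {U : Set 𝔼} (hc : IsCompact (closure U)) {G : Fin d → 𝔼 → ℝ}
    (hG : ∀ i, IntegrableOn (G i) U) (w : MvPolynomial (Fin d) ℝ) :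
    IntegrableOn (fun x => ∑ i, G i x * polyEval (MvPolynomial.pderiv i w) x) U := by
  refine integrable_finsetSum _ fun i _ => ?_
  obtain ⟨C, hC⟩ := hc.exists_bound_of_continuousOn
    (continuous_polyEval (MvPolynomial.pderiv i w)).continuousOn
  have hb : ∀ᵐ x ∂(volume.restrict U), ‖polyEval (MvPolynomial.pderiv i w) x‖ ≤ C := by
    refine ae_restrict_of_ae_restrict_of_subset subset_closure ?_
    exact (ae_restrict_iff' isClosed_closure.measurableSet).2 (Filter.Eventually.of_forall hC)
  exact Integrable.mul_bdd (c := C) (hG i) (continuous_polyEval _).aestronglyMeasurable hb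

theorem gradPairing_add {U : Set 𝔼} (hc : IsCompact (closure U)) {G : Fin d → 𝔼 → ℝ}
    (hG : ∀ i, IntegrableOn (G i) U) (w w' : MvPolynomial (Fin d) ℝ) :
    gradPairing U G (w + w') = gradPairing U G w + gradPairing U G w' := by
  unfold gradPairing
  rw [← integral_add (integrable_gradPairing hc hG w) (integrable_gradPairing hc hG w')]
  refine integral_congr_ae (Filter.Eventually.of_forall fun x => ?_)
  simp only [map_add, polyEval_add, mul_add, Finset.sum_add_distrib]

theorem gradPairing_smul (U : Set 𝔼) (G : Fin d → 𝔼 → ℝ) (a : ℝ) (w : MvPolynomial (Fin d) ℝ) :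
    gradPairing U G (a • w) = a * gradPairing U G w := by
  unfold gradPairing
  rw [← integral_const_mul]
  refine integral_congr_ae (Filter.Eventually.of_forall fun x => ?_)
  have hs : ∀ i, MvPolynomial.pderiv i (a • w) = a • MvPolynomial.pderiv i w := fun i =>
    (MvPolynomial.pderiv i).map_smul a w
  simp only [Finset.mul_sum, hs, polyEval_smul]
  refine Finset.sum_congr rfl fun i _ => ?_
  ring

theorem integrableOn_polyEval {U : Set 𝔼} (hc : IsCompact (closure U))
    (q : MvPolynomial (Fin d) ℝ) : IntegrableOn (polyEval q) U :=
  ((continuous_polyEval q).continuousOn.integrableOn_compact hc).mono_set subset_closure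

/-- Existence of the elliptic projection. -/
theorem IsRegularPolytope.exists_isEllipticProjection {ρ : ℝ} {U : Set 𝔼} {𝒮 : Finset (Finset 𝔼)}
    (hU : IsRegularPolytope ρ U 𝒮) (l : ℕ) {v : 𝔼 → ℝ} (hv : IntegrableOn v U)
    (hG : ∀ i, IntegrableOn (weakDeriv U (Pi.single i 1) v) U) :
    ∃ q, IsEllipticProjection U l v q := by
  have hc := hU.isCompact_closure
  let V := polySpace d (l + 1)
  have hiq := fun q => integrableOn_polyEval hc (d := d) q
  let Λ : (Fin d → 𝔼 → ℝ) → ℝ → (MvPolynomial (Fin d) ℝ) → ℝ := fun G a w =>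
    gradPairing U G w + a * ∫ x in U, polyEval w x
  have hint_add : ∀ w w' : MvPolynomial (Fin d) ℝ, ∫ x in U, polyEval (w + w') x =
      (∫ x in U, polyEval w x) + ∫ x in U, polyEval w' x := by
    intro w w'
    rw [← integral_add (hiq w) (hiq w')]
    simp only [polyEval_add]
  have hint_smul : ∀ (a : ℝ) (w : MvPolynomial (Fin d) ℝ), ∫ x in U, polyEval (a • w) x =
      a * ∫ x in U, polyEval w x := by
    intro a w
    rw [← integral_const_mul]
    simp only [polyEval_smul]
  let dq : MvPolynomial (Fin d) ℝ → Fin d → 𝔼 → ℝ := fun q i => polyEval (MvPolynomial.pderiv i q)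
  have hsymm : ∀ q w, gradPairing U (dq q) w = gradPairing U (dq w) q := by
    intro q w
    refine integral_congr_ae (Filter.Eventually.of_forall fun x => ?_)
    exact Finset.sum_congr rfl fun i _ => mul_comm _ _
  have hga : ∀ q w w' : MvPolynomial (Fin d) ℝ, gradPairing U (dq q) (w + w') =
      gradPairing U (dq q) w + gradPairing U (dq q) w' := fun q =>
    gradPairing_add hc fun i => hiq _
  let B : V →ₗ[ℝ] V →ₗ[ℝ] ℝ := LinearMap.mk₂ ℝ
    (fun q w => Λ (dq q) (∫ x in U, polyEval (q : MvPolynomial (Fin d) ℝ) x) w)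
    (by
      intro q q' w
      simp only [Λ, Submodule.coe_add, hint_add, hsymm _ (w : MvPolynomial (Fin d) ℝ),
        hga]
      ring)
    (by
      intro a q w
      simp only [Λ, Submodule.coe_smul, hint_smul, hsymm _ (w : MvPolynomial (Fin d) ℝ),
        gradPairing_smul, smul_eq_mul]
      ring)
    (by
      intro q w w'
      simp only [Λ, Submodule.coe_add, hint_add, hga]
      ring)
    (by
      intro a q w
      simp only [Λ, Submodule.coe_smul, hint_smul, gradPairing_smul, smul_eq_mul]
      ring)
  let ℓ : V →ₗ[ℝ] ℝ :=
    { toFun := fun w => Λ (fun i => weakDeriv U (Pi.single i 1) v) (∫ x in U, v x) w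
      map_add' := by
        intro w w'
        simp only [Λ, Submodule.coe_add, hint_add, gradPairing_add hc hG]
        ring
      map_smul' := by
        intro a w
        simp only [Λ, Submodule.coe_smul, hint_smul, gradPairing_smul, smul_eq_mul,
          RingHom.id_apply]
        ring }
  have hinj : Function.Injective B := by
    rw [← LinearMap.ker_eq_bot, LinearMap.ker_eq_bot']
    rintro ⟨q, hq⟩ h0
    have h1 : gradPairing U (dq q) q + (∫ x in U, polyEval q x) * ∫ x in U, polyEval q x = 0 :=
      LinearMap.congr_fun h0 ⟨q, hq⟩
    have hnn : 0 ≤ gradPairing U (dq q) q :=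
      integral_nonneg fun x => Finset.sum_nonneg fun i _ => mul_self_nonneg _
    have hsq : (∫ x in U, polyEval q x) * ∫ x in U, polyEval q x = 0 := by
      have := mul_self_nonneg (∫ x in U, polyEval q x); linarith
    have hz : ∫ x in U, polyEval q x = 0 := mul_self_eq_zero.1 hsq
    have hg : gradPairing U (dq q) q = 0 := by linarith
    have hae := (integral_eq_zero_iff_of_nonneg
      (fun x => Finset.sum_nonneg fun i _ => mul_self_nonneg _)
      (integrable_gradPairing hc (G := dq q) (fun i => hiq _) q)).1 hg
    have hgi : ∀ i, dq q i =ᵐ[volume.restrict U] 0 := by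
      intro i
      filter_upwards [hae] with x hx
      have := (Finset.sum_eq_zero_iff_of_nonneg (fun i _ => mul_self_nonneg _)).1 hx i
        (Finset.mem_univ i)
      exact mul_self_eq_zero.1 this
    obtain ⟨K, hK, hP⟩ := exists_poincare_const d ρ
    have hgrad : HasWeakGrad U (polyEval q) (dq q) := by
      intro i
      have := isWeakDeriv_single_of_contDiff (U := U) i (contDiff_polyEval q)
      rwa [partialDeriv_polyEval] at this
    have h2 := hP U 𝒮 hU _ _ hgrad (hiq q) (fun i => hiq _) hz 1 le_rfl
    simp only [eLpNorm_congr_ae (hgi _), eLpNorm_zero, Finset.sum_const_zero, mul_zero,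
      nonpos_iff_eq_zero] at h2
    rw [eLpNorm_eq_zero_iff (continuous_polyEval q).aestronglyMeasurable one_ne_zero] at h2
    exact Subtype.ext (eq_zero_of_polyEval_eq_zero hU.isOpen hU.isConnected.nonempty
      (polyEval_eq_zero_of_ae hU.isOpen h2))
  have hsurj : Function.Surjective B :=
    (LinearMap.injective_iff_surjective_of_finrank_eq_finrank
      (Subspace.dual_finrank_eq (K := ℝ) (V := V)).symm).1 hinj
  obtain ⟨⟨q, hq⟩, hB⟩ := hsurj ℓ
  have key : ∀ w ∈ V, gradPairing U (dq q) w + (∫ x in U, polyEval q x) * (∫ x in U, polyEval w x) =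
      gradPairing U (fun i => weakDeriv U (Pi.single i 1) v) w +
        (∫ x in U, v x) * ∫ x in U, polyEval w x := fun w hw => LinearMap.congr_fun hB ⟨w, hw⟩
  have hmean : ∫ x in U, polyEval q x = ∫ x in U, v x := by
    have h1 := key 1 (mem_polySpace_succ.2 (by simp))
    have hvol : (∫ x in U, polyEval (1 : MvPolynomial (Fin d) ℝ) x) ≠ 0 := by
      simp only [polyEval, map_one, integral_const, smul_eq_mul, mul_one, measureReal_restrict_apply_univ]
      rw [measureReal_def]
      exact (ENNReal.toReal_pos (hU.isOpen.measure_pos volume hU.isConnected.nonempty).ne'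
        hU.isBounded.measure_lt_top.ne).ne'
    have hg0 : ∀ G : Fin d → 𝔼 → ℝ, gradPairing U G 1 = 0 := by
      intro G
      simp [gradPairing, polyEval]
    rw [hg0, hg0, zero_add, zero_add] at h1
    exact mul_right_cancel₀ hvol h1
  refine ⟨q, mem_polySpace_succ.1 hq, fun w hw => ?_, ?_⟩
  · have := key w (mem_polySpace_succ.2 hw)
    rw [hmean] at this
    exact add_right_cancel this
  · rw [integral_sub (hiq q) hv, hmean, sub_self]

/-- The gradient of the difference of the elliptic projection and a polynomial. -/
theorem exists_projection_gradient_bound (d l : ℕ) {ρ : ℝ} (hρ : 0 < ρ) :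
    ∃ C : ℝ, 0 < C ∧ ∀ (U : Set (EuclideanSpace ℝ (Fin d)))
      (𝒮 : Finset (Finset (EuclideanSpace ℝ (Fin d)))), IsRegularPolytope ρ U 𝒮 →
      ∀ r ∈ polySpace d (l + 1), ∀ G : Fin d → EuclideanSpace ℝ (Fin d) → ℝ,
      (∀ i, IntegrableOn (G i) U) →
      gradPairing U (fun i => polyEval (MvPolynomial.pderiv i r)) r = gradPairing U G r →
      ∀ n : ℕ, ∀ α : Fin d → ℕ, ∑ i, α i = n + 1 → ∀ x ∈ U,
        |multiDeriv α (polyEval r) x| ≤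
          C * (C / Metric.diam U) ^ n * ⨍ y in U, ∑ i, |G i y| := by
  obtain ⟨C, hC, hb⟩ := exists_polySpace_bound d (l + 1) hρ
  refine ⟨C + C * (d * C), by positivity, fun U 𝒮 hU r hr G hG hrG n => ?_⟩
  have hc := hU.isCompact_closure
  have hh := hU.diam_pos
  set P : Measure (EuclideanSpace ℝ (Fin d)) :=
    (volume.restrict U univ)⁻¹ • volume.restrict U with hP
  have hvol0 : volume.restrict U univ ≠ 0 := by
    rw [Measure.restrict_apply_univ]
    exact (hU.isOpen.measure_pos volume hU.isConnected.nonempty).ne'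
  have hvolt : volume.restrict U univ ≠ ⊤ := by
    rw [Measure.restrict_apply_univ]; exact hU.isBounded.measure_lt_top.ne
  have hprob : IsProbabilityMeasure P := by
    constructor
    rw [hP, Measure.smul_apply, smul_eq_mul, ENNReal.inv_mul_cancel hvol0 hvolt]
  have hPint : ∀ {f : EuclideanSpace ℝ (Fin d) → ℝ}, IntegrableOn f U → Integrable f P := fun hf =>
    Integrable.smul_measure hf (ENNReal.inv_ne_top.2 hvol0)
  have hPmem : ∀ᵐ x ∂P, x ∈ U :=
    Measure.ae_smul_measure (ae_restrict_mem hU.isOpen.measurableSet) _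
  change ∀ α : Fin d → ℕ, ∑ i, α i = n + 1 → ∀ x ∈ U, |multiDeriv α (polyEval r) x| ≤
    _ * (_ / Metric.diam U) ^ n * ∫ y, ∑ i, |G i y| ∂P
  set M := ∫ y, ∑ i, |G i y| ∂P with hM
  have hM0 : 0 ≤ M := integral_nonneg fun y => Finset.sum_nonneg fun i _ => abs_nonneg _
  have hb' : ∀ q ∈ polySpace d (l + 1), ∀ x ∈ U, |polyEval q x| ≤ C * ∫ y, |polyEval q y| ∂P ∧
      ∀ i, |polyEval (MvPolynomial.pderiv i q) x| ≤ C / Metric.diam U * ∫ y, |polyEval q y| ∂P :=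
    fun q hq x hx => hb U 𝒮 hU q hq x hx
  let D : Fin d → EuclideanSpace ℝ (Fin d) → ℝ := fun i => polyEval (MvPolynomial.pderiv i r)
  have hDc : ∀ i, Continuous (D i) := fun i => continuous_polyEval _
  have hDi : ∀ i, Integrable (fun y => |D i y|) P := fun i => hPint
    (((hDc i).abs.continuousOn.integrableOn_compact hc).mono_set subset_closure)
  have hD2 : ∀ i, Integrable (fun y => D i y * D i y) P := fun i => hPint
    ((((hDc i).mul (hDc i)).continuousOn.integrableOn_compact hc).mono_set subset_closure)
  let a : Fin d → ℝ := fun i => ∫ y, |D i y| ∂P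
  have ha0 : ∀ i, 0 ≤ a i := fun i => integral_nonneg fun y => abs_nonneg _
  set A := ∑ i, a i with hA
  have hA0 : 0 ≤ A := Finset.sum_nonneg fun i _ => ha0 i
  have hDmem : ∀ i, MvPolynomial.pderiv i r ∈ polySpace d (l + 1) := fun i =>
    polySpace_mono (by omega) (pderiv_mem_polySpace i hr)
  have hDA : ∀ i, ∀ x ∈ U, |D i x| ≤ C * A := by
    intro i x hx
    refine ((hb' _ (hDmem i) x hx).1).trans ?_
    gcongr
    exact Finset.single_le_sum (f := a) (fun i _ => ha0 i) (Finset.mem_univ i)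
  have hsq : ∀ i, a i ^ 2 ≤ ∫ y, D i y * D i y ∂P := by
    intro i
    have h1 : 0 ≤ ∫ y, (|D i y| - a i) ^ 2 ∂P := integral_nonneg fun y => sq_nonneg _
    have h2 : ∀ y, (|D i y| - a i) ^ 2 = D i y * D i y - 2 * a i * |D i y| + a i ^ 2 := by
      intro y
      have := abs_mul_abs_self (D i y)
      nlinarith
    simp only [h2] at h1
    have i1 : Integrable (fun y => D i y * D i y - 2 * a i * |D i y|) P :=
      (hD2 i).sub ((hDi i).const_mul _)
    rw [integral_add i1 (integrable_const _),
      integral_sub (hD2 i) ((hDi i).const_mul _), integral_const_mul, integral_const] at h1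
    simp only [probReal_univ, one_smul] at h1
    have h3 : ∫ y, |D i y| ∂P = a i := rfl
    rw [h3] at h1
    nlinarith
  have henergy : ∑ i, ∫ y, D i y * D i y ∂P ≤ C * A * M := by
    have e1 : ∑ i, ∫ y, D i y * D i y ∂P = ∫ y, ∑ i, D i y * D i y ∂P :=
      (integral_finsetSum _ fun i _ => hD2 i).symm
    have e2 : ∫ y, ∑ i, D i y * D i y ∂P = ∫ y, ∑ i, G i y * D i y ∂P := by
      rw [hP, integral_smul_measure, integral_smul_measure]
      congr 1
    rw [e1, e2, hM, ← integral_const_mul]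
    refine integral_mono_ae (hPint (integrable_gradPairing hc hG r))
      ((integrable_finsetSum _ fun i _ => (hPint (hG i)).abs).const_mul _) ?_
    filter_upwards [hPmem] with y hy
    rw [Finset.mul_sum]
    refine Finset.sum_le_sum fun i _ => (le_abs_self _).trans ?_
    rw [abs_mul, mul_comm]
    exact mul_le_mul_of_nonneg_right (hDA i y hy) (abs_nonneg _)
  have hAM : A ≤ d * C * M := by
    have h1 : A ^ 2 ≤ d * (C * A * M) := by
      calc A ^ 2 ≤ (Finset.univ : Finset (Fin d)).card * ∑ i, a i ^ 2 := sq_sum_le_card_mul_sum_sq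
        _ = d * ∑ i, a i ^ 2 := by simp
        _ ≤ d * (C * A * M) := by
            gcongr
            exact (Finset.sum_le_sum fun i _ => hsq i).trans henergy
    rcases hA0.eq_or_lt with h0 | hpos
    · rw [← h0]; positivity
    · refine le_of_mul_le_mul_right ?_ hpos
      calc A * A = A ^ 2 := by ring
        _ ≤ _ := h1
        _ = _ := by ring
  set C' := C + C * (d * C) with hC'
  have hCC' : C ≤ C' := by rw [hC']; have : 0 ≤ C * (d * C) := by positivity
                           linarith
  have hC'0 : 0 ≤ C' := hC.le.trans hCC'
  induction n with
  | zero =>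
    intro α hα x hx
    obtain ⟨β, i, hβ, rfl⟩ := exists_eq_add_single hα
    have : β = 0 := by
      funext i
      exact (Finset.sum_eq_zero_iff.1 hβ) i (Finset.mem_univ i)
    subst this
    rw [zero_add, multiDeriv_single i (contDiff_polyEval r), partialDeriv_polyEval, pow_zero,
      mul_one]
    calc |D i x| ≤ C * A := hDA i x hx
      _ ≤ C * (d * C * M) := by gcongr
      _ = C * (d * C) * M := by ring
      _ ≤ C' * M := by gcongr; rw [hC']; linarith
  | succ n ih =>
    intro α hα x hx
    obtain ⟨β, i, hβ, rfl⟩ := exists_eq_add_single hα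
    obtain ⟨q', hq', he⟩ := exists_multiDeriv_polyEval hr β
    have hβb := ih β hβ
    rw [he] at hβb
    rw [multiDeriv_add_single β i (contDiff_polyEval r),
      ← partialDeriv_multiDeriv β i (contDiff_polyEval r), he, partialDeriv_polyEval]
    have h1 := (hb' q' (polySpace_mono (Nat.sub_le _ _) hq') x hx).2 i
    have h2 : ∫ y, |polyEval q' y| ∂P ≤ C' * (C' / Metric.diam U) ^ n * M := by
      have h3 : ∫ y, |polyEval q' y| ∂P ≤ ∫ _y, C' * (C' / Metric.diam U) ^ n * M ∂P := by
        refine integral_mono_ae (hPint (((continuous_polyEval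
          q').abs.continuousOn.integrableOn_compact hc).mono_set subset_closure))
          (integrable_const _) ?_
        filter_upwards [hPmem] with y hy using hβb y hy
      simpa using h3
    calc |polyEval (MvPolynomial.pderiv i q') x| ≤ C / Metric.diam U * ∫ y, |polyEval q' y| ∂P := h1
      _ ≤ C' / Metric.diam U * (C' * (C' / Metric.diam U) ^ n * M) := by gcongr
      _ = _ := by ring

theorem eLpNorm_le_sobolevSeminorm (U : Set 𝔼) (p : ℝ≥0∞) (v : 𝔼 → ℝ) {α : Fin d → ℕ} {m : ℕ}
    (hα : ∑ i, α i = m) :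
    eLpNorm (weakDeriv U α v) p (volume.restrict U) ≤ sobolevSeminorm U m p v :=
  Finset.single_le_sum (f := fun α => eLpNorm (weakDeriv U α v) p (volume.restrict U))
    (fun _ _ => zero_le) (mem_piAntidiag_univ.2 hα)

theorem sum_eLpNorm_le_sobolevSeminorm (U : Set 𝔼) (p : ℝ≥0∞) (v : 𝔼 → ℝ) {α : Fin d → ℕ} {m : ℕ}
    (hα : ∑ i, α i = m) :
    ∑ i, eLpNorm (weakDeriv U (α + Pi.single i 1) v) p (volume.restrict U) ≤
      (d : ℝ≥0∞) * sobolevSeminorm U (m + 1) p v := by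
  calc _ ≤ ∑ _i : Fin d, sobolevSeminorm U (m + 1) p v := Finset.sum_le_sum fun i _ =>
        eLpNorm_le_sobolevSeminorm U p v (by rw [sum_add_single, hα])
    _ = _ := by simp

/-- A number of multi-indices bounding that of each order at most `s`. -/
theorem exists_card_piAntidiag_le (d s : ℕ) : ∃ N : ℕ, ∀ m ≤ s,
    (Finset.piAntidiag (Finset.univ : Finset (Fin d)) m).card ≤ N :=
  ⟨∑ m ∈ Finset.range (s + 1), (Finset.piAntidiag (Finset.univ : Finset (Fin d)) m).card,
    fun m hm => Finset.single_le_sum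
      (f := fun m => (Finset.piAntidiag (Finset.univ : Finset (Fin d)) m).card)
      (fun _ _ => Nat.zero_le _) (Finset.mem_range.2 (by omega))⟩

/-- A pointwise bound by the mean value of a function gives a bound of the norms. -/
theorem eLpNorm_le_of_abs_le_average {U : Set 𝔼} (hU : IsOpen U) (hne : U.Nonempty)
    (hb : Bornology.IsBounded U) {f : 𝔼 → ℝ} {G : Fin d → 𝔼 → ℝ}
    (hG : ∀ i, IntegrableOn (G i) U) {c : ℝ} (hc : 0 ≤ c)
    (h : ∀ x ∈ U, |f x| ≤ c * ⨍ y in U, ∑ i, |G i y|) {p : ℝ≥0∞} (hp : 1 ≤ p) :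
    eLpNorm f p (volume.restrict U) ≤
      ENNReal.ofReal c * ∑ i, eLpNorm (G i) p (volume.restrict U) := by
  have hfin : IsFiniteMeasure (volume.restrict U) :=
    ⟨by rw [Measure.restrict_apply_univ]; exact hb.measure_lt_top⟩
  have hvol : (volume.restrict U).real univ ≠ 0 := by
    rw [measureReal_def, Measure.restrict_apply_univ]
    exact (ENNReal.toReal_pos (hU.measure_pos volume hne).ne' hb.measure_lt_top.ne).ne'
  have hm : AEStronglyMeasurable (fun x => 0 * |(0 : 𝔼 → ℝ) x| + c * ∑ i, |G i x|)
      (volume.restrict U) := by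
    have : AEStronglyMeasurable (fun x => ∑ i, |G i x|) (volume.restrict U) :=
      (integrable_finsetSum _ fun i _ => (hG i).abs).aestronglyMeasurable
    simpa using this.const_mul c
  calc eLpNorm f p (volume.restrict U)
      ≤ eLpNorm (fun _ : 𝔼 => c * ⨍ y in U, ∑ i, |G i y|) p (volume.restrict U) := by
        refine eLpNorm_mono_ae ?_
        filter_upwards [ae_restrict_mem hU.measurableSet] with x hx
        exact (h x hx).trans (le_abs_self _)
    _ ≤ eLpNorm (fun x => 0 * |(0 : 𝔼 → ℝ) x| + c * ∑ i, |G i x|) p (volume.restrict U) := by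
        refine enorm_mul_rpow_le_eLpNorm hm hp _ ?_
        simp only [zero_mul, zero_add]
        rw [integral_const_mul, average_eq, smul_eq_mul]
        field_simp
    _ ≤ ENNReal.ofReal 0 * eLpNorm (0 : 𝔼 → ℝ) p (volume.restrict U) +
          ENNReal.ofReal c * ∑ i, eLpNorm (G i) p (volume.restrict U) :=
        eLpNorm_sum_abs_le aestronglyMeasurable_zero (fun i => (hG i).aestronglyMeasurable) le_rfl
          hc hp
    _ = _ := by simp

/-- Approximation properties of the elliptic projector in Sobolev seminorms. -/
theorem exists_ellipticProjector_const (d l s : ℕ) (hs : 1 ≤ s) (hsl : s ≤ l + 1) {ρ : ℝ}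
    (hρ : 0 < ρ) :
    ∃ K : ℝ, 0 < K ∧ ∀ (U : Set (EuclideanSpace ℝ (Fin d)))
      (𝒮 : Finset (Finset (EuclideanSpace ℝ (Fin d)))), IsRegularPolytope ρ U 𝒮 →
      ∀ p : ℝ≥0∞, 1 ≤ p → ∀ v, MemSobolev U s p v →
      MemSobolev U s p (v - ellipticProjector U l v) ∧ ∀ m ≤ s,
        sobolevSeminorm U m p (v - ellipticProjector U l v) ≤
          ENNReal.ofReal (K * Metric.diam U ^ (s - m)) * sobolevSeminorm U s p v := by
  obtain ⟨K₀, hK₀, hP₀⟩ := exists_poincare_const d ρ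
  obtain ⟨K₁, hK₁, hP₁⟩ := exists_iterated_poincare_const d s ρ
  obtain ⟨C, hC, hgrad⟩ := exists_projection_gradient_bound d l hρ
  obtain ⟨N, hN⟩ := exists_card_piAntidiag_le d s
  set K₂ : ℝ := (1 + K₁) ^ s + N * (C * (1 + C) ^ s * (d * (1 + K₁) ^ s)) with hK₂
  have hK₂0 : 0 < K₂ := by positivity
  refine ⟨K₂ + K₀ * (d * K₂), by positivity, fun U 𝒮 hU p hp v hv => ?_⟩
  have hh := hU.diam_pos
  have hc := hU.isCompact_closure
  set h := Metric.diam U with hhdef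
  have hv0 : IntegrableOn v U := by
    obtain ⟨w, hw, hwp⟩ := hv 0 (by simp)
    have h1 := hv.integrableOn hU.isOpen hU.isBounded hp (α := 0) (by simp)
    exact Integrable.congr h1 (weakDeriv_zero_ae_eq hU.isOpen hw.1)
  have hvG : ∀ i, IntegrableOn (weakDeriv U (Pi.single i 1) v) U := fun i =>
    hv.integrableOn hU.isOpen hU.isBounded hp (by simpa using hs)
  obtain ⟨q, hq, hqe⟩ : ∃ q, IsEllipticProjection U l v q ∧ ellipticProjector U l v = polyEval q := by
    have hex := hU.exists_isEllipticProjection l hv0 hvG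
    exact ⟨hex.choose, hex.choose_spec, by rw [ellipticProjector, dif_pos hex]⟩
  rw [hqe]
  obtain ⟨Q, hQ, hQz⟩ := hU.exists_polynomial_integral_eq hp hv
  have hQS := memSobolev_of_contDiff hc (contDiff_polyEval Q) s p
  set u := v - polyEval Q with hu
  have huS : MemSobolev U s p u := hv.sub hQS
  have huG : ∀ i, IntegrableOn (weakDeriv U (Pi.single i 1) u) U := fun i =>
    huS.integrableOn hU.isOpen hU.isBounded hp (by simpa using hs)
  set r := q - Q with hr
  have hrmem : r ∈ polySpace d (l + 1) :=
    Submodule.sub_mem _ (mem_polySpace_succ.2 hq.1) (polySpace_mono hsl hQ)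
  have hrS := memSobolev_of_contDiff hc (contDiff_polyEval r) s p
  have hvq : v - polyEval q = u - polyEval r := by
    funext x
    simp only [hu, hr, Pi.sub_apply, polyEval_sub]; ring
  have hvqS : MemSobolev U s p (v - polyEval q) := by
    rw [hvq]; exact huS.sub hrS
  refine ⟨hvqS, ?_⟩
  -- seminorm of order `s`
  have husv : sobolevSeminorm U s p u ≤ sobolevSeminorm U s p v := by
    refine Finset.sum_le_sum fun α hα => ?_
    rw [mem_piAntidiag_univ] at hα
    obtain ⟨q', hq', he⟩ := exists_multiDeriv_polyEval hQ α
    rw [hα, Nat.sub_self] at hq'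
    have hz : polyEval (0 : MvPolynomial (Fin d) ℝ) = 0 := by funext x; simp [polyEval]
    rw [eq_zero_of_mem_polySpace_zero hq', hz] at he
    refine (eLpNorm_congr_ae ?_).le
    filter_upwards [hv.weakDeriv_sub_ae_eq hU.isOpen hQS hα.le,
      weakDeriv_ae_eq_of_contDiff hU.isOpen (contDiff_polyEval Q) α] with x h1 h2
    rw [h1, Pi.sub_apply, h2, he]; simp
  have hpoin : ∀ m ≤ s, sobolevSeminorm U m p u ≤
      ENNReal.ofReal ((K₁ * h) ^ (s - m)) * sobolevSeminorm U s p v := by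
    intro m hm
    have h1 := hP₁ U 𝒮 hU p hp u huS hQz (s - m) (by omega)
    rw [Nat.sub_sub_self hm] at h1
    exact h1.trans (mul_le_mul' le_rfl husv)
  -- the energy identity
  have henergy : gradPairing U (fun i => polyEval (MvPolynomial.pderiv i r)) r =
      gradPairing U (fun i => weakDeriv U (Pi.single i 1) u) r := by
    have e0 := hq.2.1 r (mem_polySpace_succ.1 hrmem)
    have i1 := integrable_gradPairing hc
      (G := fun i => polyEval (MvPolynomial.pderiv i q)) (fun i => integrableOn_polyEval hc _) r
    have i2 := integrable_gradPairing hc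
      (G := fun i => polyEval (MvPolynomial.pderiv i Q)) (fun i => integrableOn_polyEval hc _) r
    have i3 := integrable_gradPairing hc hvG r
    have e1 : gradPairing U (fun i => polyEval (MvPolynomial.pderiv i r)) r =
        gradPairing U (fun i => polyEval (MvPolynomial.pderiv i q)) r -
          gradPairing U (fun i => polyEval (MvPolynomial.pderiv i Q)) r := by
      unfold gradPairing
      rw [← integral_sub i1 i2]
      refine integral_congr_ae (Filter.Eventually.of_forall fun x => ?_)
      simp only [← Finset.sum_sub_distrib, ← sub_mul]
      refine Finset.sum_congr rfl fun i _ => ?_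
      rw [← polyEval_sub, ← map_sub]
    have e2 : gradPairing U (fun i => weakDeriv U (Pi.single i 1) u) r =
        gradPairing U (fun i => weakDeriv U (Pi.single i 1) v) r -
          gradPairing U (fun i => polyEval (MvPolynomial.pderiv i Q)) r := by
      unfold gradPairing
      rw [← integral_sub i3 i2]
      refine integral_congr_ae ?_
      have hall : ∀ᵐ x ∂(volume.restrict U), ∀ i : Fin d, weakDeriv U (Pi.single i 1) u x =
          weakDeriv U (Pi.single i 1) v x - polyEval (MvPolynomial.pderiv i Q) x := by
        refine ae_all_iff.2 fun i => ?_
        filter_upwards [hv.weakDeriv_sub_ae_eq hU.isOpen hQS (α := Pi.single i 1)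
          (by simpa using hs), weakDeriv_ae_eq_of_contDiff hU.isOpen (contDiff_polyEval Q)
            (Pi.single i 1)] with x h1 h2
        rw [h1, Pi.sub_apply, h2, multiDeriv_single i (contDiff_polyEval Q), partialDeriv_polyEval]
      filter_upwards [hall] with x hx
      simp only [← Finset.sum_sub_distrib, ← sub_mul, hx]
    rw [e1, e2]
    congr 1
  have hsumG : ∑ i, eLpNorm (weakDeriv U (Pi.single i 1) u) p (volume.restrict U) ≤
      (d : ℝ≥0∞) * (ENNReal.ofReal ((K₁ * h) ^ (s - 1)) * sobolevSeminorm U s p v) := by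
    have h1 := sum_eLpNorm_le_sobolevSeminorm U p u (α := 0) (m := 0) (by simp)
    simp only [zero_add] at h1
    exact h1.trans (mul_le_mul' le_rfl (hpoin 1 hs))
  have hpos : ∀ m, 1 ≤ m → m ≤ s → sobolevSeminorm U m p (v - polyEval q) ≤
      ENNReal.ofReal (K₂ * h ^ (s - m)) * sobolevSeminorm U s p v := by
    intro m hm1 hms
    have hterm : ∀ α : Fin d → ℕ, ∑ i, α i = m →
        eLpNorm (weakDeriv U α (v - polyEval q)) p (volume.restrict U) ≤
          eLpNorm (weakDeriv U α u) p (volume.restrict U) +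
          ENNReal.ofReal (C * (1 + C) ^ s * (d * (1 + K₁) ^ s) * h ^ (s - m)) *
            sobolevSeminorm U s p v := by
      intro α hα
      have hr1 := fun x hx => hgrad U 𝒮 hU r hrmem _ huG henergy (m - 1) α
        (by omega) x hx
      have hr2 := eLpNorm_le_of_abs_le_average hU.isOpen hU.isConnected.nonempty hU.isBounded huG
        (by positivity) hr1 hp
      have hae : weakDeriv U α (v - polyEval q) =ᵐ[volume.restrict U]
          weakDeriv U α u - multiDeriv α (polyEval r) := by
        rw [hvq]
        filter_upwards [huS.weakDeriv_sub_ae_eq hU.isOpen hrS (α := α) (by omega),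
          weakDeriv_ae_eq_of_contDiff hU.isOpen (contDiff_polyEval r) α] with x h1 h2
        rw [h1, Pi.sub_apply, h2, Pi.sub_apply]
      rw [eLpNorm_congr_ae hae]
      refine (eLpNorm_sub_le (huS.memLp hU.isOpen (by omega)).aestronglyMeasurable
        (contDiff_multiDeriv α (contDiff_polyEval r)).continuous.aestronglyMeasurable hp).trans ?_
      gcongr
      refine hr2.trans ((mul_le_mul' le_rfl hsumG).trans ?_)
      rw [← ENNReal.ofReal_natCast, ← mul_assoc, ← mul_assoc, ← ENNReal.ofReal_mul (by positivity),
        ← ENNReal.ofReal_mul (by positivity), ← hhdef]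
      refine mul_le_mul' (ENNReal.ofReal_le_ofReal ?_) le_rfl
      have e1 : (C / h) ^ (m - 1) * h ^ (s - 1) = C ^ (m - 1) * h ^ (s - m) := by
        have : s - 1 = (m - 1) + (s - m) := by omega
        rw [this, pow_add, div_pow]; field_simp
      calc C * (C / h) ^ (m - 1) * d * (K₁ * h) ^ (s - 1)
          = C * ((C / h) ^ (m - 1) * h ^ (s - 1)) * (d * K₁ ^ (s - 1)) := by rw [mul_pow]; ring
        _ = C * C ^ (m - 1) * (d * K₁ ^ (s - 1)) * h ^ (s - m) := by rw [e1]; ring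
        _ ≤ C * (1 + C) ^ s * (d * (1 + K₁) ^ s) * h ^ (s - m) := by
            gcongr
            · calc C ^ (m - 1) ≤ (1 + C) ^ (m - 1) := by gcongr; linarith
                _ ≤ (1 + C) ^ s := pow_le_pow_right₀ (by linarith) (by omega)
            · calc K₁ ^ (s - 1) ≤ (1 + K₁) ^ (s - 1) := by gcongr; linarith
                _ ≤ (1 + K₁) ^ s := pow_le_pow_right₀ (by linarith) (by omega)
    set B := ENNReal.ofReal (C * (1 + C) ^ s * (d * (1 + K₁) ^ s) * h ^ (s - m)) *
            sobolevSeminorm U s p v with hB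
    have hsum : sobolevSeminorm U m p (v - polyEval q) ≤ sobolevSeminorm U m p u +
        ((Finset.piAntidiag (Finset.univ : Finset (Fin d)) m).card : ℝ≥0∞) * B := by
      rw [← nsmul_eq_mul, ← Finset.sum_const, sobolevSeminorm, sobolevSeminorm,
        ← Finset.sum_add_distrib]
      exact Finset.sum_le_sum fun α hα => hterm α (mem_piAntidiag_univ.1 hα)
    refine hsum.trans ?_
    have hKs : ENNReal.ofReal ((K₁ * h) ^ (s - m)) ≤
        ENNReal.ofReal ((1 + K₁) ^ s * h ^ (s - m)) := by
      refine ENNReal.ofReal_le_ofReal ?_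
      rw [mul_pow]
      gcongr
      calc K₁ ^ (s - m) ≤ (1 + K₁) ^ (s - m) := by gcongr; linarith
        _ ≤ (1 + K₁) ^ s := pow_le_pow_right₀ (by linarith) (by omega)
    calc sobolevSeminorm U m p u +
          ((Finset.piAntidiag (Finset.univ : Finset (Fin d)) m).card : ℝ≥0∞) * B
        ≤ ENNReal.ofReal ((1 + K₁) ^ s * h ^ (s - m)) * sobolevSeminorm U s p v +
          (N : ℝ≥0∞) * B := by
          gcongr
          · exact (hpoin m hms).trans (mul_le_mul' hKs le_rfl)
          · exact hN m hms
      _ = _ := by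
          rw [hB, ← ENNReal.ofReal_natCast, ← mul_assoc, ← ENNReal.ofReal_mul (by positivity),
            ← add_mul, ← ENNReal.ofReal_add (by positivity) (by positivity)]
          congr 2
          rw [hK₂]; ring
  intro m hms
  rcases Nat.eq_zero_or_pos m with rfl | hm1
  · have hmean : ∫ x in U, weakDeriv U 0 (v - polyEval q) x = 0 := by
      have hl : LocallyIntegrableOn (v - polyEval q) U :=
        (IntegrableOn.locallyIntegrableOn (hv0.sub (integrableOn_polyEval hc q)))
      rw [integral_congr_ae (weakDeriv_zero_ae_eq hU.isOpen hl)]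
      have e1 : ∫ x in U, (v - polyEval q) x = - ∫ x in U, (polyEval q x - v x) := by
        rw [← integral_neg]
        refine integral_congr_ae (Filter.Eventually.of_forall fun x => ?_)
        simp
      rw [e1, hq.2.2, neg_zero]
    have h1 := hP₀ U 𝒮 hU _ _ (hvqS.hasWeakGrad (α := 0) (by simp; omega))
      (hvqS.integrableOn hU.isOpen hU.isBounded hp (by simp))
      (fun i => hvqS.integrableOn hU.isOpen hU.isBounded hp (by simpa using hs)) hmean p hp
    have h2 := sum_eLpNorm_le_sobolevSeminorm U p (v - polyEval q) (α := 0) (m := 0) (by simp)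
    have h3 : sobolevSeminorm U 0 p (v - polyEval q) =
        eLpNorm (weakDeriv U 0 (v - polyEval q)) p (volume.restrict U) := by
      simp [sobolevSeminorm]
    rw [h3]
    refine h1.trans ((mul_le_mul' le_rfl (h2.trans (mul_le_mul' le_rfl (hpos 1 le_rfl hs)))).trans ?_)
    rw [← ENNReal.ofReal_natCast, ← mul_assoc, ← mul_assoc, ← ENNReal.ofReal_mul (by positivity),
      ← ENNReal.ofReal_mul (by positivity), ← hhdef]
    refine mul_le_mul' (ENNReal.ofReal_le_ofReal ?_) le_rfl
    have e1 : h ^ (s - 0) = h * h ^ (s - 1) := by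
      rw [← pow_succ']; congr 1; omega
    rw [e1]
    have : 0 ≤ K₂ * (h * h ^ (s - 1)) := by positivity
    nlinarith
  · refine (hpos m hm1 hms).trans ?_
    gcongr
    have : 0 ≤ K₀ * (d * K₂) := by positivity
    linarith

theorem IsTrace.aestronglyMeasurable {U : Set 𝔼} {w g : 𝔼 → ℝ} (h : IsTrace U w g) :
    AEStronglyMeasurable g (faceMeasure U) := h.1.aestronglyMeasurable

/-- Traces of the derivatives of a Sobolev function, with a bound on the broken seminorm. -/
theorem exists_faceSeminorm_const (d s : ℕ) {ρ : ℝ} (hρ : 0 < ρ) :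
    ∃ K : ℝ, 0 < K ∧ ∀ (U : Set (EuclideanSpace ℝ (Fin d)))
      (𝒮 : Finset (Finset (EuclideanSpace ℝ (Fin d)))), IsRegularPolytope ρ U 𝒮 →
      ∀ p : ℝ≥0∞, 1 ≤ p → ∀ f, MemSobolev U s p f → ∀ m < s, MemFaceSobolev U m p f ∧
        ENNReal.ofReal (Metric.diam U) ^ (1 / p).toReal * faceSeminorm U m p f ≤
          ENNReal.ofReal K * (sobolevSeminorm U m p f +
            ENNReal.ofReal (Metric.diam U) * sobolevSeminorm U (m + 1) p f) := by
  obtain ⟨K, hK, hT⟩ := exists_trace_const d hρ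
  obtain ⟨N, hN⟩ := exists_card_piAntidiag_le d s
  refine ⟨(N + 1) * (K * (d + 1)), by positivity, fun U 𝒮 hU p hp f hf m hm => ?_⟩
  have hh := hU.diam_pos
  have hbase : ∀ α : Fin d → ℕ, ∑ i, α i < s → ∃ g, IsTrace U (weakDeriv U α f) g ∧
      ENNReal.ofReal (Metric.diam U) ^ (1 / p).toReal * eLpNorm g p (faceMeasure U) ≤
        ENNReal.ofReal K * (eLpNorm (weakDeriv U α f) p (volume.restrict U) +
          ENNReal.ofReal (Metric.diam U) *
            ∑ i, eLpNorm (weakDeriv U (α + Pi.single i 1) f) p (volume.restrict U)) := by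
    intro α hα
    obtain ⟨g, hg, hgb⟩ := hT U 𝒮 hU _ _ (hf.hasWeakGrad hα)
      (hf.integrableOn hU.isOpen hU.isBounded hp hα.le)
      (fun i => hf.integrableOn hU.isOpen hU.isBounded hp (by rw [sum_add_single]; exact hα))
    exact ⟨g, hg, hgb p hp⟩
  constructor
  · intro α hα
    have hαs : ∑ i, α i < s := hα.trans_lt hm
    obtain ⟨g, hg, hgb⟩ := hbase α hαs
    refine ⟨g, hg, hg.aestronglyMeasurable, ?_⟩
    have hlt : ENNReal.ofReal (Metric.diam U) ^ (1 / p).toReal * eLpNorm g p (faceMeasure U) < ⊤ := by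
      refine hgb.trans_lt (ENNReal.mul_lt_top ENNReal.ofReal_lt_top (ENNReal.add_lt_top.2
        ⟨(hf.memLp hU.isOpen hαs.le).2, ENNReal.mul_lt_top ENNReal.ofReal_lt_top
          (ENNReal.sum_lt_top.2 fun i _ => (hf.memLp hU.isOpen ?_).2)⟩))
      rw [sum_add_single]; exact hαs
    refine lt_top_iff_ne_top.2 fun htop => ?_
    rw [htop, ENNReal.mul_top] at hlt
    · exact lt_irrefl _ hlt
    · exact (ENNReal.rpow_pos (ENNReal.ofReal_pos.2 hh) ENNReal.ofReal_ne_top).ne'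
  · rw [faceSeminorm, Finset.mul_sum]
    have hterm : ∀ α ∈ Finset.piAntidiag (Finset.univ : Finset (Fin d)) m,
        ENNReal.ofReal (Metric.diam U) ^ (1 / p).toReal *
          eLpNorm (faceTrace U (weakDeriv U α f)) p (faceMeasure U) ≤
        ENNReal.ofReal (K * (d + 1)) * (sobolevSeminorm U m p f +
            ENNReal.ofReal (Metric.diam U) * sobolevSeminorm U (m + 1) p f) := by
      intro α hα
      rw [mem_piAntidiag_univ] at hα
      obtain ⟨g, hg, hgb⟩ := hbase α (by omega)
      rw [eLpNorm_congr_ae hg.faceTrace_ae_eq]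
      refine hgb.trans ?_
      rw [ENNReal.ofReal_mul hK.le, mul_assoc]
      refine mul_le_mul' le_rfl ?_
      rw [mul_add]
      have h1 : (1 : ℝ≥0∞) ≤ ENNReal.ofReal ((d : ℝ) + 1) := by
        rw [← ENNReal.ofReal_one]
        exact ENNReal.ofReal_le_ofReal (by have : (0 : ℝ) ≤ d := Nat.cast_nonneg d
                                           linarith)
      have h2 : (d : ℝ≥0∞) ≤ ENNReal.ofReal ((d : ℝ) + 1) := by
        rw [← ENNReal.ofReal_natCast]
        exact ENNReal.ofReal_le_ofReal (by linarith)
      refine add_le_add ?_ ?_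
      · calc _ ≤ 1 * sobolevSeminorm U m p f := by
              rw [one_mul]; exact eLpNorm_le_sobolevSeminorm U p f hα
          _ ≤ _ := by gcongr
      · calc _ ≤ ENNReal.ofReal (Metric.diam U) * ((d : ℝ≥0∞) * sobolevSeminorm U (m + 1) p f) := by
              gcongr; exact sum_eLpNorm_le_sobolevSeminorm U p f hα
          _ = (d : ℝ≥0∞) * (ENNReal.ofReal (Metric.diam U) * sobolevSeminorm U (m + 1) p f) := by
              ring
          _ ≤ _ := by gcongr
    refine (Finset.sum_le_sum hterm).trans ?_
    rw [Finset.sum_const, nsmul_eq_mul, ← mul_assoc]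
    refine mul_le_mul' ?_ le_rfl
    rw [← ENNReal.ofReal_natCast, ← ENNReal.ofReal_mul (by positivity)]
    refine ENNReal.ofReal_le_ofReal ?_
    have : ((Finset.piAntidiag (Finset.univ : Finset (Fin d)) m).card : ℝ) ≤ N := by
      exact_mod_cast hN m hm.le
    gcongr
    linarith

end

theorem theorem2 (d : ℕ) (hd : 1 ≤ d) (ρ : ℝ) (hρ : 0 < ρ) (l s : ℕ) (hs : 1 ≤ s) (hsl : s ≤ l + 1)
    (p : ℝ≥0∞) (hp : 1 ≤ p) :
    ∃ C : ℝ, 0 < C ∧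
      ∀ (U : Set (EuclideanSpace ℝ (Fin d))) (𝒮 : Finset (Finset (EuclideanSpace ℝ (Fin d)))),
        IsConnected U →
        IsSimplicialPartition U 𝒮 →
        (∀ S ∈ 𝒮,
          ρ ^ 2 * Metric.diam U ≤
            ρ * Metric.diam (convexHull ℝ (S : Set (EuclideanSpace ℝ (Fin d)))) ∧
          ρ * Metric.diam (convexHull ℝ (S : Set (EuclideanSpace ℝ (Fin d)))) ≤
            setInradius (convexHull ℝ (S : Set (EuclideanSpace ℝ (Fin d))))) →
        ∀ m : ℕ, m ≤ s - 1 → ∀ v : EuclideanSpace ℝ (Fin d) → ℝ, MemSobolev U s p v →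
          MemFaceSobolev U m p (v - ellipticProjector U l v) ∧
          ENNReal.ofReal (Metric.diam U) ^ (1 / p).toReal *
              faceSeminorm U m p (v - ellipticProjector U l v) ≤
            ENNReal.ofReal (C * Metric.diam U ^ (s - m)) * sobolevSeminorm U s p v := by
  obtain ⟨K, hK, hface⟩ := exists_faceSeminorm_const d s hρ
  obtain ⟨L, hL, hproj⟩ := exists_ellipticProjector_const d l s hs hsl hρ
  refine ⟨K * (L + L), by positivity, fun U 𝒮 hconn hpart hreg m hm v hv => ?_⟩
  have hU : IsRegularPolytope ρ U 𝒮 :=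
    ⟨hd, hρ, hconn, hpart, fun S hS => (hreg S hS).1.trans (hreg S hS).2⟩
  have hh := hU.diam_pos
  obtain ⟨hmem, hbound⟩ := hproj U 𝒮 hU p hp v hv
  obtain ⟨h1, h2⟩ := hface U 𝒮 hU p hp _ hmem m (by omega)
  refine ⟨h1, h2.trans ?_⟩
  have h3 := hbound m (by omega)
  have h4 := hbound (m + 1) (by omega)
  have e : s - m = (s - (m + 1)) + 1 := by omega
  calc _ ≤ ENNReal.ofReal K *
        (ENNReal.ofReal (L * Metric.diam U ^ (s - m)) * sobolevSeminorm U s p v +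
          ENNReal.ofReal (Metric.diam U) *
            (ENNReal.ofReal (L * Metric.diam U ^ (s - (m + 1))) * sobolevSeminorm U s p v)) :=
        mul_le_mul' le_rfl (add_le_add h3 (mul_le_mul' le_rfl h4))
    _ = ENNReal.ofReal (K * (L + L) * Metric.diam U ^ (s - m)) * sobolevSeminorm U s p v := by
        rw [← mul_assoc (ENNReal.ofReal (Metric.diam U)), ← add_mul, ← mul_assoc,
          ← ENNReal.ofReal_mul hh.le, ← ENNReal.ofReal_add (by positivity) (by positivity),
          ← ENNReal.ofReal_mul hK.le]
        congr 2
        rw [e, pow_succ]; ring
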